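/- Let $S^3\subset\mathbb C^2$ be the unit sphere with the contact form $\lambda=\frac i4\sum_k(z_k\,d\bar z_k-\bar z_k\,dz_k)|_{S^3}=\frac12\sum_k (x_k\,dy_k-y_k\,dx_k)|_{S^3}$, let $G\subset SU(2)$ be a finite subgroup, acting linearly on $S^3$, let $\pi_G:S^3\to S^3/G$ be the quotient map, and let $\lambda_G$ be the contact form on $S^3/G$ with $\pi_G^*\lambda_G=\lambda$. Let $P:SU(2)\to SO(3)$ be the double cover, $H=P(G)$, let $\mathfrak P:S^3\to S^2$, $(\alpha,\beta)\mapsto(|\alpha|^2-|\beta|^2,-2\,\mathrm{Im}(\bar\alpha\beta),-2\,\mathrm{Re}(\bar\alpha\beta))$, be the Hopf fibration, and let $\mathfrak p:S^3/G\to S^2/H$ be the map it induces. Let $f:S^2\to\mathbb R$ be an $H$-invariant (smooth) Morse function, $f_H:S^2/H\to\mathbb R$ its descent; an orbifold critical point of $f_H$ is the image in $S^2/H$ of a critical point of $f$. Put $\lambda_{G,\varepsilon}=(1+\varepsilon\,\mathfrak p^*f_H)\lambda_G$ and $\lambda_\varepsilon=(1+\varepsilon f\circ\mathfrak P)\lambda$.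 For a critical point $p$ of $f$ and $z\in\mathfrak P^{-1}(p)$ let $\gamma_p(t)=e^{2it/(1+\varepsilon f(p))}z$, the embedded Reeb orbit of $\lambda_\varepsilon$ through $z$, of period $\pi(1+\varepsilon f(p))$, and let $\gamma_p^k$ be its $k$-fold iterate. A Reeb orbit $\gamma:\mathbb R/T\mathbb Z\to Y$ of a contact form has action $T$; it is nondegenerate if $1$ is not an eigenvalue of the time-$T$ linearized Reeb flow restricted to the contact plane at $\gamma(0)$. Conley–Zehnder indices $\mu_{CZ}$ on $S^3/G$ are taken with respect to the global trivialization of $\xi_G=\ker\lambda_G$ induced by the left-invariant vector fields $V_1(\alpha,\beta)=(-\bar\beta,\bar\alpha)$, $V_2=iV_1$ on $S^3=SU(2)$. Then for each $L>0$ there is $\varepsilon_0>0$ such that, for all $\varepsilon\in(0,\varepsilon_0]$, every Reeb orbit $\gamma$ of $\lambda_{G,\varepsilon}$ with action less than $L$ is nondegenerate and projects under $\mathfrak p$ to an orbifold critical point of $f_H$. If moreover $\gamma$ is contractible, then it lifts to some $\gamma_p^k$ in $S^3$ with $p$ a critical point of $f$ and $k\ge1$, and for every such lift $$\mu_{CZ}(\gamma)=4k+\mathrm{ind}_f(p)-1,$$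 where $\mathrm{ind}_f(p)$ is the Morse index of $f$ at $p$. -/

import Mathlib

open scoped Manifold ContDiff Topology

noncomputable section

namespace SphereQuotient

/-! ### The groups `SU(2)`, `SO(3)`, the spheres `S³ ⊂ ℂ²`, `S² ⊂ ℝ³` and the double cover -/

/-- `ℂ²`. -/
abbrev C2 : Type := EuclideanSpace ℂ (Fin 2)

/-- The unit sphere `S³ ⊂ ℂ²`. -/
abbrev S3 : Type := Metric.sphere (0 : C2) 1

/-- The unit sphere `S² ⊂ ℝ³`. -/
abbrev S2 : Type := Metric.sphere (0 : EuclideanSpace ℝ (Fin 3)) 1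

abbrev SU2 : Type := Matrix.specialUnitaryGroup (Fin 2) ℂ

abbrev SO3 : Type := Matrix.specialOrthogonalGroup (Fin 3) ℝ

/-- The real-bilinear pairing `⟪z, v⟫ = ∑ conj(z_k) v_k`. Its real part is the Euclidean inner
product of `ℝ⁴`, its imaginary part is the standard symplectic form `∑ dx_k ∧ dy_k`. -/
abbrev herm (z v : C2) : ℂ := inner ℂ z v

lemma herm_eq (z v : C2) :
    herm z v = (starRingEnd ℂ) (z 0) * v 0 + (starRingEnd ℂ) (z 1) * v 1 := by
  simp [herm, PiLp.inner_apply, Fin.sum_univ_two, mul_comm]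

lemma S3.herm_self (z : S3) : herm z z = 1 := by
  have h : ‖(z : C2)‖ = 1 := mem_sphere_zero_iff_norm.1 z.2
  simp [herm, inner_self_eq_norm_sq_to_K, h]

lemma SU2.star_eq_adjugate (A : SU2) : star (A : Matrix (Fin 2) (Fin 2) ℂ) = (A.1).adjugate := by
  have h1 : A.1 * star A.1 = 1 := Matrix.mem_unitaryGroup_iff.1 A.2.1
  have h2 : (A.1).adjugate * A.1 = 1 := by
    rw [Matrix.adjugate_mul, (Matrix.mem_specialUnitaryGroup_iff.1 A.2).2, one_smul]
  calc star A.1 = ((A.1).adjugate * A.1) * star A.1 := by rw [h2, one_mul]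
    _ = (A.1).adjugate := by rw [mul_assoc, h1, mul_one]

lemma SU2.apply_one_one (A : SU2) : A.1 1 1 = (starRingEnd ℂ) (A.1 0 0) := by
  have := congrFun (congrFun (SU2.star_eq_adjugate A) 0) 0
  simpa [Matrix.adjugate_fin_two, Matrix.star_apply] using this.symm

lemma SU2.apply_zero_one (A : SU2) : A.1 0 1 = -(starRingEnd ℂ) (A.1 1 0) := by
  have := congrFun (congrFun (SU2.star_eq_adjugate A) 0) 1
  simp [Matrix.adjugate_fin_two, Matrix.star_apply] at this
  simp [this]

lemma SU2.normSq_add (A : SU2) :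
    Complex.normSq (A.1 0 0) + Complex.normSq (A.1 1 0) = 1 := by
  have h := (Matrix.mem_specialUnitaryGroup_iff.1 A.2).2
  rw [Matrix.det_fin_two, SU2.apply_one_one, SU2.apply_zero_one, Complex.mul_conj] at h
  have h3 : -(starRingEnd ℂ) (A.1 1 0) * A.1 1 0 = -(Complex.normSq (A.1 1 0) : ℂ) := by
    rw [neg_mul, mul_comm, Complex.mul_conj]
  rw [h3, sub_neg_eq_add] at h
  exact_mod_cast h

/-- `SU(2)` acting linearly on `ℂ²`. -/
def actC2 (A : SU2) (v : C2) : C2 := WithLp.toLp 2 (A.1.mulVec v.ofLp)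

lemma actC2_zero (A : SU2) (v : C2) :
    actC2 A v 0 = A.1 0 0 * v 0 - (starRingEnd ℂ) (A.1 1 0) * v 1 := by
  simp [actC2, SU2.apply_zero_one]
  ring

lemma actC2_one (A : SU2) (v : C2) :
    actC2 A v 1 = A.1 1 0 * v 0 + (starRingEnd ℂ) (A.1 0 0) * v 1 := by
  simp [actC2, SU2.apply_one_one]

lemma one_actC2 (v : C2) : actC2 1 v = v := by
  simp [actC2]

lemma mul_actC2 (A B : SU2) (v : C2) : actC2 (A * B) v = actC2 A (actC2 B v) := by
  show WithLp.toLp 2 ((A.1 * B.1).mulVec v.ofLp) = WithLp.toLp 2 (A.1.mulVec (B.1.mulVec v.ofLp))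
  rw [Matrix.mulVec_mulVec]

lemma herm_actC2 (A : SU2) (z v : C2) : herm (actC2 A z) (actC2 A v) = herm z v := by
  have h : (starRingEnd ℂ) (A.1 0 0) * A.1 0 0 + (starRingEnd ℂ) (A.1 1 0) * A.1 1 0 = 1 := by
    rw [mul_comm, Complex.mul_conj, mul_comm ((starRingEnd ℂ) (A.1 1 0)), Complex.mul_conj]
    exact_mod_cast SU2.normSq_add A
  rw [herm_eq, herm_eq, actC2_zero, actC2_zero, actC2_one, actC2_one]
  simp only [map_sub, map_add, map_mul, Complex.conj_conj]
  linear_combination ((starRingEnd ℂ) (z 0) * v 0 + (starRingEnd ℂ) (z 1) * v 1) * h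

lemma mem_S3_iff (z : C2) : z ∈ Metric.sphere (0 : C2) 1 ↔ herm z z = 1 := by
  rw [mem_sphere_zero_iff_norm, herm, inner_self_eq_norm_sq_to_K]
  constructor
  · intro h; simp [h]
  · intro h
    have h2 : ‖z‖ ^ 2 = 1 := Complex.ofReal_injective (by rw [Complex.ofReal_pow]; simpa using h)
    nlinarith [norm_nonneg z]

/-- The action of `SU(2)` on `S³`. -/
instance : MulAction SU2 S3 where
  smul A z := ⟨actC2 A z, (mem_S3_iff _).2 (by rw [herm_actC2]; exact S3.herm_self z)⟩
  one_smul z := Subtype.ext (one_actC2 _)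
  mul_smul A B z := Subtype.ext (mul_actC2 A B _)

lemma coe_smul_S3 (A : SU2) (z : S3) : ((A • z : S3) : C2) = actC2 A z := rfl

/-- The action of `SO(3)` on `S²`. -/
instance : MulAction SO3 S2 where
  smul B x := ⟨WithLp.toLp 2 (B.1.mulVec x.1.ofLp), by
    have hx : ‖x.1‖ = 1 := mem_sphere_zero_iff_norm.1 x.2
    have hB : B.1.transpose * B.1 = 1 := by
      exact (Matrix.mem_orthogonalGroup_iff' _ _).1 B.2.1
    rw [mem_sphere_zero_iff_norm]
    have h : ‖(WithLp.toLp 2 (B.1.mulVec x.1.ofLp) : EuclideanSpace ℝ (Fin 3))‖ ^ 2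
        = ‖x.1‖ ^ 2 := by
      have key : ∀ u : Fin 3 → ℝ, ‖(WithLp.toLp 2 u : EuclideanSpace ℝ (Fin 3))‖ ^ 2
          = u ⬝ᵥ u := by
        intro u
        rw [EuclideanSpace.norm_sq_eq]; simp [dotProduct, sq]
      have hx' : x.1 = WithLp.toLp 2 x.1.ofLp := rfl
      rw [key, hx', key, Matrix.dotProduct_mulVec, ← Matrix.mulVec_transpose,
        Matrix.mulVec_mulVec, hB, Matrix.one_mulVec]
    rw [hx] at h
    nlinarith [norm_nonneg (WithLp.toLp 2 (B.1.mulVec x.1.ofLp) : EuclideanSpace ℝ (Fin 3))]⟩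
  one_smul x := Subtype.ext (by
    show WithLp.toLp 2 ((1 : SO3).1.mulVec x.1.ofLp) = x.1
    simp)
  mul_smul B C x := Subtype.ext (by
    show WithLp.toLp 2 ((B * C).1.mulVec x.1.ofLp)
      = WithLp.toLp 2 (B.1.mulVec (C.1.mulVec x.1.ofLp))
    simp [Matrix.mulVec_mulVec])

lemma coe_smul_S2 (B : SO3) (x : S2) :
    ((B • x : S2) : EuclideanSpace ℝ (Fin 3)).ofLp = B.1.mulVec x.1.ofLp := rfl

/-- The matrix of the rotation attached to the element of `SU(2)` with first column `(α, β)`. -/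
def rotMatrix (α β : ℂ) : Matrix (Fin 3) (Fin 3) ℝ :=
  !![Complex.normSq α - Complex.normSq β, 2 * (α * β).im, 2 * (α * β).re;
    -2 * ((starRingEnd ℂ) α * β).im, (α ^ 2 + β ^ 2).re, -(α ^ 2 + β ^ 2).im;
    -2 * ((starRingEnd ℂ) α * β).re, (α ^ 2 - β ^ 2).im, (α ^ 2 - β ^ 2).re]

lemma rotMatrix_mul (a b c d : ℂ) :
    rotMatrix (a * c - (starRingEnd ℂ) b * d) (b * c + (starRingEnd ℂ) a * d)
      = rotMatrix a b * rotMatrix c d := by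
  ext i j
  fin_cases i <;> fin_cases j <;>
    simp [rotMatrix, Matrix.mul_apply, Fin.sum_univ_three, Complex.normSq_apply, sq] <;> ring

lemma rotMatrix_mem (a b : ℂ) (h : Complex.normSq a + Complex.normSq b = 1) :
    rotMatrix a b ∈ Matrix.specialOrthogonalGroup (Fin 3) ℝ := by
  rw [Complex.normSq_apply, Complex.normSq_apply] at h
  have hs : ∀ r : ℝ, r = (a.re * a.re + a.im * a.im + (b.re * b.re + b.im * b.im)) ^ 2 → r = 1 := by
    intro r hr; rw [hr, h]; norm_num
  rw [Matrix.mem_specialOrthogonalGroup_iff, Matrix.mem_orthogonalGroup_iff]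
  constructor
  · ext i j
    fin_cases i <;> fin_cases j <;>
      simp [rotMatrix, Matrix.mul_apply, Fin.sum_univ_three, Complex.normSq_apply, sq] <;>
      first | (apply hs; ring1) | ring1
  · have h3 : (rotMatrix a b).det
        = (a.re * a.re + a.im * a.im + (b.re * b.re + b.im * b.im)) ^ 3 := by
      rw [Matrix.det_fin_three]
      simp [rotMatrix, Complex.normSq_apply, sq]
      ring
    rw [h3, h]; norm_num

/-- The double cover of Lie groups `P : SU(2) → SO(3)`. -/
def P : SU2 →* SO3 where
  toFun A := ⟨rotMatrix (A.1 0 0) (A.1 1 0), rotMatrix_mem _ _ (SU2.normSq_add A)⟩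
  map_one' := Subtype.ext (by
    ext i j
    fin_cases i <;> fin_cases j <;> simp [rotMatrix])
  map_mul' A B := Subtype.ext (by
    have h0 : (A * B).1 0 0 = A.1 0 0 * B.1 0 0 - (starRingEnd ℂ) (A.1 1 0) * B.1 1 0 := by
      simp [Matrix.mul_apply, Fin.sum_univ_two, SU2.apply_zero_one]; ring
    have h1 : (A * B).1 1 0 = A.1 1 0 * B.1 0 0 + (starRingEnd ℂ) (A.1 0 0) * B.1 1 0 := by
      simp [Matrix.mul_apply, Fin.sum_univ_two, SU2.apply_one_one]
    show rotMatrix ((A * B).1 0 0) ((A * B).1 1 0)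
      = rotMatrix (A.1 0 0) (A.1 1 0) * rotMatrix (B.1 0 0) (B.1 1 0)
    rw [h0, h1, rotMatrix_mul])

/-- The Hopf fibration `𝔓 : S³ → S²`,
`(α, β) ↦ (|α|² - |β|², -2 Im(conj α β), -2 Re(conj α β))`. -/
def hopf (z : S3) : S2 :=
  ⟨!₂[Complex.normSq (z.1 0) - Complex.normSq (z.1 1),
      -2 * ((starRingEnd ℂ) (z.1 0) * z.1 1).im,
      -2 * ((starRingEnd ℂ) (z.1 0) * z.1 1).re], by
    have h := S3.herm_self z
    rw [herm_eq, mul_comm, Complex.mul_conj, mul_comm ((starRingEnd ℂ) (z.1 1)),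
      Complex.mul_conj] at h
    have h' : Complex.normSq (z.1 0) + Complex.normSq (z.1 1) = 1 := by exact_mod_cast h
    rw [Complex.normSq_apply, Complex.normSq_apply] at h'
    rw [mem_sphere_zero_iff_norm]
    have h2 : ‖(!₂[Complex.normSq (z.1 0) - Complex.normSq (z.1 1),
      -2 * ((starRingEnd ℂ) (z.1 0) * z.1 1).im,
      -2 * ((starRingEnd ℂ) (z.1 0) * z.1 1).re] : EuclideanSpace ℝ (Fin 3))‖ ^ 2 =
      ((z.1 0).re * (z.1 0).re + (z.1 0).im * (z.1 0).im
        + ((z.1 1).re * (z.1 1).re + (z.1 1).im * (z.1 1).im)) ^ 2 := by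
      rw [EuclideanSpace.norm_sq_eq]
      simp [Fin.sum_univ_three, Complex.normSq_apply]
      ring
    rw [h'] at h2
    nlinarith [norm_nonneg (!₂[Complex.normSq (z.1 0) - Complex.normSq (z.1 1),
      -2 * ((starRingEnd ℂ) (z.1 0) * z.1 1).im,
      -2 * ((starRingEnd ℂ) (z.1 0) * z.1 1).re] : EuclideanSpace ℝ (Fin 3))]⟩

lemma hopf_smul (A : SU2) (z : S3) : hopf (A • z) = P A • hopf z := by
  apply Subtype.ext
  ext i
  have h0 : (A • z : S3).1 0 = A.1 0 0 * z.1 0 - (starRingEnd ℂ) (A.1 1 0) * z.1 1 :=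
    actC2_zero A z
  have h1 : (A • z : S3).1 1 = A.1 1 0 * z.1 0 + (starRingEnd ℂ) (A.1 0 0) * z.1 1 :=
    actC2_one A z
  rw [coe_smul_S2]
  simp only [hopf, h0, h1, P, MonoidHom.coe_mk, OneHom.coe_mk]
  fin_cases i <;>
    simp [rotMatrix, Matrix.mulVec, dotProduct, Fin.sum_univ_three, Complex.normSq_apply, sq] <;>
    ring

/-! ### The quotients `S³/G`, `S²/H` and the maps between them -/

/-- The quotient manifold `S³/G`, with the quotient topology. -/
abbrev S3Mod (G : Subgroup SU2) : Type := Quotient (MulAction.orbitRel G S3)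

/-- The orbit space `S²/H`. -/
abbrev S2Mod (H : Subgroup SO3) : Type := Quotient (MulAction.orbitRel H S2)

/-- `π_G : S³ → S³/G`. -/
def projS3 (G : Subgroup SU2) (z : S3) : S3Mod G := Quotient.mk _ z

/-- `π_H : S² → S²/H`. -/
def projS2 (H : Subgroup SO3) (x : S2) : S2Mod H := Quotient.mk _ x

/-- `𝔭 : S³/G → S²/H`, the map induced by the Hopf fibration, where `H = P(G)`. -/
def seifert (G : Subgroup SU2) : S3Mod G → S2Mod (G.map P) :=
  Quotient.lift (fun z => projS2 (G.map P) (hopf z)) (by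
    rintro a b ⟨g, rfl⟩
    refine Quotient.sound ⟨⟨P g.1, Subgroup.mem_map_of_mem P g.2⟩, ?_⟩
    exact (hopf_smul g.1 b).symm)

/-- The function `f_H : S²/H → ℝ` to which an `H`-invariant function `f` on `S²` descends. -/
def descend (H : Subgroup SO3) (f : S2 → ℝ) (hf : ∀ h ∈ H, ∀ x, f (h • x) = f x) :
    S2Mod H → ℝ :=
  Quotient.lift f (by
    rintro a b ⟨h, rfl⟩
    exact hf h.1 h.2 b)

/-- The tangent bundle `TS³`: pairs `(z, v)` with `z ∈ S³` and `v ∈ ℂ² = ℝ⁴` orthogonal to `z`. -/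
abbrev TS3 : Type := {p : S3 × C2 // (herm p.1 p.2).re = 0}

/-- The derivative of the action of `SU(2)` on `S³`. -/
instance : MulAction SU2 TS3 where
  smul A p := ⟨(A • p.1.1, actC2 A p.1.2), by
    show (herm (actC2 A p.1.1) (actC2 A p.1.2)).re = 0
    rw [herm_actC2]; exact p.2⟩
  one_smul p := Subtype.ext (Prod.ext (one_smul _ _) (one_actC2 _))
  mul_smul A B p := Subtype.ext (Prod.ext (mul_smul _ _ _) (mul_actC2 A B _))

lemma smul_TS3_fst (A : SU2) (p : TS3) : (A • p).1.1 = A • p.1.1 := rfl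

lemma smul_TS3_snd (A : SU2) (p : TS3) : (A • p).1.2 = actC2 A p.1.2 := rfl

/-- The tangent bundle of the quotient manifold, `T(S³/G) = TS³/G` (`G` acts freely on `S³`, and
`π_G` is a local diffeomorphism). -/
abbrev TS3Mod (G : Subgroup SU2) : Type := Quotient (MulAction.orbitRel G TS3)

/-- The derivative `dπ_G : TS³ → T(S³/G)`. -/
def dprojS3 (G : Subgroup SU2) (p : TS3) : TS3Mod G := Quotient.mk _ p

/-- The curve `c` in `S³/G` is differentiable at time `t` with velocity `X ∈ T(S³/G)`: near `t` it
has a lift to `S³` that is differentiable at `t` with velocity representing `X`. -/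
def HasVelocityAt (G : Subgroup SU2) (c : ℝ → S3Mod G) (X : TS3Mod G) (t : ℝ) : Prop :=
  ∃ (b : ℝ → S3) (p : TS3), (∀ᶠ s in 𝓝 t, projS3 G (b s) = c s) ∧ b t = p.1.1 ∧
    HasDerivAt (fun s => (b s : C2)) p.1.2 t ∧ X = dprojS3 G p

/-! ### One-forms and Reeb dynamics -/

/-- The radial projection `ℂ² \ {0} → S³` (with an irrelevant value at the origin). -/
def radial (w : C2) : S3 :=
  open Classical in
  if h : w = 0 then ⟨EuclideanSpace.single 0 1, by simp⟩
  else ⟨((‖w‖⁻¹ : ℝ) : ℂ) • w, by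
    rw [mem_sphere_zero_iff_norm, norm_smul]
    simp [h]⟩

/-- The orthogonal projection of `v ∈ ℂ² = ℝ⁴` to the tangent space `T_z S³`. -/
def tangentProj (z : S3) (v : C2) : TS3 :=
  ⟨(z, v - ((herm z v).re : ℂ) • (z : C2)), by
    have h : herm (z : C2) (v - ((herm z v).re : ℂ) • (z : C2))
        = herm z v - ((herm z v).re : ℂ) * herm z z := by
      simp only [herm, inner_sub_right, inner_smul_right]
    show (herm (z : C2) (v - ((herm z v).re : ℂ) • (z : C2))).re = 0
    rw [h, S3.herm_self]
    simp⟩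

/-- The pullback of a 1-form on `S³` to `ℂ² \ {0}` under the radial projection `r`, evaluated at
`w` on `v`; note `dr_w v = ‖w‖⁻¹ • (projection of v to the tangent space of S³ at r w)`. -/
def radialPullback (a : TS3 → ℝ) (w v : C2) : ℝ :=
  a (tangentProj (radial w) (((‖w‖⁻¹ : ℝ) : ℂ) • v))

/-- The exterior derivative of a 1-form `a` on `S³`, evaluated on tangent vectors `u`, `v` at `z`.
It is computed from the pullback of `a` to `ℂ² \ {0}` by `dA(u, v) = D_u (A v) - D_v (A u)`;
restricting to `TS³` recovers `da`, as the radial projection is the identity on `S³`. -/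
def extDerivS3 (a : TS3 → ℝ) (z : S3) (u v : C2) : ℝ :=
  fderiv ℝ (fun w => radialPullback a w v) z u - fderiv ℝ (fun w => radialPullback a w u) z v

/-- `X ∈ T(S³/G)` is a value of the Reeb vector field of the 1-form `α` on `S³/G`: `α(X) = 1` and
`dα(X, ·) = 0`. The form `dα` is read off upstairs: `dα (dπ_G u, dπ_G v) = d(π_G^* α)(u, v)`. -/
def IsReebVector (G : Subgroup SU2) (α : TS3Mod G → ℝ) (X : TS3Mod G) : Prop :=
  α X = 1 ∧ ∃ p : TS3, X = dprojS3 G p ∧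
    ∀ v : C2, (herm p.1.1 v).re = 0 → extDerivS3 (fun q => α (dprojS3 G q)) p.1.1 p.1.2 v = 0

/-- `γ : ℝ → S³/G` is an integral curve of the Reeb vector field of `α`. -/
def IsReebTrajectory (G : Subgroup SU2) (α : TS3Mod G → ℝ) (γ : ℝ → S3Mod G) : Prop :=
  ∀ t, ∃ X, HasVelocityAt G γ X t ∧ IsReebVector G α X

/-- `γ : ℝ/Tℤ → S³/G`, given as a `T`-periodic map on `ℝ`, is a (parametrized) Reeb orbit of `α`.
Its action `∫_γ α` is `T`, because `α` is `1` on the Reeb vector field. -/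
def IsReebOrbit (G : Subgroup SU2) (α : TS3Mod G → ℝ) (γ : ℝ → S3Mod G) (T : ℝ) : Prop :=
  0 < T ∧ Function.Periodic γ T ∧ IsReebTrajectory G α γ

/-- `φ` is the Reeb flow of `α`. -/
def IsReebFlow (G : Subgroup SU2) (α : TS3Mod G → ℝ) (φ : ℝ → S3Mod G → S3Mod G) : Prop :=
  ∀ q, φ 0 q = q ∧ IsReebTrajectory G α (fun t => φ t q)

/-! ### The trivialization `τ_G` and the linearized flow -/

/-- `η₁ V₁(z) + η₂ V₂(z)` where `V₁(α, β) = (-conj β, conj α)` and `V₂ = i V₁` are the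
left-invariant vector fields on `S³ = SU(2)` spanning the contact planes. -/
def frame (z : S3) (η : Fin 2 → ℝ) : C2 :=
  ((η 0 : ℂ) + (η 1 : ℂ) * Complex.I) •
    (!₂[-(starRingEnd ℂ) (z.1 1), (starRingEnd ℂ) (z.1 0)] : C2)

lemma herm_frame (z : S3) (η : Fin 2 → ℝ) : herm z (frame z η) = 0 := by
  rw [herm_eq]
  simp [frame]
  ring

lemma frame_smul (A : SU2) (z : S3) (η : Fin 2 → ℝ) :
    frame (A • z) η = actC2 A (frame z η) := by
  have h0 : (A • z : S3).1 0 = A.1 0 0 * z.1 0 - (starRingEnd ℂ) (A.1 1 0) * z.1 1 :=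
    actC2_zero A z
  have h1 : (A • z : S3).1 1 = A.1 1 0 * z.1 0 + (starRingEnd ℂ) (A.1 0 0) * z.1 1 :=
    actC2_one A z
  ext i
  fin_cases i
  · show frame (A • z) η 0 = actC2 A (frame z η) 0
    rw [actC2_zero]
    simp only [frame, h0, h1]
    simp
    ring
  · show frame (A • z) η 1 = actC2 A (frame z η) 1
    rw [actC2_one]
    simp only [frame, h0, h1]
    simp
    ring

/-- The global trivialization `τ : S³ × ℝ² → ξ` of the contact structure. -/
def triv (z : S3) (η : Fin 2 → ℝ) : TS3 :=
  ⟨(z, frame z η), by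
    show (herm z (frame z η)).re = 0
    rw [herm_frame]; simp⟩

/-- The global trivialization `τ_G : S³/G × ℝ² → ξ_G`, the descent of `τ`. -/
def trivMod (G : Subgroup SU2) (q : S3Mod G) (η : Fin 2 → ℝ) : TS3Mod G :=
  Quotient.lift (fun z => dprojS3 G (triv z η)) (by
    rintro a b ⟨g, rfl⟩
    refine Quotient.sound ⟨g, ?_⟩
    exact Subtype.ext (Prod.ext rfl (frame_smul g.1 b η).symm)) q

/-- `N t` is the matrix, in the trivialization `τ_G`, of the linearized flow
`dφ^t : ξ_q → ξ_{φ^t q}`. (The differential of `φ^t` maps the velocity of a curve through `q` to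
the velocity of its image under `φ^t`.) -/
def IsLinearizedFlow (G : Subgroup SU2) (φ : ℝ → S3Mod G → S3Mod G) (q : S3Mod G)
    (N : ℝ → Matrix (Fin 2) (Fin 2) ℝ) : Prop :=
  ∀ (t : ℝ) (η : Fin 2 → ℝ) (c : ℝ → S3Mod G), HasVelocityAt G c (trivMod G q η) 0 →
    HasVelocityAt G (fun s => φ t (c s)) (trivMod G (φ t q) ((N t).mulVec η)) 0

/-- `N` is the linearized Reeb flow of `α` along the orbit `γ`, as a path of matrices with respect
to `τ_G`. -/
def IsLinearizedReebFlow (G : Subgroup SU2) (α : TS3Mod G → ℝ) (γ : ℝ → S3Mod G)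
    (N : ℝ → Matrix (Fin 2) (Fin 2) ℝ) : Prop :=
  ∃ φ, IsReebFlow G α φ ∧ IsLinearizedFlow G φ (γ 0) N

/-- The Reeb orbit `γ` of period `T` is nondegenerate: `1` is not an eigenvalue of the linearized
return map `P_γ = dφ^T : ξ_{γ(0)} → ξ_{γ(0)}`, here written as a matrix in `τ_G`. -/
def IsNondegenerateOrbit (G : Subgroup SU2) (α : TS3Mod G → ℝ) (γ : ℝ → S3Mod G) (T : ℝ) : Prop :=
  ∃ N, IsLinearizedReebFlow G α γ N ∧ (1 : ℝ) ∉ spectrum ℝ (N T)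

/-! ### The Conley-Zehnder index -/

/-- `θ` is a continuous choice of the angle of the nonzero vector `M t • v`, `t ∈ [0, T]`. -/
def IsAngleAlong (M : ℝ → Matrix (Fin 2) (Fin 2) ℝ) (T : ℝ) (v : Fin 2 → ℝ) (θ : ℝ → ℝ) : Prop :=
  ContinuousOn θ (Set.Icc 0 T) ∧ ∀ t ∈ Set.Icc 0 T, ∃ r : ℝ, 0 < r ∧
    (M t).mulVec v = ![r * Real.cos (θ t), r * Real.sin (θ t)]

/-- The rotation set of the path `M` on `[0, T]`: all total rotations, in full turns, of nonzero
vectors. For a path of symplectic matrices starting at the identity it is a compact interval of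
length less than `1/2`. -/
def rotationSet (M : ℝ → Matrix (Fin 2) (Fin 2) ℝ) (T : ℝ) : Set ℝ :=
  {x | ∃ (v : Fin 2 → ℝ) (θ : ℝ → ℝ), v ≠ 0 ∧ IsAngleAlong M T v θ ∧
    x = (θ T - θ 0) / (2 * Real.pi)}

/-- The Conley-Zehnder index of a path `M` in `Sp(2) = SL(2, ℝ)` on `[0, T]` starting at the
identity and with `1 ∉ Spec (M T)`: it is `2k` if the rotation interval contains the integer `k`,
and `2k + 1` if the rotation interval lies strictly between the consecutive integers `k` and
`k + 1`. -/
def conleyZehnder (M : ℝ → Matrix (Fin 2) (Fin 2) ℝ) (T : ℝ) : ℤ :=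
  open Classical in
  if h : ∃ k : ℤ, (k : ℝ) ∈ rotationSet M T then 2 * h.choose
  else 2 * ⌊sInf (rotationSet M T)⌋ + 1

/-- The Conley-Zehnder index of the Reeb orbit `γ` of period `T`, with respect to the global
trivialization `τ_G`, equals `μ`. -/
def HasConleyZehnderIndex (G : Subgroup SU2) (α : TS3Mod G → ℝ) (γ : ℝ → S3Mod G) (T : ℝ)
    (μ : ℤ) : Prop :=
  ∃ N, IsLinearizedReebFlow G α γ N ∧ conleyZehnder N T = μ

/-- The loop `γ : ℝ/Tℤ → S³/G` is contractible. -/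
def IsContractibleLoop (G : Subgroup SU2) (γ : ℝ → S3Mod G) (T : ℝ) : Prop :=
  ∃ c : C(AddCircle T, S3Mod G), (∀ t : ℝ, c (t : AddCircle T) = γ t) ∧ c.Nullhomotopic

/-! ### The contact forms -/

/-- The round contact form on `S³`, the restriction of
`(i/4) ∑ (z_k d(conj z_k) - conj z_k dz_k) = (1/2) ∑ (x_k dy_k - y_k dx_k)`. -/
def roundForm (p : TS3) : ℝ := (herm p.1.1 p.1.2).im / 2

/-- The contact form `λ_G` on `S³/G`, the descent of the round contact form. -/
def roundFormMod (G : Subgroup SU2) : TS3Mod G → ℝ :=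
  Quotient.lift roundForm (by
    rintro a b ⟨g, rfl⟩
    show (herm (actC2 g.1 b.1.1) (actC2 g.1 b.1.2)).im / 2 = (herm b.1.1 b.1.2).im / 2
    rw [herm_actC2])

/-- The bundle projection `T(S³/G) → S³/G`. -/
def basePoint (G : Subgroup SU2) : TS3Mod G → S3Mod G :=
  Quotient.lift (fun p => projS3 G p.1.1) (by
    rintro a b ⟨g, rfl⟩
    exact Quotient.sound ⟨g, rfl⟩)

/-- The perturbed form `λ_{G,ε} = (1 + ε 𝔭^* f_H) λ_G` on `S³/G`, for a function `fH` on `S²/H`. -/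
def perturbedForm (G : Subgroup SU2) (fH : S2Mod (G.map P) → ℝ) (ε : ℝ) (X : TS3Mod G) : ℝ :=
  (1 + ε * fH (seifert G (basePoint G X))) * roundFormMod G X

/-! ### Morse functions on `S²` -/

/-- `p` is a critical point of `f`. -/
def IsCrit (f : S2 → ℝ) (p : S2) : Prop := mfderiv (𝓡 2) 𝓘(ℝ, ℝ) f p = 0

/-- The Hessian of `f` at `p` in the (stereographic) chart of `S²` centred at `p`. -/
def hessian (f : S2 → ℝ) (p : S2) :
    EuclideanSpace ℝ (Fin 2) →ₗ[ℝ] EuclideanSpace ℝ (Fin 2) →ₗ[ℝ] ℝ :=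
  (fderiv ℝ (fderiv ℝ (f ∘ (chartAt (EuclideanSpace ℝ (Fin 2)) p).symm))
    (chartAt (EuclideanSpace ℝ (Fin 2)) p p)).toLinearMap₁₂

/-- `f` is a Morse function: it is smooth and its critical points are nondegenerate. -/
def IsMorse (f : S2 → ℝ) : Prop :=
  ContMDiff (𝓡 2) 𝓘(ℝ, ℝ) ∞ f ∧
    ∀ p, IsCrit f p → ∀ v, (∀ w, hessian f p v w = 0) → v = 0

/-- The Morse index of `f` at `p`: the maximal dimension of a subspace on which the Hessian is
negative definite. -/
def morseIndex (f : S2 → ℝ) (p : S2) : ℕ :=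
  sigNeg (LinearMap.BilinMap.toQuadraticMap (hessian f p))

/-- `q ∈ S²/H` is an orbifold critical point of the function to which the `H`-invariant function
`f` descends: `q` is the image of a critical point of `f`. -/
def IsOrbifoldCrit (H : Subgroup SO3) (f : S2 → ℝ) (q : S2Mod H) : Prop :=
  ∃ p, IsCrit f p ∧ projS2 H p = q

/-! ### The orbits over critical points -/

/-- `e^{is} · z`, the Hopf action of `S¹ ⊂ ℂ^*` on `S³`. -/
def hopfAct (s : ℝ) (z : S3) : S3 :=
  ⟨Complex.exp (s * Complex.I) • (z : C2), by
    rw [mem_sphere_zero_iff_norm, norm_smul, Complex.norm_exp_ofReal_mul_I, one_mul]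
    exact mem_sphere_zero_iff_norm.1 z.2⟩

/-- The Reeb orbit `γ_p` of `λ_ε = (1 + ε f ∘ 𝔓) λ` on `S³` through the point `z` over the critical
point `p = 𝔓(z)`. The Reeb vector field of `λ = (1/2) ∑ (x_k dy_k - y_k dx_k)` at `z` is `2 i z`,
so the simple orbit `γ_p` has period `π (1 + ε f(p))`. -/
def fiberOrbit (f : S2 → ℝ) (ε : ℝ) (z : S3) (t : ℝ) : S3 :=
  hopfAct (2 * t / (1 + ε * f (hopf z))) z

/-- The loop `γ` of period `T` in `S³/G` lifts to the `k`-fold iterate `γ_p^k` of the Reeb orbit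
`γ_p` on `S³` through `z`. -/
def LiftsToFiberOrbit (G : Subgroup SU2) (f : S2 → ℝ) (ε : ℝ) (γ : ℝ → S3Mod G) (T : ℝ)
    (z : S3) (k : ℕ) : Prop :=
  T = k * (Real.pi * (1 + ε * f (hopf z))) ∧ ∀ t, γ t = projS3 G (fiberOrbit f ε z t)

end SphereQuotient

end

open SphereQuotient

/-! Everything is computed on S³ ⊂ ℂ² with one explicit vector field. Let `F` extend `f` to ℝ³,
constant on rays near S², and let g = 1 + ε F∘𝔓. The Reeb field of gλ is (2/g)·iz plus a term of
order ε in the contact plane, built from the derivatives of F∘𝔓 along V₁ and V₂ (`isReeb_iff`). It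
commutes with G and with the Hopf circle action, and it projects to (ε/g²)·4x × ∇F on S²
(`hopfBilin_reebField`).

Location of short orbits. The projected field is orthogonal to ∇F, so g is constant along a
trajectory, and the projection is an integral curve of an autonomous field with Lipschitz constant
O(ε). A lift of an orbit of period T closes up after time |G|T, because the deck transformation
relating its ends has finite order. A periodic integral curve whose period times the Lipschitz
constant is below 1 is constant (`eq_zero_of_periodic_integralCurve`). Hence for small ε the orbit
stays in the Hopf fibre over a zero of x × ∇F, that is, over a critical point of f.

Linearized flow. By circle equivariance, the linearized equation along such a fibre has constant
coefficients in the frame carried along by e^{iθ}. Its flow there is exp(tX), with X the Hamiltonian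
matrix of ε/g² times the Hessian of F on the images of V₁, V₂. Since V₁(e^{iθ}z) = e^{-iθ}V₁(z), the
carried frame turns by 2θ against the left-invariant one. With θ = 2t/g, the path in the global
trivialization is the rotation by 4t/g times exp(tX) (`isLinearizedFlow_flowMod`).

Nondegeneracy. The path lies in SL(2,ℝ), so 1 is an eigenvalue exactly when the trace is 2. The
rotation angle at time T has order dividing |G| modulo 2π. Either the rotation is trivial and the
trace of exp(TX) differs from 2 because the Hessian is nondegenerate, or its trace is bounded away
from 2 and the small factor exp(TX) cannot close the gap.

Index. A contractible orbit lifts to a loop, so T = kπg and the rotation makes exactly 2k turns. The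
factor exp(TX) moves each vector by less than a quarter turn, in the sense opposite to the sign of
the Hessian on it. The rotation interval therefore lies just below 2k, contains 2k, or lies just
above it, according to Morse index 0, 1, 2. The Conley–Zehnder index is accordingly 4k − 1, 4k, 4k +
1. -/

namespace SphereQuotient

/-! ### Rotation angles of elliptic and hyperbolic one-parameter groups -/

/-- Solutions of `c' = -δ s`, `s' = c`, `c(0) = 1`, `s(0) = 0`, with estimates for small time. -/
lemma exists_trig_pair (δ : ℝ) (hδ : δ ≠ 0) : ∃ c s : ℝ → ℝ,
    (∀ t, HasDerivAt c (-δ * s t) t) ∧ (∀ t, HasDerivAt s (c t) t) ∧ c 0 = 1 ∧ s 0 = 0 ∧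
    (∀ t, c t ^ 2 + δ * s t ^ 2 = 1) ∧
    ∀ t, 0 < t → |δ| * t ^ 2 ≤ 1 → |c t - 1| ≤ |δ| * t ^ 2 ∧ 0 < s t ∧ s t ≤ 2 * t ∧ c t ≠ 1 := by
  rcases lt_or_gt_of_ne hδ with h | h
  · set μ := Real.sqrt (-δ) with hμ
    have hμ0 : 0 < μ := Real.sqrt_pos.2 (by linarith)
    have hμ2 : μ ^ 2 = -δ := Real.sq_sqrt (by linarith)
    have hδμ : δ = -μ ^ 2 := by linarith
    have habs : |δ| = μ ^ 2 := by rw [hμ2, abs_of_neg h]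
    refine ⟨fun t => Real.cosh (μ * t), fun t => Real.sinh (μ * t) / μ, fun t => ?_, fun t => ?_,
      by simp, by simp, fun t => ?_, fun t ht h1 => ?_⟩
    · have := (Real.hasDerivAt_cosh (μ * t)).comp t ((hasDerivAt_id t).const_mul μ)
      convert! this using 1
      rw [hδμ]; field_simp
    · have := ((Real.hasDerivAt_sinh (μ * t)).comp t ((hasDerivAt_id t).const_mul μ)).div_const μ
      convert! this using 1
      field_simp
    · have := Real.cosh_sq (μ * t)
      have h2 : δ * (Real.sinh (μ * t) / μ) ^ 2 = - Real.sinh (μ * t) ^ 2 := by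
        rw [hδμ]; field_simp
      simp only [h2, this]; ring
    · have hx : 0 < μ * t := mul_pos hμ0 ht
      rw [habs] at h1 ⊢
      have hx1 : μ * t ≤ 1 := by nlinarith
      have hsq : |(μ * t)| ≤ 1 := by rw [abs_of_pos hx]; exact hx1
      -- With x = μt ≤ 1, half the sum of the bounds at x and −x gives cosh x − 1 ≤ x², and half
      -- their difference gives sinh x ≤ x + x² ≤ 2x.
      have hE := Real.abs_exp_sub_one_sub_id_le hsq
      have hE' := Real.abs_exp_sub_one_sub_id_le (x := -(μ * t)) (by rwa [abs_neg])
      rw [abs_le] at hE hE'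
      have hc := Real.cosh_eq (μ * t)
      have hs := Real.sinh_eq (μ * t)
      have hc1 : 1 < Real.cosh (μ * t) := Real.one_lt_cosh.2 hx.ne'
      refine ⟨?_, ?_, ?_, hc1.ne'⟩
      · rw [abs_of_pos (by linarith)]
        have : (μ * t) ^ 2 = μ ^ 2 * t ^ 2 := by ring
        nlinarith
      · exact div_pos (Real.sinh_pos_iff.2 hx) hμ0
      · rw [div_le_iff₀ hμ0]
        nlinarith
  · set μ := Real.sqrt δ with hμ
    have hμ0 : 0 < μ := Real.sqrt_pos.2 h
    have hμ2 : μ ^ 2 = δ := Real.sq_sqrt h.le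
    have habs : |δ| = μ ^ 2 := by rw [hμ2, abs_of_pos h]
    refine ⟨fun t => Real.cos (μ * t), fun t => Real.sin (μ * t) / μ, fun t => ?_, fun t => ?_,
      by simp, by simp, fun t => ?_, fun t ht h1 => ?_⟩
    · have := (Real.hasDerivAt_cos (μ * t)).comp t ((hasDerivAt_id t).const_mul μ)
      convert! this using 1
      rw [← hμ2]; field_simp
    · have := ((Real.hasDerivAt_sin (μ * t)).comp t ((hasDerivAt_id t).const_mul μ)).div_const μ
      convert! this using 1
      field_simp
    · have := Real.sin_sq_add_cos_sq (μ * t)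
      have h2 : δ * (Real.sin (μ * t) / μ) ^ 2 = Real.sin (μ * t) ^ 2 := by
        rw [← hμ2]; field_simp
      simp only [h2]; linarith
    · have hx : 0 < μ * t := mul_pos hμ0 ht
      rw [habs] at h1 ⊢
      have hx1 : μ * t ≤ 1 := by nlinarith
      have hπ := Real.pi_gt_three
      have hs0 : 0 < Real.sin (μ * t) := Real.sin_pos_of_pos_of_lt_pi hx (by linarith)
      have hlow := Real.one_sub_sq_div_two_le_cos (x := μ * t)
      have hup := Real.cos_le_one (μ * t)
      refine ⟨?_, div_pos hs0 hμ0, ?_, ?_⟩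
      · rw [abs_le]; constructor <;> nlinarith
      · rw [div_le_iff₀ hμ0]
        have := Real.sin_le hx.le
        nlinarith
      · intro hcon
        have hcon' : Real.cos (μ * t) = 1 := hcon
        have := Real.sin_sq_add_cos_sq (μ * t)
        rw [hcon'] at this
        nlinarith

/-- The matrix of the rotation by the angle `θ`. -/
noncomputable def planeRotation (θ : ℝ) : Matrix (Fin 2) (Fin 2) ℝ :=
  !![Real.cos θ, -Real.sin θ; Real.sin θ, Real.cos θ]

/-- The Hamiltonian matrix `-J S` of the quadratic form `a x² + 2 b x y + d y²`. -/
def hamiltonianMatrix (a b d : ℝ) : Matrix (Fin 2) (Fin 2) ℝ := !![b, d; -a, -b]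

/-- Hypotheses on a path of matrices: a rotation at constant speed `κ` composed with the
one-parameter group generated by a Hamiltonian matrix with entries at most `m`, in coordinates
`c`, `s`, at a small time `T`. -/
structure IsTwistedPath (N : ℝ → Matrix (Fin 2) (Fin 2) ℝ) (κ a b d T m : ℝ) (c s : ℝ → ℝ) :
    Prop where
  eq : ∀ t, N t = planeRotation (κ * t) * (c t • (1 : Matrix (Fin 2) (Fin 2) ℝ)
    + s t • hamiltonianMatrix a b d)
  cont_c : Continuous c
  cont_s : Continuous s
  c_zero : c 0 = 1
  s_zero : s 0 = 0
  sq_add : ∀ t, c t ^ 2 + (a * d - b ^ 2) * s t ^ 2 = 1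
  estimate : ∀ t, 0 < t → |a * d - b ^ 2| * t ^ 2 ≤ 1 →
    |c t - 1| ≤ |a * d - b ^ 2| * t ^ 2 ∧ 0 < s t ∧ s t ≤ 2 * t ∧ c t ≠ 1
  pos : 0 < T
  ha : |a| ≤ m
  hb : |b| ≤ m
  hd : |d| ≤ m
  small : T * m ≤ 1 / 8

/-! ### Nondegeneracy and Conley–Zehnder index of twisted paths -/

namespace IsTwistedPath

variable {N : ℝ → Matrix (Fin 2) (Fin 2) ℝ} {κ a b d T m : ℝ} {c s : ℝ → ℝ}

lemma m_nonneg (h : IsTwistedPath N κ a b d T m c s) : 0 ≤ m := (abs_nonneg a).trans h.ha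

lemma det_le (h : IsTwistedPath N κ a b d T m c s) : |a * d - b ^ 2| ≤ 2 * m ^ 2 := by
  have h1 : |a * d| ≤ m * m := by
    rw [abs_mul]; exact mul_le_mul h.ha h.hd (abs_nonneg _) h.m_nonneg
  have h2 : |b ^ 2| ≤ m ^ 2 := by
    rw [abs_pow]; exact pow_le_pow_left₀ (abs_nonneg _) h.hb 2
  calc |a * d - b ^ 2| ≤ |a * d| + |b ^ 2| := abs_sub _ _
    _ ≤ 2 * m ^ 2 := by linarith [sq m]

lemma bounds (h : IsTwistedPath N κ a b d T m c s) {t : ℝ} (ht : 0 < t) (htT : t ≤ T) :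
    |c t - 1| ≤ 2 * (t * m) ^ 2 ∧ 0 < s t ∧ s t ≤ 2 * t ∧ c t ≠ 1 := by
  have h0 := h.m_nonneg
  have h1 : t * m ≤ 1 / 8 := (mul_le_mul_of_nonneg_right htT h0).trans h.small
  have h2 : |a * d - b ^ 2| * t ^ 2 ≤ 2 * (t * m) ^ 2 := by
    have := mul_le_mul_of_nonneg_right h.det_le (sq_nonneg t)
    linarith [mul_pow t m 2]
  have h3 : 0 ≤ t * m := by positivity
  obtain ⟨e1, e2⟩ := h.estimate t ht (h2.trans (by nlinarith))
  exact ⟨e1.trans h2, e2⟩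

/-- The factor c + sX differs from the identity by O(Tm): c − 1 contributes at most 4(Tm)² to the
trace, and the symmetric part of the form, through a + d, at most 2T·2m. -/
lemma trace_close (h : IsTwistedPath N κ a b d T m c s) :
    |(N T).trace - 2 * Real.cos (κ * T)| ≤ 8 * (T * m) := by
  obtain ⟨h1, h2, h3, -⟩ := h.bounds h.pos le_rfl
  have h0 := h.m_nonneg
  have hT := h.pos
  have ht : (N T).trace = 2 * c T * Real.cos (κ * T) + s T * (a + d) * Real.sin (κ * T) := by
    rw [h.eq, Matrix.trace_fin_two]
    simp [planeRotation, hamiltonianMatrix, Matrix.mul_apply, Fin.sum_univ_two]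
    ring
  have e : (N T).trace - 2 * Real.cos (κ * T)
      = 2 * (c T - 1) * Real.cos (κ * T) + s T * (a + d) * Real.sin (κ * T) := by rw [ht]; ring
  have e1 : |2 * (c T - 1) * Real.cos (κ * T)| ≤ 4 * (T * m) ^ 2 := by
    rw [abs_mul, abs_mul, abs_two]
    have := Real.abs_cos_le_one (κ * T)
    nlinarith [abs_nonneg (c T - 1), abs_nonneg (Real.cos (κ * T))]
  have e2 : |s T * (a + d) * Real.sin (κ * T)| ≤ 4 * (T * m) := by
    rw [abs_mul, abs_mul, abs_of_pos h2]
    have h5 := Real.abs_sin_le_one (κ * T)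
    have h6 : |a + d| ≤ 2 * m := (abs_add_le a d).trans (by linarith [h.ha, h.hd])
    calc s T * |a + d| * |Real.sin (κ * T)| ≤ (2 * T) * (2 * m) * 1 := by gcongr
      _ = 4 * (T * m) := by ring
  rw [e]
  refine (abs_add_le _ _).trans ?_
  have : 0 ≤ T * m := by positivity
  nlinarith [h.small]

/-- The determinant of c + sX is c² + (ad − b²)s², the conserved quantity of the equations for c and
s. -/
lemma det_eq_one (h : IsTwistedPath N κ a b d T m c s) (t : ℝ) : (N t).det = 1 := by
  have h1 := h.sq_add t
  have h2 := Real.sin_sq_add_cos_sq (κ * t)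
  rw [h.eq, Matrix.det_mul, Matrix.det_fin_two, Matrix.det_fin_two]
  simp [planeRotation, hamiltonianMatrix]
  have e1 : Real.cos (κ * t) * Real.cos (κ * t) + Real.sin (κ * t) * Real.sin (κ * t) = 1 := by
    nlinarith
  rw [e1]
  linarith

/-- For a 2×2 matrix of determinant 1 the characteristic polynomial takes the value 2 − tr at 1. -/
lemma one_notMem_spectrum_of_trace_ne (h : IsTwistedPath N κ a b d T m c s)
    (htr : (N T).trace ≠ 2) : (1 : ℝ) ∉ spectrum ℝ (N T) := by
  rw [spectrum.notMem_iff, Matrix.isUnit_iff_isUnit_det, isUnit_iff_ne_zero]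
  have h1 := h.det_eq_one T
  rw [Matrix.det_fin_two] at h1
  rw [Matrix.trace_fin_two] at htr
  simp only [map_one, Matrix.det_fin_two, Matrix.sub_apply, Matrix.one_apply]
  simp
  intro hcon
  apply htr
  linarith

/-- Nondegeneracy when the rotation part is trivial. -/
lemma one_notMem_spectrum_of_cos_eq_one (h : IsTwistedPath N κ a b d T m c s)
    (hcos : Real.cos (κ * T) = 1) : (1 : ℝ) ∉ spectrum ℝ (N T) := by
  apply h.one_notMem_spectrum_of_trace_ne
  have hsin : Real.sin (κ * T) = 0 := by
    have := Real.sin_sq_add_cos_sq (κ * T)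
    rw [hcos] at this
    nlinarith
  rw [h.eq, Matrix.trace_fin_two]
  simp [planeRotation, hamiltonianMatrix, Matrix.mul_apply, Fin.sum_univ_two, hcos, hsin]
  intro hcon
  exact (h.bounds h.pos le_rfl).2.2.2 (by linarith)

/-- Nondegeneracy when the rotation part is far from trivial. -/
lemma one_notMem_spectrum_of_cos_lt (h : IsTwistedPath N κ a b d T m c s)
    (hcos : 2 * Real.cos (κ * T) + 8 * (T * m) < 2) : (1 : ℝ) ∉ spectrum ℝ (N T) := by
  apply h.one_notMem_spectrum_of_trace_ne
  have := (abs_le.1 h.trace_close).2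
  intro hcon
  linarith

/-- The image of `v` in the rotating frame. -/
def moving (a b d : ℝ) (c s : ℝ → ℝ) (v : Fin 2 → ℝ) (t : ℝ) : Fin 2 → ℝ :=
  ![c t * v 0 + s t * (b * v 0 + d * v 1), c t * v 1 + s t * (-a * v 0 - b * v 1)]

lemma mulVec_eq (h : IsTwistedPath N κ a b d T m c s) (v : Fin 2 → ℝ) (t : ℝ) :
    (N t).mulVec v = ![Real.cos (κ * t) * moving a b d c s v t 0
        - Real.sin (κ * t) * moving a b d c s v t 1,
      Real.sin (κ * t) * moving a b d c s v t 0
        + Real.cos (κ * t) * moving a b d c s v t 1] := by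
  rw [h.eq]
  ext i
  fin_cases i <;>
  · simp [planeRotation, hamiltonianMatrix, Matrix.mul_apply, Fin.sum_univ_two, Matrix.mulVec,
      dotProduct, moving]
    ring

lemma norm_pos_of_ne_zero {v : Fin 2 → ℝ} (hv : v ≠ 0) : 0 < v 0 ^ 2 + v 1 ^ 2 := by
  by_contra hcon
  apply hv
  have h0 : v 0 = 0 := by nlinarith [sq_nonneg (v 0), sq_nonneg (v 1)]
  have h1 : v 1 = 0 := by nlinarith [sq_nonneg (v 0), sq_nonneg (v 1)]
  ext i
  fin_cases i
  · exact h0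
  · exact h1

lemma moving_zero (h : IsTwistedPath N κ a b d T m c s) (v : Fin 2 → ℝ) :
    moving a b d c s v 0 = v := by
  ext i
  fin_cases i <;> simp [moving, h.c_zero, h.s_zero]

/-- In the rotating frame a vector never turns by a right angle: c ≥ 31/32, while the term with s
costs at most 2t·2m ≤ 1/2 of |v|². This positivity is what pins down the angle below. -/
lemma dot_moving_pos (h : IsTwistedPath N κ a b d T m c s) {v : Fin 2 → ℝ} (hv : v ≠ 0)
    {t : ℝ} (ht : t ∈ Set.Icc 0 T) :
    0 < v 0 * moving a b d c s v t 0 + v 1 * moving a b d c s v t 1 := by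
  have hpos := norm_pos_of_ne_zero hv
  rcases ht.1.eq_or_lt with h0 | h0
  · rw [← h0, h.moving_zero]; nlinarith
  obtain ⟨h1, h2, h3, -⟩ := h.bounds h0 ht.2
  have hm := h.m_nonneg
  have hT := h.pos
  have htm : t * m ≤ 1 / 8 := (mul_le_mul_of_nonneg_right ht.2 hm).trans h.small
  have htm0 : 0 ≤ t * m := by positivity
  have hc : 1 - 1 / 32 ≤ c t := by
    have := (abs_le.1 h1).1
    nlinarith
  have ha := abs_le.1 h.ha
  have hb := abs_le.1 h.hb
  have hd := abs_le.1 h.hd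
  have key : -(2 * m * (v 0 ^ 2 + v 1 ^ 2))
      ≤ v 0 * (b * v 0 + d * v 1) + v 1 * (-a * v 0 - b * v 1) := by
    have e1 : |v 0 * v 1| ≤ (v 0 ^ 2 + v 1 ^ 2) / 2 := by
      rw [abs_le]; constructor <;> nlinarith [sq_nonneg (v 0 + v 1), sq_nonneg (v 0 - v 1)]
    have e2 : |(d - a) * (v 0 * v 1)| ≤ (2 * m) * ((v 0 ^ 2 + v 1 ^ 2) / 2) := by
      rw [abs_mul]
      refine mul_le_mul ?_ e1 (abs_nonneg _) (by positivity)
      rw [abs_le]; constructor <;> linarith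
    have e3 := (abs_le.1 e2).1
    nlinarith [sq_nonneg (v 0), sq_nonneg (v 1)]
  have e : v 0 * moving a b d c s v t 0 + v 1 * moving a b d c s v t 1
      = c t * (v 0 ^ 2 + v 1 ^ 2)
        + s t * (v 0 * (b * v 0 + d * v 1) + v 1 * (-a * v 0 - b * v 1)) := by
    simp [moving]; ring
  rw [e]
  have f1 : (1 - 1 / 32) * (v 0 ^ 2 + v 1 ^ 2) ≤ c t * (v 0 ^ 2 + v 1 ^ 2) := by gcongr
  have f2 : s t * -(2 * m * (v 0 ^ 2 + v 1 ^ 2)) ≤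
      s t * (v 0 * (b * v 0 + d * v 1) + v 1 * (-a * v 0 - b * v 1)) := by gcongr
  have f3 : s t * (2 * m * (v 0 ^ 2 + v 1 ^ 2)) ≤ 2 * t * (2 * m * (v 0 ^ 2 + v 1 ^ 2)) := by
    gcongr
  have f4 : t * m * (v 0 ^ 2 + v 1 ^ 2) ≤ 1 / 8 * (v 0 ^ 2 + v 1 ^ 2) := by gcongr
  nlinarith

/-- The sense of rotation comes from here: the multiple c of the identity drops out of the cross
product, and X contributes minus its quadratic form. -/
lemma cross_moving (v : Fin 2 → ℝ) (t : ℝ) :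
    v 0 * moving a b d c s v t 1 - v 1 * moving a b d c s v t 0
      = -(s t * (a * v 0 ^ 2 + 2 * b * v 0 * v 1 + d * v 1 ^ 2)) := by
  simp [moving]; ring

/-- The total rotation of a nonzero vector is, up to the full turns of the rotation part, an angle
`ψ ∈ (-π/2, π/2)` whose sign is opposite to that of the quadratic form. -/
lemma exists_angle_of_isAngleAlong (h : IsTwistedPath N κ a b d T m c s) {v : Fin 2 → ℝ}
    (hv : v ≠ 0) {φ : ℝ → ℝ} (hφ : IsAngleAlong N T v φ) :
    ∃ ψ r : ℝ, φ T - φ 0 = κ * T + ψ ∧ |ψ| < Real.pi / 2 ∧ 0 < r ∧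
      r * Real.sin ψ = -(a * v 0 ^ 2 + 2 * b * v 0 * v 1 + d * v 1 ^ 2) := by
  obtain ⟨hcont, hang⟩ := hφ
  have hT := h.pos
  have h0 : (0 : ℝ) ∈ Set.Icc 0 T := ⟨le_rfl, hT.le⟩
  have hTm : T ∈ Set.Icc 0 T := ⟨hT.le, le_rfl⟩
  have key : ∀ t ∈ Set.Icc 0 T, ∃ r : ℝ, 0 < r ∧
      moving a b d c s v t 0 = r * Real.cos (φ t - κ * t) ∧
      moving a b d c s v t 1 = r * Real.sin (φ t - κ * t) := by
    intro t ht
    obtain ⟨r, hr, e⟩ := hang t ht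
    rw [h.mulVec_eq] at e
    have e0 := congrFun e 0
    have e1 := congrFun e 1
    simp only [Matrix.cons_val_zero, Matrix.cons_val_one] at e0 e1
    have hsc := Real.sin_sq_add_cos_sq (κ * t)
    refine ⟨r, hr, ?_, ?_⟩
    · rw [Real.cos_sub]
      linear_combination (Real.cos (κ * t)) * e0 + (Real.sin (κ * t)) * e1
        - moving a b d c s v t 0 * hsc
    · rw [Real.sin_sub]
      linear_combination (-Real.sin (κ * t)) * e0 + (Real.cos (κ * t)) * e1
        - moving a b d c s v t 1 * hsc
  obtain ⟨r0, hr0, p0, q0⟩ := key 0 h0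
  rw [h.moving_zero, mul_zero, sub_zero] at p0 q0
  have hcos : ∀ t ∈ Set.Icc 0 T, 0 < Real.cos (φ t - κ * t - φ 0) := by
    intro t ht
    obtain ⟨r, hr, p, q⟩ := key t ht
    have := h.dot_moving_pos hv ht
    rw [p, q, p0, q0] at this
    have e : r0 * Real.cos (φ 0) * (r * Real.cos (φ t - κ * t))
        + r0 * Real.sin (φ 0) * (r * Real.sin (φ t - κ * t))
        = (r0 * r) * Real.cos (φ t - κ * t - φ 0) := by rw [Real.cos_sub _ (φ 0)]; ring
    rw [e] at this
    exact pos_of_mul_pos_right this (by positivity)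
  have hψc : ContinuousOn (fun t => φ t - κ * t - φ 0) (Set.Icc 0 T) := by fun_prop
  refine ⟨φ T - κ * T - φ 0, ?_⟩
  -- The deviation starts at 0 and its cosine stays positive on `[0, T]`, so by the intermediate
  -- value theorem it cannot reach ±π/2.
  have habs : |φ T - κ * T - φ 0| < Real.pi / 2 := by
    rw [abs_lt]
    constructor
    · by_contra! hcon
      have hmem : -(Real.pi / 2) ∈ Set.Icc (φ T - κ * T - φ 0) (φ 0 - κ * 0 - φ 0) :=
        ⟨hcon, by have := Real.pi_pos; linarith⟩
      obtain ⟨t, ht, e⟩ := intermediate_value_Icc' hT.le hψc hmem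
      have := hcos t ht
      simp only at e
      rw [e, Real.cos_neg, Real.cos_pi_div_two] at this
      exact lt_irrefl _ this
    · by_contra! hcon
      have hmem : Real.pi / 2 ∈ Set.Icc (φ 0 - κ * 0 - φ 0) (φ T - κ * T - φ 0) :=
        ⟨by have := Real.pi_pos; linarith, hcon⟩
      obtain ⟨t, ht, e⟩ := intermediate_value_Icc hT.le hψc hmem
      have := hcos t ht
      simp only at e
      rw [e, Real.cos_pi_div_two] at this
      exact lt_irrefl _ this
  obtain ⟨r, hr, p, q⟩ := key T hTm
  obtain ⟨-, hs, -, -⟩ := h.bounds hT le_rfl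
  refine ⟨r0 * r / s T, by ring, habs, by positivity, ?_⟩
  have e1 := cross_moving (a := a) (b := b) (d := d) (c := c) (s := s) v T
  have e2 : v 0 * moving a b d c s v T 1 - v 1 * moving a b d c s v T 0
      = r0 * r * Real.sin (φ T - κ * T - φ 0) := by
    rw [p, q, p0, q0, Real.sin_sub _ (φ 0)]; ring
  rw [div_mul_eq_mul_div, div_eq_iff hs.ne', ← e2, e1]
  ring

/-- Identify ℝ² with ℂ and multiply the vector in the rotating frame by the conjugate of v. The
product u stays in the right half plane by `dot_moving_pos`, where the principal argument is
continuous; then κt + arg v + arg u is an angle function. -/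
lemma exists_isAngleAlong (h : IsTwistedPath N κ a b d T m c s) {v : Fin 2 → ℝ} (hv : v ≠ 0) :
    ∃ φ, IsAngleAlong N T v φ := by
  set u : ℝ → ℂ := fun t => ⟨v 0 * moving a b d c s v t 0 + v 1 * moving a b d c s v t 1,
    v 0 * moving a b d c s v t 1 - v 1 * moving a b d c s v t 0⟩ with hu
  have hpos := norm_pos_of_ne_zero hv
  set z : ℂ := ⟨v 0, v 1⟩ with hz
  have hz0 : z ≠ 0 := by
    intro hcon
    have h0 := congrArg Complex.re hcon
    have h1 := congrArg Complex.im hcon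
    simp [hz] at h0 h1
    rw [h0, h1] at hpos
    simp at hpos
  have hcu : Continuous u := by
    have e : u = fun t => ((v 0 * moving a b d c s v t 0 + v 1 * moving a b d c s v t 1 : ℝ) : ℂ)
      + ((v 0 * moving a b d c s v t 1 - v 1 * moving a b d c s v t 0 : ℝ) : ℂ) * Complex.I := by
      funext t
      apply Complex.ext <;> simp [hu]
    have := h.cont_c
    have := h.cont_s
    rw [e]
    simp only [moving, Matrix.cons_val_zero, Matrix.cons_val_one]
    fun_prop
  refine ⟨fun t => κ * t + z.arg + (u t).arg, ?_, ?_⟩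
  · refine ContinuousOn.add (by fun_prop) ?_
    intro t ht
    refine ContinuousAt.continuousWithinAt ?_
    refine (Complex.continuousAt_arg ?_).comp hcu.continuousAt
    exact Or.inl (h.dot_moving_pos hv ht)
  · intro t ht
    have hu0 : u t ≠ 0 := by
      intro hcon
      have h0 := congrArg Complex.re hcon
      have := h.dot_moving_pos hv ht
      simp [hu] at h0
      linarith
    have hn : 0 < ‖z‖ := norm_pos_iff.2 hz0
    have hn2 : ‖z‖ * ‖z‖ = v 0 ^ 2 + v 1 ^ 2 := by
      rw [Complex.norm_mul_self_eq_normSq, Complex.normSq_apply]; simp [hz]; ring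
    refine ⟨‖u t‖ / ‖z‖, div_pos (norm_pos_iff.2 hu0) hn, ?_⟩
    have c1 : ‖z‖ * Real.cos z.arg = v 0 := Complex.norm_mul_cos_arg z
    have s1 : ‖z‖ * Real.sin z.arg = v 1 := Complex.norm_mul_sin_arg z
    have c2 : ‖u t‖ * Real.cos (u t).arg
      = v 0 * moving a b d c s v t 0 + v 1 * moving a b d c s v t 1 := Complex.norm_mul_cos_arg _
    have s2 : ‖u t‖ * Real.sin (u t).arg
      = v 0 * moving a b d c s v t 1 - v 1 * moving a b d c s v t 0 := Complex.norm_mul_sin_arg _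
    have e0 : ‖u t‖ / ‖z‖ * Real.cos (z.arg + (u t).arg) = moving a b d c s v t 0 := by
      rw [div_mul_eq_mul_div, div_eq_iff hn.ne']
      have : ‖z‖ * (‖u t‖ * Real.cos (z.arg + (u t).arg))
          = ‖z‖ * (moving a b d c s v t 0 * ‖z‖) := by
        rw [Real.cos_add]
        linear_combination (‖z‖ * Real.cos z.arg) * c2 - (‖z‖ * Real.sin z.arg) * s2
          + (v 0 * moving a b d c s v t 0 + v 1 * moving a b d c s v t 1) * c1
          - (v 0 * moving a b d c s v t 1 - v 1 * moving a b d c s v t 0) * s1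
          - (moving a b d c s v t 0) * hn2
      exact mul_left_cancel₀ hn.ne' this
    have e1 : ‖u t‖ / ‖z‖ * Real.sin (z.arg + (u t).arg) = moving a b d c s v t 1 := by
      rw [div_mul_eq_mul_div, div_eq_iff hn.ne']
      have : ‖z‖ * (‖u t‖ * Real.sin (z.arg + (u t).arg))
          = ‖z‖ * (moving a b d c s v t 1 * ‖z‖) := by
        rw [Real.sin_add]
        linear_combination (‖z‖ * Real.sin z.arg) * c2 + (‖z‖ * Real.cos z.arg) * s2
          + (v 0 * moving a b d c s v t 0 + v 1 * moving a b d c s v t 1) * s1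
          + (v 0 * moving a b d c s v t 1 - v 1 * moving a b d c s v t 0) * c1
          - (moving a b d c s v t 1) * hn2
      exact mul_left_cancel₀ hn.ne' this
    rw [h.mulVec_eq, ← e0, ← e1]
    ext i
    fin_cases i
    · simp only [Fin.zero_eta, Matrix.cons_val_zero]
      rw [add_assoc (κ * t), Real.cos_add (κ * t)]; ring
    · simp only [Fin.mk_one, Matrix.cons_val_one, Matrix.cons_val_fin_one]
      rw [add_assoc (κ * t), Real.sin_add (κ * t)]; ring

lemma mem_rotationSet (h : IsTwistedPath N κ a b d T m c s) {n : ℤ}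
    (hn : κ * T = 2 * Real.pi * n) {x : ℝ} (hx : x ∈ rotationSet N T) :
    ∃ (v : Fin 2 → ℝ) (ψ r : ℝ), v ≠ 0 ∧ x = n + ψ / (2 * Real.pi) ∧ |ψ| < Real.pi / 2 ∧ 0 < r ∧
      r * Real.sin ψ = -(a * v 0 ^ 2 + 2 * b * v 0 * v 1 + d * v 1 ^ 2) := by
  obtain ⟨v, φ, hv, hφ, rfl⟩ := hx
  obtain ⟨ψ, r, e, h1, h2, h3⟩ := h.exists_angle_of_isAngleAlong hv hφ
  refine ⟨v, ψ, r, hv, ?_, h1, h2, h3⟩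
  have := Real.pi_pos
  rw [e, hn]
  field_simp

lemma nonempty_rotationSet (h : IsTwistedPath N κ a b d T m c s) {v : Fin 2 → ℝ} (hv : v ≠ 0) :
    ∃ φ, (φ T - φ 0) / (2 * Real.pi) ∈ rotationSet N T ∧ IsAngleAlong N T v φ := by
  obtain ⟨φ, hφ⟩ := h.exists_isAngleAlong hv
  exact ⟨φ, ⟨v, φ, hv, hφ, rfl⟩, hφ⟩

lemma abs_div_two_pi_lt {ψ : ℝ} (h : |ψ| < Real.pi / 2) : |ψ / (2 * Real.pi)| < 1 / 4 := by
  have := Real.pi_pos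
  rw [abs_div, abs_of_pos (by positivity : (0 : ℝ) < 2 * Real.pi), div_lt_iff₀ (by positivity)]
  linarith

/-- All rotations lie within 1/4 of n, so n is the only possible integer. Uniqueness matters because
`conleyZehnder` doubles an integer picked by choice. Rotation exactly n means sin ψ = 0, so the
vector is isotropic. -/
lemma int_eq_of_mem_rotationSet (h : IsTwistedPath N κ a b d T m c s) {n : ℤ}
    (hn : κ * T = 2 * Real.pi * n) {k : ℤ} (hk : (k : ℝ) ∈ rotationSet N T) :
    k = n ∧ ∃ v : Fin 2 → ℝ, v ≠ 0 ∧ a * v 0 ^ 2 + 2 * b * v 0 * v 1 + d * v 1 ^ 2 = 0 := by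
  obtain ⟨v, ψ, r, hv, e, h1, h2, h3⟩ := h.mem_rotationSet hn hk
  have hlt := abs_lt.1 (abs_div_two_pi_lt h1)
  have hkn : k = n := by
    have h4 : (k : ℝ) < n + 1 := by linarith
    have h5 : (n : ℝ) < k + 1 := by linarith
    have h6 : k < n + 1 := by exact_mod_cast h4
    have h7 : n < k + 1 := by exact_mod_cast h5
    omega
  refine ⟨hkn, v, hv, ?_⟩
  have hψ : ψ = 0 := by
    rw [hkn] at e
    have := Real.pi_pos
    have e' : ψ / (2 * Real.pi) = 0 := by linarith
    rcases div_eq_zero_iff.1 e' with h' | h'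
    · exact h'
    · linarith
  rw [hψ, Real.sin_zero] at h3
  linarith

lemma conleyZehnder_eq_of_isotropic (h : IsTwistedPath N κ a b d T m c s) {n : ℤ}
    (hn : κ * T = 2 * Real.pi * n) {v : Fin 2 → ℝ} (hv : v ≠ 0)
    (hq : a * v 0 ^ 2 + 2 * b * v 0 * v 1 + d * v 1 ^ 2 = 0) : conleyZehnder N T = 2 * n := by
  have hex : ∃ k : ℤ, (k : ℝ) ∈ rotationSet N T := by
    obtain ⟨φ, hmem, hφ⟩ := h.nonempty_rotationSet hv
    obtain ⟨ψ, r, e, h1, h2, h3⟩ := h.exists_angle_of_isAngleAlong hv hφ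
    rw [hq, neg_zero] at h3
    have hs : Real.sin ψ = 0 := by
      rcases mul_eq_zero.1 h3 with h' | h'
      · exact absurd h' h2.ne'
      · exact h'
    have hψ : ψ = 0 := by
      have h4 := abs_lt.1 h1
      have := Real.pi_pos
      exact (Real.sin_eq_zero_iff_of_lt_of_lt (by linarith) (by linarith)).1 hs
    refine ⟨n, ?_⟩
    convert! hmem using 1
    rw [e, hn, hψ]
    have := Real.pi_pos
    field_simp
    ring
  rw [conleyZehnder, dif_pos hex, (h.int_eq_of_mem_rotationSet hn hex.choose_spec).1]

/-- A positive form turns every vector backwards, so all rotations lie in (n − 1/4, n). The floor of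
the infimum is n − 1, and the odd branch of the definition gives 2(n − 1) + 1. -/
lemma conleyZehnder_eq_of_posDef (h : IsTwistedPath N κ a b d T m c s) {n : ℤ}
    (hn : κ * T = 2 * Real.pi * n)
    (hq : ∀ v : Fin 2 → ℝ, v ≠ 0 → 0 < a * v 0 ^ 2 + 2 * b * v 0 * v 1 + d * v 1 ^ 2) :
    conleyZehnder N T = 2 * n - 1 := by
  have hne : ¬ ∃ k : ℤ, (k : ℝ) ∈ rotationSet N T := by
    rintro ⟨k, hk⟩
    obtain ⟨-, v, hv, e⟩ := h.int_eq_of_mem_rotationSet hn hk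
    exact (hq v hv).ne' e
  rw [conleyZehnder, dif_neg hne]
  have hb : ∀ x ∈ rotationSet N T, (n : ℝ) - 1 ≤ x ∧ x < n := by
    intro x hx
    obtain ⟨v, ψ, r, hv, e, h1, h2, h3⟩ := h.mem_rotationSet hn hx
    have hlt := abs_lt.1 (abs_div_two_pi_lt h1)
    have hπ := Real.pi_pos
    have hψ : ψ < 0 := by
      by_contra! hcon
      have := Real.sin_nonneg_of_nonneg_of_le_pi hcon (by linarith [(abs_lt.1 h1).2])
      nlinarith [hq v hv]
    have : ψ / (2 * Real.pi) < 0 := div_neg_of_neg_of_pos hψ (by positivity)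
    rw [e]
    constructor <;> linarith
  obtain ⟨φ, hmem, -⟩ := h.nonempty_rotationSet (v := ![1, 0])
    (by intro hcon; simpa using congrFun hcon 0)
  have hbb : BddBelow (rotationSet N T) := ⟨n - 1, fun x hx => (hb x hx).1⟩
  have : ⌊sInf (rotationSet N T)⌋ = n - 1 := by
    rw [Int.floor_eq_iff]
    push_cast
    refine ⟨le_csInf ⟨_, hmem⟩ fun x hx => (hb x hx).1, ?_⟩
    have := csInf_le hbb hmem
    linarith [(hb _ hmem).2]
  rw [this]; ring

lemma conleyZehnder_eq_of_negDef (h : IsTwistedPath N κ a b d T m c s) {n : ℤ}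
    (hn : κ * T = 2 * Real.pi * n)
    (hq : ∀ v : Fin 2 → ℝ, v ≠ 0 → a * v 0 ^ 2 + 2 * b * v 0 * v 1 + d * v 1 ^ 2 < 0) :
    conleyZehnder N T = 2 * n + 1 := by
  have hne : ¬ ∃ k : ℤ, (k : ℝ) ∈ rotationSet N T := by
    rintro ⟨k, hk⟩
    obtain ⟨-, v, hv, e⟩ := h.int_eq_of_mem_rotationSet hn hk
    exact (hq v hv).ne e
  rw [conleyZehnder, dif_neg hne]
  have hb : ∀ x ∈ rotationSet N T, (n : ℝ) ≤ x ∧ x < n + 1 := by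
    intro x hx
    obtain ⟨v, ψ, r, hv, e, h1, h2, h3⟩ := h.mem_rotationSet hn hx
    have hlt := abs_lt.1 (abs_div_two_pi_lt h1)
    have hπ := Real.pi_pos
    have hψ : 0 < ψ := by
      by_contra! hcon
      have := Real.sin_nonpos_of_nonpos_of_neg_pi_le hcon (by linarith [(abs_lt.1 h1).1])
      nlinarith [hq v hv]
    have : 0 < ψ / (2 * Real.pi) := by positivity
    rw [e]
    constructor <;> linarith
  obtain ⟨φ, hmem, -⟩ := h.nonempty_rotationSet (v := ![1, 0])
    (by intro hcon; simpa using congrFun hcon 0)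
  have hbb : BddBelow (rotationSet N T) := ⟨n, fun x hx => (hb x hx).1⟩
  have : ⌊sInf (rotationSet N T)⌋ = n := by
    rw [Int.floor_eq_iff]
    refine ⟨le_csInf ⟨_, hmem⟩ fun x hx => (hb x hx).1, ?_⟩
    have := csInf_le hbb hmem
    linarith [(hb _ hmem).2]
  rw [this]

end IsTwistedPath

/-! ### Flows of compactly supported vector fields -/

section Flow

variable {E : Type*} [NormedAddCommGroup E] [NormedSpace ℝ E]

lemma exists_lipschitzWith_of_hasCompactSupport {F : Type*} [NormedAddCommGroup F]
    [NormedSpace ℝ F] {v : E → F} (hv : ContDiff ℝ 1 v)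
    (hc : HasCompactSupport v) : ∃ K : NNReal, LipschitzWith K v := by
  have h1 : Continuous (fderiv ℝ v) := hv.continuous_fderiv one_ne_zero
  obtain ⟨C, hC⟩ := h1.bounded_above_of_compact_support (hc.fderiv ℝ)
  refine ⟨C.toNNReal, lipschitzWith_of_nnnorm_fderiv_le (hv.differentiable one_ne_zero) ?_⟩
  intro x
  rw [← NNReal.coe_le_coe, coe_nnnorm]
  exact (hC x).trans (Real.le_coe_toNNReal C)

lemma integralCurve_unique {v : E → E} {K : NNReal} (hK : LipschitzWith K v) {f g : ℝ → E}
    (hf : ∀ t, HasDerivAt f (v (f t)) t) (hg : ∀ t, HasDerivAt g (v (g t)) t) {t₀ : ℝ}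
    (h : f t₀ = g t₀) : f = g :=
  ODE_solution_unique_univ (v := fun _ => v) (s := fun _ => Set.univ)
    (fun _ => hK.lipschitzOnWith) (fun t => ⟨hf t, trivial⟩) (fun t => ⟨hg t, trivial⟩) h

/-- Boundedness lets Picard–Lindelöf run on every interval [−a, a] at once; uniqueness glues these
solutions into a global flow. -/
lemma exists_flow [CompleteSpace E] {v : E → E} {K : NNReal} (hK : LipschitzWith K v) {B : ℝ}
    (hB : ∀ x, ‖v x‖ ≤ B) : ∃ Φ : ℝ → E → E, (∀ x, Φ 0 x = x) ∧
      ∀ x t, HasDerivAt (fun s => Φ s x) (v (Φ t x)) t := by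
  have loc : ∀ (x : E) (a : ℝ), ∃ γ : ℝ → E, 0 < a → γ 0 = x ∧
      ∀ t ∈ Set.Ioo (-a) a, HasDerivAt γ (v (γ t)) t := by
    intro x a
    by_cases ha : 0 < a
    swap
    · exact ⟨fun _ => x, fun h => absurd h ha⟩
    have h0 : (0 : ℝ) ∈ Set.Icc (-a) a := ⟨by linarith, ha.le⟩
    -- Speed at most B keeps the solution in the ball of radius Ba during [−a, a], so that radius
    -- imposes no restriction on a.
    have hPL : IsPicardLindelof (fun _ => v) (⟨0, h0⟩ : Set.Icc (-a) a) x
        (B.toNNReal * a.toNNReal) 0 B.toNNReal K :=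
      { lipschitzOnWith := fun _ _ => hK.lipschitzOnWith
        continuousOn := fun _ _ => continuousOn_const
        norm_le := fun _ _ y _ => (hB y).trans (Real.le_coe_toNNReal B)
        mul_max_le := by simp [Real.coe_toNNReal a ha.le] }
    obtain ⟨γ, h1, h2⟩ := hPL.exists_eq_forall_mem_Icc_hasDerivWithinAt₀
    exact ⟨γ, fun _ => ⟨h1, fun t ht => (h2 t (Set.Ioo_subset_Icc_self ht)).hasDerivAt
      (Icc_mem_nhds ht.1 ht.2)⟩⟩
  choose α hα using loc
  have agree : ∀ x a b, 0 < a → a ≤ b → Set.EqOn (α x a) (α x b) (Set.Ioo (-a) a) := by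
    intro x a b ha hab
    have hb : 0 < b := ha.trans_le hab
    refine ODE_solution_unique_of_mem_Ioo (v := fun _ => v) (s := fun _ => Set.univ) (K := K)
      (t₀ := 0) (fun t _ => hK.lipschitzOnWith) ⟨by linarith, ha⟩
      (fun t ht => ⟨(hα x a ha).2 t ht, trivial⟩)
      (fun t ht => ⟨(hα x b hb).2 t ⟨by linarith [ht.1], by linarith [ht.2]⟩, trivial⟩) ?_
    rw [(hα x a ha).1, (hα x b hb).1]
  -- The interval used depends on t, so for differentiation at t the larger fixed interval of
  -- half-width |t| + 2 replaces it for all nearby times.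
  refine ⟨fun t x => α x (|t| + 1) t, fun x => (hα x _ (by positivity)).1, fun x t => ?_⟩
  have hmem : ∀ s : ℝ, s ∈ Set.Ioo (-(|s| + 1)) (|s| + 1) := fun s =>
    ⟨by linarith [neg_abs_le s], by linarith [le_abs_self s]⟩
  have hev : (fun s => α x (|s| + 1) s) =ᶠ[𝓝 t] α x (|t| + 2) := by
    have : ∀ᶠ s in 𝓝 t, |s| < |t| + 1 :=
      continuous_abs.continuousAt.eventually_lt continuousAt_const (by linarith)
    filter_upwards [this] with s hs
    exact agree x _ _ (by positivity) (by linarith) (hmem s)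
  have ht : α x (|t| + 1) t = α x (|t| + 2) t := agree x _ _ (by positivity) (by linarith) (hmem t)
  have hd := (hα x (|t| + 2) (by positivity)).2 t
    ⟨by linarith [neg_abs_le t], by linarith [le_abs_self t]⟩
  simp only [ht]
  exact hd.congr_of_eventuallyEq hev

/-- The first variation of a flow for positive times: if `h` solves the linearized equation along
the integral curve through `x`, then `h t` is the velocity of the image under the time-`t` map of
any curve through `x` with velocity `h 0`. -/
lemma hasDerivAt_flow_of_nonneg {v : E → E} (hv : ContDiff ℝ 2 v) (hc : HasCompactSupport v)
    {Φ : ℝ → E → E} (h0 : ∀ x, Φ 0 x = x)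
    (hΦ : ∀ x t, HasDerivAt (fun s => Φ s x) (v (Φ t x)) t) {x : E} {h : ℝ → E}
    (hh : ∀ t, HasDerivAt h (fderiv ℝ v (Φ t x) (h t)) t) {b : ℝ → E} (hb0 : b 0 = x)
    (hb : HasDerivAt b (h 0) 0) {T : ℝ} (hT : 0 ≤ T) :
    HasDerivAt (fun s => Φ T (b s)) (h T) 0 := by
  obtain ⟨K, hK⟩ := exists_lipschitzWith_of_hasCompactSupport (hv.of_le one_le_two) hc
  obtain ⟨M, hM⟩ := exists_lipschitzWith_of_hasCompactSupport
    (hv.fderiv_right (m := 1) (by norm_num)) (hc.fderiv ℝ)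
  have hhc : Continuous h := continuous_iff_continuousAt.2 fun t => (hh t).continuousAt
  obtain ⟨B, hB⟩ := (isCompact_Icc (a := (0 : ℝ)) (b := T)).exists_bound_of_continuousOn
    hhc.continuousOn
  have hdiff := hv.differentiable two_ne_zero
  -- Since `fderiv ℝ v` is M-Lipschitz, the mean value inequality on the segment from z to z + w
  -- gives a quadratic remainder.
  have taylor : ∀ z w : E, ‖v (z + w) - v z - fderiv ℝ v z w‖ ≤ M * ‖w‖ * ‖w‖ := by
    intro z w
    have := (convex_segment z (z + w)).norm_image_sub_le_of_norm_hasFDerivWithin_le'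
      (f := v) (f' := fderiv ℝ v) (φ := fderiv ℝ v z) (C := M * ‖w‖) (x := z) (y := z + w)
      (fun y _ => (hdiff y).hasFDerivAt.hasFDerivWithinAt) (fun y hy => ?_)
      (left_mem_segment ℝ _ _) (right_mem_segment ℝ _ _)
    · simpa using this
    · have h1 := hM.dist_le_mul y z
      rw [dist_eq_norm, dist_eq_norm] at h1
      refine h1.trans ?_
      gcongr
      have := norm_sub_le_of_mem_segment hy
      simpa using this
  set G : ℝ := gronwallBound 1 K 0 T with hG
  have hB0 : 0 ≤ B := (norm_nonneg _).trans (hB 0 ⟨le_rfl, hT⟩)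
  -- The curve t ↦ Φ t x + s h(t) solves the equation up to a defect O(s²). Grönwall compares it
  -- with the true trajectory from b(s), whose initial distance to it is o(s).
  have est : ∀ s : ℝ, ‖Φ T (b s) - (Φ T x + s • h T)‖
      ≤ gronwallBound ‖b s - (x + s • h 0)‖ K (0 + M * (|s| * B) * (|s| * B)) T := by
    intro s
    have := dist_le_of_approx_trajectories_ODE (v := fun _ => v) (K := K) (a := 0) (b := T)
      (f := fun t => Φ t (b s)) (f' := fun t => v (Φ t (b s)))
      (g := fun t => Φ t x + s • h t) (g' := fun t => v (Φ t x) + s • fderiv ℝ v (Φ t x) (h t))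
      (εf := 0) (εg := M * (|s| * B) * (|s| * B)) (δ := ‖b s - (x + s • h 0)‖)
      (fun _ => hK) (fun t _ => (hΦ (b s) t).continuousAt.continuousWithinAt)
      (fun t _ => (hΦ (b s) t).hasDerivWithinAt) (fun t _ => by simp)
      (fun t _ => ((hΦ x t).add ((hh t).const_smul s)).continuousAt.continuousWithinAt)
      (fun t _ => ((hΦ x t).add ((hh t).const_smul s)).hasDerivWithinAt) (fun t ht => ?_)
      (by simp only [dist_eq_norm, h0]; exact le_rfl) T ⟨hT, le_rfl⟩
    · rw [dist_eq_norm, sub_zero] at this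
      exact this
    · rw [dist_eq_norm, norm_sub_rev, ← sub_sub, ← map_smul]
      refine (taylor _ _).trans ?_
      have : ‖s • h t‖ ≤ |s| * B := by
        rw [norm_smul, Real.norm_eq_abs]
        exact mul_le_mul_of_nonneg_left (hB t (Set.Ico_subset_Icc_self ht)) (abs_nonneg s)
      gcongr
  -- Linearity of the Grönwall bound in initial error and defect turns o(s) + O(s²) into o(s) at
  -- time T.
  have lin : ∃ C : ℝ, ∀ δ ε : ℝ, 0 ≤ δ → 0 ≤ ε → gronwallBound δ K ε T ≤ C * (δ + ε) := by
    by_cases hK0 : (K : ℝ) = 0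
    · refine ⟨1 + T, fun δ ε hδ hε => ?_⟩
      rw [hK0, gronwallBound_K0]
      nlinarith [mul_nonneg hT hδ]
    · have hKpos : 0 < (K : ℝ) := lt_of_le_of_ne K.2 (Ne.symm hK0)
      refine ⟨Real.exp (K * T) + 1 / K * (Real.exp (K * T) - 1), fun δ ε hδ hε => ?_⟩
      rw [gronwallBound_of_K_ne_0 hK0]
      have h1 : 0 ≤ Real.exp (K * T) - 1 := by
        have := Real.one_le_exp (x := K * T) (by positivity)
        linarith
      have h2 : 0 ≤ 1 / K * (Real.exp (K * T) - 1) := by positivity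
      have h3 : ε / K * (Real.exp (K * T) - 1) = (1 / K * (Real.exp (K * T) - 1)) * ε := by ring
      simp only [h3]
      nlinarith [mul_nonneg h2 hδ, mul_nonneg (Real.exp_pos (K * T)).le hε]
  obtain ⟨C, hC⟩ := lin
  rw [hasDerivAt_iff_isLittleO] at hb ⊢
  simp only [hb0, sub_zero] at hb ⊢
  have o1 : (fun s : ℝ => |s| ^ 2) =o[𝓝 0] fun s => s := by
    have : (fun s : ℝ => s ^ 2) =o[𝓝 0] fun s => s := by
      simpa using Asymptotics.isLittleO_pow_id (𝕜 := ℝ) (n := 2) one_lt_two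
    simpa using this
  have o2 : (fun s : ℝ => C * (‖b s - x - s • h 0‖ + M * B * B * |s| ^ 2)) =o[𝓝 0] fun s => s :=
    (hb.norm_left.add (o1.const_mul_left _)).const_mul_left C
  refine Asymptotics.IsBigO.trans_isLittleO (Asymptotics.IsBigO.of_bound 1 ?_) o2
  refine Filter.Eventually.of_forall fun s => ?_
  rw [one_mul]
  refine le_trans ?_ (le_abs_self _)
  rw [sub_sub]
  refine (est s).trans ((hC _ _ (norm_nonneg _) (by positivity)).trans (le_of_eq ?_))
  rw [sub_sub]; ring

/-- The first variation of a flow. -/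
lemma hasDerivAt_flow {v : E → E} (hv : ContDiff ℝ 2 v) (hc : HasCompactSupport v)
    {Φ : ℝ → E → E} (h0 : ∀ x, Φ 0 x = x)
    (hΦ : ∀ x t, HasDerivAt (fun s => Φ s x) (v (Φ t x)) t) {x : E} {h : ℝ → E}
    (hh : ∀ t, HasDerivAt h (fderiv ℝ v (Φ t x) (h t)) t) {b : ℝ → E} (hb0 : b 0 = x)
    (hb : HasDerivAt b (h 0) 0) (T : ℝ) :
    HasDerivAt (fun s => Φ T (b s)) (h T) 0 := by
  rcases le_total 0 T with hT | hT
  · exact hasDerivAt_flow_of_nonneg hv hc h0 hΦ hh hb0 hb hT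
  · have key := hasDerivAt_flow_of_nonneg (v := fun y => -v y) (Φ := fun t y => Φ (-t) y)
      (x := x) (h := fun t => h (-t)) (b := b) (T := -T) hv.neg
      (hc.comp_left (g := fun y => -y) neg_zero) (fun y => by simp [h0])
      (fun y t => ?_) (fun t => ?_) hb0 (by simpa using hb) (by linarith)
    · simpa using key
    · simpa [Function.comp_def] using (hΦ y (-t)).scomp t (hasDerivAt_neg t)
    · have e : fderiv ℝ (fun y => -v y) (Φ (-t) x) = -fderiv ℝ v (Φ (-t) x) := fderiv_fun_neg
      rw [e]
      simpa [Function.comp_def] using (hh (-t)).scomp t (hasDerivAt_neg t)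

end Flow

/-- A periodic integral curve of a vector field with small Lipschitz constant is constant. -/
lemma eq_zero_of_periodic_integralCurve {E : Type*} [NormedAddCommGroup E] [NormedSpace ℝ E]
    [CompleteSpace E] {v : E → E} {K : NNReal} (hK : LipschitzWith K v) {x : ℝ → E}
    (hx : ∀ t, HasDerivAt x (v (x t)) t) {T : ℝ} (hT : 0 < T) (hper : Function.Periodic x T)
    (hKT : K * T < 1) (t : ℝ) : v (x t) = 0 := by
  have hxc : Continuous x := continuous_iff_continuousAt.2 fun t => (hx t).continuousAt
  have hvc : Continuous fun t => v (x t) := hK.continuous.comp hxc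
  obtain ⟨t₁, -, hmax⟩ := isCompact_Icc.exists_isMaxOn (Set.nonempty_Icc.2 hT.le)
    (hvc.norm.continuousOn (s := Set.Icc 0 T))
  set m := ‖v (x t₁)‖ with hm
  have hle : ∀ s, ‖v (x s)‖ ≤ m := by
    intro s
    obtain ⟨s', hs', e⟩ := hper.exists_mem_Ico₀ hT s
    rw [e]
    exact hmax (Set.Ico_subset_Icc_self hs')
  have hlip : ∀ s, ‖x s - x t₁‖ ≤ m * |s - t₁| := by
    intro s
    have := convex_univ.norm_image_sub_le_of_norm_hasDerivWithin_le (f := x)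
      (f' := fun t => v (x t)) (C := m) (x := t₁) (y := s) (fun t _ => (hx t).hasDerivWithinAt)
      (fun t _ => hle t) trivial trivial
    simpa [Real.norm_eq_abs] using this
  -- Over one period starting where the speed attains its maximum m, the point moves at most mT, so
  -- its velocity stays within KmT of v(x t₁). The displacement is zero by periodicity, so mT ≤
  -- KmT·T, which forces m = 0 when KT < 1.
  have key : ‖x (t₁ + T) - x t₁ - ((t₁ + T) - t₁) • v (x t₁)‖ ≤ K * (m * T) * |T| := by
    have := (convex_Icc t₁ (t₁ + T)).norm_image_sub_le_of_norm_hasDerivWithin_le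
      (f := fun t => x t - (t - t₁) • v (x t₁)) (f' := fun t => v (x t) - v (x t₁))
      (C := K * (m * T)) (x := t₁) (y := t₁ + T) (fun t _ => ?_) (fun t ht => ?_)
      ⟨le_rfl, by linarith⟩ ⟨by linarith, le_rfl⟩
    · simpa [Real.norm_eq_abs, sub_right_comm] using this
    · have h1 : HasDerivAt (fun t => (t - t₁) • v (x t₁)) ((1 : ℝ) • v (x t₁)) t :=
        ((hasDerivAt_id t).sub_const t₁).smul_const _
      rw [one_smul] at h1
      exact ((hx t).sub h1).hasDerivWithinAt
    · have h1 := hK.dist_le_mul (x t) (x t₁)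
      rw [dist_eq_norm, dist_eq_norm] at h1
      refine h1.trans ?_
      gcongr
      refine (hlip t).trans ?_
      rw [abs_of_nonneg (by linarith [ht.1])]
      gcongr
      linarith [ht.2]
  rw [hper, sub_self, zero_sub, norm_neg, add_sub_cancel_left, norm_smul, Real.norm_eq_abs,
    abs_of_pos hT, ← hm] at key
  have hm0 : m = 0 := by
    have h0 : 0 ≤ m := norm_nonneg _
    by_contra hne
    have hmp : 0 < m := lt_of_le_of_ne h0 (Ne.symm hne)
    have : T * m * (K * T) < T * m * 1 := by gcongr
    nlinarith
  exact norm_le_zero_iff.1 ((hle t).trans hm0.le)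

instance fact_finrank_euclideanSpace_three : Fact (Module.finrank ℝ (EuclideanSpace ℝ (Fin 3)) = 2 + 1) :=
  ⟨finrank_euclideanSpace_fin⟩

lemma contMDiff_coe_S2 : ContMDiff (𝓡 2) 𝓘(ℝ, EuclideanSpace ℝ (Fin 3)) ∞
    ((↑) : S2 → EuclideanSpace ℝ (Fin 3)) :=
  contMDiff_coe_sphere (n := 2)

/-! ### Radial extension of functions on `S²` -/

/-- `ℝ³`. -/
abbrev E3 : Type := EuclideanSpace ℝ (Fin 3)

/-- `F` is a smooth compactly supported function on `ℝ³`, which near `S²` is the extension of `f`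
that is constant on rays. -/
structure IsRadialExtension (f : S2 → ℝ) (F : E3 → ℝ) : Prop where
  smooth : ContDiff ℝ ∞ F
  compact : HasCompactSupport F
  eq : ∀ (x : S2) (r : ℝ), 9 / 10 < r → r < 11 / 10 → F (r • (x : E3)) = f x

lemma contMDiff_normalize {m : E3 → E3} (hm : ContDiff ℝ ∞ m) (h0 : ∀ x, m x ≠ 0) :
    ∃ N : E3 → S2, ContMDiff 𝓘(ℝ, E3) (𝓡 2) ∞ N ∧ ∀ x, (N x : E3) = ‖m x‖⁻¹ • m x := by
  have hN : ContDiff ℝ ∞ fun x => ‖m x‖⁻¹ • m x :=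
    ((hm.norm ℝ h0).inv fun x => norm_ne_zero_iff.2 (h0 x)).smul hm
  have hmem : ∀ x, ‖m x‖⁻¹ • m x ∈ Metric.sphere (0 : E3) 1 := fun x => by
    rw [mem_sphere_zero_iff_norm, norm_smul, norm_inv, norm_norm]
    exact inv_mul_cancel₀ (norm_ne_zero_iff.2 (h0 x))
  exact ⟨_, ContMDiff.codRestrict_sphere (n := 2) hN.contMDiff hmem, fun x => rfl⟩

open Classical in
/-- The radial projection `ℝ³ \ {0} → S²`. -/
noncomputable def direction (x : E3) : S2 :=
  if h : x = 0 then ⟨EuclideanSpace.single 0 1, by simp⟩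
  else ⟨‖x‖⁻¹ • x, by
    rw [mem_sphere_zero_iff_norm, norm_smul, norm_inv, norm_norm]
    exact inv_mul_cancel₀ (norm_ne_zero_iff.2 h)⟩

lemma coe_direction {x : E3} (h : x ≠ 0) : (direction x : E3) = ‖x‖⁻¹ • x := by
  simp [direction, h]

lemma direction_smul (x : S2) {r : ℝ} (hr : 0 < r) : direction (r • (x : E3)) = x := by
  have hx : ‖(x : E3)‖ = 1 := mem_sphere_zero_iff_norm.1 x.2
  have hx0 : (x : E3) ≠ 0 := fun h => by simp [h] at hx
  apply Subtype.ext
  rw [coe_direction (smul_ne_zero hr.ne' hx0), norm_smul, hx, smul_smul, Real.norm_eq_abs,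
    abs_of_pos hr, mul_one, inv_mul_cancel₀ hr.ne', one_smul]

/-- `direction` is singular at 0, so near x₀ it is replaced by the normalization of x₀ + b(x)(x −
x₀). This globally smooth map stays within ‖x₀‖/2 of x₀, hence avoids 0, and equals x where the bump
b is 1. -/
lemma contDiffAt_comp_direction {f : S2 → ℝ} (hf : ContMDiff (𝓡 2) 𝓘(ℝ, ℝ) ∞ f) {x₀ : E3}
    (hx : x₀ ≠ 0) : ContDiffAt ℝ ∞ (fun x => f (direction x)) x₀ := by
  have hn : 0 < ‖x₀‖ := norm_pos_iff.2 hx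
  let b : ContDiffBump x₀ := ⟨‖x₀‖ / 4, ‖x₀‖ / 2, by positivity, by linarith⟩
  have hm : ContDiff ℝ ∞ fun x => x₀ + b x • (x - x₀) :=
    contDiff_const.add (b.contDiff.smul (contDiff_id.sub contDiff_const))
  have h0 : ∀ x, x₀ + b x • (x - x₀) ≠ 0 := by
    intro x hcon
    have h1 : ‖b x • (x - x₀)‖ ≤ ‖x₀‖ / 2 := by
      by_cases hxb : dist x x₀ < ‖x₀‖ / 2
      · rw [norm_smul, Real.norm_eq_abs, abs_of_nonneg b.nonneg, ← dist_eq_norm]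
        have := b.le_one (x := x)
        have := b.nonneg (x := x)
        nlinarith [dist_nonneg (x := x) (y := x₀)]
      · rw [b.zero_of_le_dist (not_lt.1 hxb), zero_smul, norm_zero]; positivity
    rw [add_eq_zero_iff_eq_neg] at hcon
    have h2 : ‖x₀‖ = ‖b x • (x - x₀)‖ := by
      conv_lhs => rw [hcon]
      rw [norm_neg]
    linarith
  obtain ⟨N, hN, hNeq⟩ := contMDiff_normalize hm h0
  have hfN : ContDiff ℝ ∞ (f ∘ N) := contMDiff_iff_contDiff.1 (hf.comp hN)
  refine hfN.contDiffAt.congr_of_eventuallyEq ?_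
  have h1 : ∀ᶠ x in 𝓝 x₀, b x = 1 := b.eventuallyEq_one
  have h2 : ∀ᶠ x in 𝓝 x₀, x ≠ 0 := isOpen_ne.mem_nhds hx
  filter_upwards [h1, h2] with x hx1 hx2
  have : direction x = N x := by
    apply Subtype.ext
    rw [hNeq, coe_direction hx2, hx1, one_smul, add_sub_cancel]
  simp [this]

/-- A bump function on `ℝ`, equal to `1` near `1` and supported in `[1/2, 3/2]`. -/
noncomputable def bumpAtOne : ContDiffBump (1 : ℝ) := ⟨1 / 4, 1 / 2, by norm_num, by norm_num⟩

/-- The radial extension of `f`, cut off away from `S²`. -/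
noncomputable def radialExtension (f : S2 → ℝ) (x : E3) : ℝ :=
  bumpAtOne (‖x‖ ^ 2) * f (direction x)

lemma bumpAtOne_eq_zero {t : ℝ} (h : t ≤ 1 / 2 ∨ 3 / 2 ≤ t) : bumpAtOne t = 0 := by
  apply bumpAtOne.zero_of_le_dist
  show (1 / 2 : ℝ) ≤ dist t 1
  rw [Real.dist_eq]
  rcases h with h | h
  · rw [abs_of_nonpos (by linarith)]; linarith
  · rw [abs_of_nonneg (by linarith)]; linarith

lemma bumpAtOne_eq_one {t : ℝ} (h : 3 / 4 ≤ t) (h' : t ≤ 5 / 4) : bumpAtOne t = 1 := by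
  apply bumpAtOne.one_of_mem_closedBall
  show t ∈ Metric.closedBall (1 : ℝ) (1 / 4)
  rw [Metric.mem_closedBall, Real.dist_eq, abs_le]
  constructor <;> linarith

lemma isRadialExtension_radialExtension {f : S2 → ℝ} (hf : ContMDiff (𝓡 2) 𝓘(ℝ, ℝ) ∞ f) :
    IsRadialExtension f (radialExtension f) where
  smooth := by
    rw [contDiff_iff_contDiffAt]
    intro x
    by_cases hx : x = 0
    · have h1 : ∀ᶠ y : E3 in 𝓝 x, ‖y‖ ^ 2 < 1 / 2 :=
        (continuous_norm.pow 2).continuousAt.eventually_lt continuousAt_const (by simp [hx])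
      refine (contDiffAt_const (c := (0 : ℝ))).congr_of_eventuallyEq ?_
      filter_upwards [h1] with y hy
      rw [radialExtension, bumpAtOne_eq_zero (Or.inl hy.le), zero_mul]
    · exact (bumpAtOne.contDiff.contDiffAt.comp x (contDiff_norm_sq ℝ).contDiffAt).mul
        (contDiffAt_comp_direction hf hx)
  compact := by
    refine HasCompactSupport.of_support_subset_isCompact (isCompact_closedBall (0 : E3) 2) ?_
    intro x hx
    rw [mem_closedBall_zero_iff]
    by_contra! hcon
    apply hx
    rw [radialExtension, bumpAtOne_eq_zero (Or.inr (by nlinarith)), zero_mul]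
  eq x r h1 h2 := by
    have hx : ‖(x : E3)‖ = 1 := mem_sphere_zero_iff_norm.1 x.2
    rw [radialExtension, direction_smul x (by linarith), norm_smul, hx, mul_one, Real.norm_eq_abs,
      sq_abs, bumpAtOne_eq_one (by nlinarith) (by nlinarith), one_mul]

lemma radialExtension_mulVec {f : S2 → ℝ} {B : SO3} (hB : ∀ x, f (B • x) = f x) (x : E3) :
    radialExtension f (WithLp.toLp 2 (B.1.mulVec x.ofLp)) = radialExtension f x := by
  by_cases hx : x = 0
  · have : (WithLp.toLp 2 (B.1.mulVec x.ofLp) : E3) = x := by simp [hx]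
    rw [this]
  have hn : 0 < ‖x‖ := norm_pos_iff.2 hx
  have hxd : x = ‖x‖ • (direction x : E3) := by
    rw [coe_direction hx, smul_smul, mul_inv_cancel₀ hn.ne', one_smul]
  have hBx : (WithLp.toLp 2 (B.1.mulVec x.ofLp) : E3) = ‖x‖ • ((B • direction x : S2) : E3) := by
    ext i
    conv_lhs => rw [hxd]
    simp only [WithLp.ofLp_smul, Matrix.mulVec_smul, coe_smul_S2]
  have hnorm : ‖(WithLp.toLp 2 (B.1.mulVec x.ofLp) : E3)‖ = ‖x‖ := by
    rw [hBx, norm_smul, mem_sphere_zero_iff_norm.1 (B • direction x).2, mul_one, norm_norm]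
  rw [radialExtension, radialExtension, hnorm, hBx, direction_smul _ hn, hB]

/-! ### Critical points and Hessians in terms of the radial extension -/

/-- Second derivative of a composition at a critical point. -/
lemma fderiv_fderiv_comp_of_fderiv_eq_zero {E E' : Type*} [NormedAddCommGroup E]
    [NormedSpace ℝ E] [NormedAddCommGroup E'] [NormedSpace ℝ E'] {F : E' → ℝ} {ψ : E → E'}
    (hF : ContDiff ℝ 2 F) (hψ : ContDiff ℝ 2 ψ) {x : E} (h0 : fderiv ℝ F (ψ x) = 0) (u v : E) :
    fderiv ℝ (fderiv ℝ (F ∘ ψ)) x u v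
      = fderiv ℝ (fderiv ℝ F) (ψ x) (fderiv ℝ ψ x u) (fderiv ℝ ψ x v) := by
  have hFd := hF.differentiable two_ne_zero
  have hψd := hψ.differentiable two_ne_zero
  have e : fderiv ℝ (F ∘ ψ) = fun y => (fderiv ℝ F (ψ y)).comp (fderiv ℝ ψ y) := by
    funext y
    exact fderiv_comp y (hFd _) (hψd _)
  have h1 : HasFDerivAt (fun y => fderiv ℝ F (ψ y))
      ((fderiv ℝ (fderiv ℝ F) (ψ x)).comp (fderiv ℝ ψ x)) x :=
    (((hF.fderiv_right (m := 1) (by norm_num)).differentiable one_ne_zero _).hasFDerivAt).comp x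
      (hψd x).hasFDerivAt
  have h2 : HasFDerivAt (fderiv ℝ ψ) (fderiv ℝ (fderiv ℝ ψ) x) x :=
    ((hψ.fderiv_right (m := 1) (by norm_num)).differentiable one_ne_zero _).hasFDerivAt
  rw [e, (h1.clm_comp h2).fderiv]
  simp [h0]

/-- The inclusion `S² ⊂ ℝ³` in the stereographic chart centred at `p`. -/
noncomputable def chartIncl (p : S2) (u : EuclideanSpace ℝ (Fin 2)) : E3 :=
  ((chartAt (EuclideanSpace ℝ (Fin 2)) p).symm u : S2)

lemma contDiff_chartIncl (p : S2) : ContDiff ℝ ∞ (chartIncl p) := by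
  have h := contMDiff_coe_S2.comp_contMDiffOn
    (contMDiffOn_chart_symm (I := 𝓡 2) (x := p) (n := ∞))
  -- The stereographic chart is onto the plane, so its inverse is smooth on the whole plane and no
  -- chart domain has to be tracked.
  have ht : (chartAt (EuclideanSpace ℝ (Fin 2)) p).target = Set.univ :=
    stereographic'_target (n := 2) (-p)
  rw [ht, contMDiffOn_univ] at h
  exact contMDiff_iff_contDiff.1 h

/-- The centre of the chart at `p`. -/
noncomputable def chartCenter (p : S2) : EuclideanSpace ℝ (Fin 2) :=
  chartAt (EuclideanSpace ℝ (Fin 2)) p p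

lemma chartIncl_chartCenter (p : S2) : chartIncl p (chartCenter p) = p := by
  rw [chartIncl, chartCenter, OpenPartialHomeomorph.left_inv _ (mem_chart_source _ p)]

lemma mvfderiv_coe_eq (p : S2) (u : EuclideanSpace ℝ (Fin 2)) :
    mvfderiv (𝓡 2) ((↑) : S2 → E3) p u = fderiv ℝ (chartIncl p) (chartCenter p) u := by
  rw [((contMDiff_coe_S2 p).mdifferentiableAt (by simp)).mvfderiv]
  simp only [fderivWithin_univ, mfld_simps]
  rfl

lemma exists_fderiv_chartIncl_eq (p : S2) {x : E3} (hx : inner ℝ (p : E3) x = 0) :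
    ∃ u, fderiv ℝ (chartIncl p) (chartCenter p) u = x := by
  have hx' : x ∈ (Submodule.span ℝ {(p : E3)})ᗮ :=
    Submodule.mem_orthogonal_singleton_iff_inner_right.2 hx
  rw [← range_mvfderiv_subtypeVal (n := 2) p] at hx'
  obtain ⟨u, hu⟩ := hx'
  exact ⟨u, (mvfderiv_coe_eq p u).symm.trans hu⟩

namespace IsRadialExtension

variable {f : S2 → ℝ} {F : E3 → ℝ}

lemma coe_eq (h : IsRadialExtension f F) (x : S2) : F x = f x := by
  simpa using h.eq x 1 (by norm_num) (by norm_num)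

lemma comp_chart_symm (h : IsRadialExtension f F) (p : S2) :
    f ∘ (chartAt (EuclideanSpace ℝ (Fin 2)) p).symm = F ∘ chartIncl p := by
  funext u
  exact (h.coe_eq _).symm

lemma contDiff_two (h : IsRadialExtension f F) : ContDiff ℝ 2 F := h.smooth.of_le ENat.LEInfty.out

/-- F is constant on the ray through p near p. Thus the ambient differential has no normal
component, and vanishes as soon as it vanishes on the tangent plane. -/
lemma fderiv_self (h : IsRadialExtension f F) (p : S2) : fderiv ℝ F p p = 0 := by
  have h1 : HasDerivAt (fun r : ℝ => r • (p : E3)) (p : E3) 1 := by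
    simpa using (hasDerivAt_id (1 : ℝ)).smul_const (p : E3)
  have h2 : HasFDerivAt F (fderiv ℝ F p) ((1 : ℝ) • (p : E3)) := by
    rw [one_smul]
    exact (h.smooth.differentiable (by simp) _).hasFDerivAt
  have h3 := h2.comp_hasDerivAt (1 : ℝ) h1
  have h4 : (F ∘ fun r : ℝ => r • (p : E3)) =ᶠ[𝓝 1] fun _ => f p := by
    filter_upwards [Ioo_mem_nhds (show (9 / 10 : ℝ) < 1 by norm_num)
      (show (1 : ℝ) < 11 / 10 by norm_num)] with r hr
    exact h.eq p r hr.1 hr.2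
  exact h3.unique ((hasDerivAt_const (1 : ℝ) (f p)).congr_of_eventuallyEq h4)

lemma isCrit_iff (h : IsRadialExtension f F) (hf : ContMDiff (𝓡 2) 𝓘(ℝ, ℝ) ∞ f) (p : S2) :
    IsCrit f p ↔ fderiv ℝ F p = 0 := by
  have e : (mfderiv (𝓡 2) 𝓘(ℝ, ℝ) f p : _ → ℝ)
      = (fderiv ℝ F p).comp (fderiv ℝ (chartIncl p) (chartCenter p)) := by
    rw [(hf.mdifferentiableAt (by simp)).mfderiv]
    have h1 : fderiv ℝ (F ∘ chartIncl p) (chartCenter p)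
        = (fderiv ℝ F p).comp (fderiv ℝ (chartIncl p) (chartCenter p)) := by
      have h2 := fderiv_comp (chartCenter p) (h.smooth.differentiable (by simp) (chartIncl p (chartCenter p)))
        ((contDiff_chartIncl p).differentiable (by simp) (chartCenter p))
      rwa [chartIncl_chartCenter] at h2
    rw [← h1, ← h.comp_chart_symm]
    simp only [fderivWithin_univ, mfld_simps]
    rfl
  constructor
  · intro hp
    have e' : ∀ u, fderiv ℝ F p (fderiv ℝ (chartIncl p) (chartCenter p) u) = 0 := by
      intro u
      have := congrFun e u
      rw [show mfderiv (𝓡 2) 𝓘(ℝ, ℝ) f p = 0 from hp] at this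
      exact this.symm
    ext x
    have hx : x = inner ℝ (p : E3) x • (p : E3) + (x - inner ℝ (p : E3) x • (p : E3)) := by abel
    have hp1 : ‖(p : E3)‖ = 1 := mem_sphere_zero_iff_norm.1 p.2
    obtain ⟨u, hu⟩ := exists_fderiv_chartIncl_eq p (x := x - inner ℝ (p : E3) x • (p : E3)) (by
      rw [inner_sub_right, inner_smul_right, real_inner_self_eq_norm_sq, hp1]; ring)
    rw [hx, map_add, map_smul, h.fderiv_self, ← hu, e' u]
    simp
  · intro hp
    rw [hp] at e
    show mfderiv (𝓡 2) 𝓘(ℝ, ℝ) f p = 0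
    ext u
    exact congrFun e u

/-- At a critical point of F the second derivative of the chart inclusion does not contribute, so
the chart Hessian is the ambient one restricted to the tangent plane. -/
lemma hessian_eq (h : IsRadialExtension f F) {p : S2} (hp : fderiv ℝ F p = 0)
    (u v : EuclideanSpace ℝ (Fin 2)) :
    hessian f p u v = fderiv ℝ (fderiv ℝ F) p (fderiv ℝ (chartIncl p) (chartCenter p) u)
      (fderiv ℝ (chartIncl p) (chartCenter p) v) := by
  have := fderiv_fderiv_comp_of_fderiv_eq_zero h.contDiff_two
    ((contDiff_chartIncl p).of_le ENat.LEInfty.out) (x := chartCenter p)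
    (by rw [chartIncl_chartCenter, hp]) u v
  rw [chartIncl_chartCenter, ← h.comp_chart_symm] at this
  exact this

end IsRadialExtension

/-! ### Signature of binary quadratic forms and the Morse index -/

section Signature

variable {M : Type*} [AddCommGroup M] [Module ℝ M] [Module.Finite ℝ M] {Q : QuadraticForm ℝ M}

lemma sigNeg_eq_zero_of_pos (h : ∀ v, v ≠ 0 → 0 < Q v) : sigNeg Q = 0 := by
  obtain ⟨V, hV, hneg⟩ := exists_finrank_eq_sigNeg_and_negDef (Q := Q)
  have : V = ⊥ := by
    rw [Submodule.eq_bot_iff]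
    intro x hx
    by_contra hx0
    have h1 : 0 < -Q x := hneg ⟨x, hx⟩ (fun hc => hx0 (congrArg Subtype.val hc))
    linarith [h x hx0]
  rw [← hV, this, finrank_bot]

lemma sigNeg_eq_finrank_of_neg (h : ∀ v, v ≠ 0 → Q v < 0) :
    sigNeg Q = Module.finrank ℝ M := by
  refine le_antisymm (sigPos_le_finrank _) ?_
  have : ((-Q).restrict ⊤).PosDef := by
    intro x hx
    have h1 := h x.1 (fun hc => hx (Subtype.ext hc))
    show 0 < -Q x.1
    linarith
  have := le_sigNeg_of_negDef _ this
  rwa [finrank_top] at this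

/-- The line through v gives index at least 1; index 2 would make the whole plane negative definite,
which w contradicts. An isotropic w is enough. -/
lemma sigNeg_eq_one_of_indefinite (h2 : Module.finrank ℝ M = 2) {v w : M} (hv : Q v < 0)
    (hw0 : w ≠ 0) (hw : 0 ≤ Q w) : sigNeg Q = 1 := by
  have hv0 : v ≠ 0 := by rintro rfl; simp at hv
  refine le_antisymm ?_ ?_
  · obtain ⟨V, hV, hneg⟩ := exists_finrank_eq_sigNeg_and_negDef (Q := Q)
    rw [← hV]
    by_contra! hcon
    have hle := V.finrank_le
    have : V = ⊤ := Submodule.eq_top_of_finrank_eq (by omega)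
    have h1 : 0 < -Q w := hneg ⟨w, this ▸ trivial⟩ (fun hc => hw0 (congrArg Subtype.val hc))
    linarith
  · have : ((-Q).restrict (Submodule.span ℝ {v})).PosDef := by
      intro x hx
      obtain ⟨r, hr⟩ := Submodule.mem_span_singleton.1 x.2
      have hr0 : r ≠ 0 := by
        rintro rfl
        exact hx (Subtype.ext (by rw [← hr, zero_smul]; rfl))
      show 0 < -Q x.1
      rw [← hr, QuadraticMap.map_smul, smul_eq_mul]
      have := mul_pos_of_neg_of_neg hv (neg_neg_of_pos (mul_self_pos.2 hr0))
      nlinarith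
    have := le_sigNeg_of_negDef _ this
    rwa [finrank_span_singleton hv0] at this

end Signature

/-- The three possibilities for a nondegenerate binary quadratic form. -/
lemma binary_form_trichotomy {a b d : ℝ} (h : a * d - b ^ 2 ≠ 0) :
    (∀ v : Fin 2 → ℝ, v ≠ 0 → 0 < a * v 0 ^ 2 + 2 * b * v 0 * v 1 + d * v 1 ^ 2) ∨
    (∀ v : Fin 2 → ℝ, v ≠ 0 → a * v 0 ^ 2 + 2 * b * v 0 * v 1 + d * v 1 ^ 2 < 0) ∨
    ((∃ v : Fin 2 → ℝ, v ≠ 0 ∧ a * v 0 ^ 2 + 2 * b * v 0 * v 1 + d * v 1 ^ 2 = 0) ∧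
      ∃ v : Fin 2 → ℝ, a * v 0 ^ 2 + 2 * b * v 0 * v 1 + d * v 1 ^ 2 < 0) := by
  -- Completing the square: if ad − b² > 0 the form is definite with the sign of a.
  have sq_id : ∀ x y : ℝ, a * (a * x ^ 2 + 2 * b * x * y + d * y ^ 2)
      = (a * x + b * y) ^ 2 + (a * d - b ^ 2) * y ^ 2 := fun x y => by ring
  have pos : 0 < a * d - b ^ 2 → ∀ v : Fin 2 → ℝ, v ≠ 0 →
      0 < a * (a * v 0 ^ 2 + 2 * b * v 0 * v 1 + d * v 1 ^ 2) := by
    intro hδ v hv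
    rw [sq_id]
    have ha : a ≠ 0 := by rintro rfl; nlinarith [sq_nonneg b]
    by_cases h1 : v 1 = 0
    · have h0 : v 0 ≠ 0 := by
        intro h0
        apply hv
        ext i
        fin_cases i
        · exact h0
        · exact h1
      rw [h1]
      have : 0 < (a * v 0) ^ 2 := by positivity
      simpa using this
    · have : 0 < (a * d - b ^ 2) * v 1 ^ 2 := by positivity
      positivity
  rcases lt_or_gt_of_ne h with hδ | hδ
  · right; right
    by_cases ha : a = 0
    · have hb : b ≠ 0 := by rintro rfl; simp [ha] at hδ
      refine ⟨⟨![1, 0], fun hc => by simpa using congrFun hc 0, by simp [ha]⟩,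
        ⟨![-(d + 1) / (2 * b), 1], ?_⟩⟩
      simp [ha]
      field_simp
      linarith
    · set r := Real.sqrt (b ^ 2 - a * d)
      have hr : r ^ 2 = b ^ 2 - a * d := Real.sq_sqrt (by linarith)
      -- The isotropic direction is the root (−b + r)/a of the quadratic, written without the
      -- denominator.
      refine ⟨⟨![-b + r, a], fun hc => ha (by simpa using congrFun hc 1), ?_⟩, ?_⟩
      · simp
        linear_combination a * hr
      · rcases lt_or_gt_of_ne ha with ha' | ha'
        · exact ⟨![1, 0], by simpa using ha'⟩
        · refine ⟨![-b, a], ?_⟩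
          simp
          nlinarith
  · have ha : a ≠ 0 := by rintro rfl; nlinarith [sq_nonneg b]
    rcases lt_or_gt_of_ne ha with ha' | ha'
    · right; left
      intro v hv
      have := pos hδ v hv
      nlinarith
    · left
      intro v hv
      exact pos_of_mul_pos_right (pos hδ v hv) ha'.le

/-- The Morse index of a Morse function at a critical point, in terms of the matrix of the second
derivative of the radial extension with respect to a basis `e₁`, `e₂` of the tangent plane. -/
lemma IsRadialExtension.morseIndex_cases {f : S2 → ℝ} {F : E3 → ℝ} (h : IsRadialExtension f F)
    (hf : IsMorse f) {p : S2} (hp : IsCrit f p) {e₁ e₂ : E3} (h1 : inner ℝ (p : E3) e₁ = 0)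
    (h2 : inner ℝ (p : E3) e₂ = 0)
    (hind : ∀ x y : ℝ, x • e₁ + y • e₂ = 0 → x = 0 ∧ y = 0) {a b d : ℝ}
    (ha : fderiv ℝ (fderiv ℝ F) p e₁ e₁ = a) (hb : fderiv ℝ (fderiv ℝ F) p e₁ e₂ = b)
    (hd : fderiv ℝ (fderiv ℝ F) p e₂ e₂ = d) :
    a * d - b ^ 2 ≠ 0 ∧
    (((∀ v : Fin 2 → ℝ, v ≠ 0 → 0 < a * v 0 ^ 2 + 2 * b * v 0 * v 1 + d * v 1 ^ 2) ∧
      morseIndex f p = 0) ∨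
    ((∀ v : Fin 2 → ℝ, v ≠ 0 → a * v 0 ^ 2 + 2 * b * v 0 * v 1 + d * v 1 ^ 2 < 0) ∧
      morseIndex f p = 2) ∨
    ((∃ v : Fin 2 → ℝ, v ≠ 0 ∧ a * v 0 ^ 2 + 2 * b * v 0 * v 1 + d * v 1 ^ 2 = 0) ∧
      morseIndex f p = 1)) := by
  have hp' := (h.isCrit_iff hf.1 p).1 hp
  obtain ⟨u₁, rfl⟩ := exists_fderiv_chartIncl_eq p h1
  obtain ⟨u₂, rfl⟩ := exists_fderiv_chartIncl_eq p h2
  rw [← h.hessian_eq hp'] at ha hb hd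
  have hsymm : ∀ u v, hessian f p u v = hessian f p v u := by
    intro u v
    rw [h.hessian_eq hp', h.hessian_eq hp']
    exact (h.contDiff_two.contDiffAt.isSymmSndFDerivAt (by simp)) _ _
  have hind' : ∀ x y : ℝ, x • u₁ + y • u₂ = 0 → x = 0 ∧ y = 0 := by
    intro x y hxy
    apply hind
    rw [← map_smul, ← map_smul, ← map_add, hxy, map_zero]
  have hli : LinearIndependent ℝ ![u₁, u₂] := LinearIndependent.pair_iff.2 hind'
  have hfr : Module.finrank ℝ (EuclideanSpace ℝ (Fin 2)) = 2 := finrank_euclideanSpace_fin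
  have hspan : ∀ u, ∃ x y : ℝ, x • u₁ + y • u₂ = u := by
    intro u
    have h3 := hli.span_eq_top_of_card_eq_finrank' (by simp)
    have h4 : u ∈ Submodule.span ℝ (Set.range ![u₁, u₂]) := h3 ▸ trivial
    rw [Matrix.range_cons_cons_empty] at h4
    exact Submodule.mem_span_pair.1 h4
  have hform : ∀ x y : ℝ, hessian f p (x • u₁ + y • u₂) (x • u₁ + y • u₂)
      = a * x ^ 2 + 2 * b * x * y + d * y ^ 2 := by
    intro x y
    simp only [map_add, map_smul, LinearMap.add_apply, LinearMap.smul_apply, smul_eq_mul, ha, hb,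
      hd, hsymm u₂ u₁]
    ring
  have hδ : a * d - b ^ 2 ≠ 0 := by
    intro hδ
    -- A vanishing determinant yields a kernel vector of the Hessian: (−b, a), or (1, 0) when a = b
    -- = 0. The Morse condition excludes it.
    obtain ⟨x, y, hxy, e1, e2⟩ : ∃ x y : ℝ, ¬ (x = 0 ∧ y = 0) ∧ a * x + b * y = 0 ∧
        b * x + d * y = 0 := by
      by_cases hab : a = 0 ∧ b = 0
      · by_cases hd0 : d = 0
        · exact ⟨1, 0, by simp, by simp [hab], by simp [hab]⟩
        · exact ⟨1, 0, by simp, by simp [hab], by simp [hab]⟩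
      · exact ⟨-b, a, fun hc => hab ⟨hc.2, by linarith [hc.1]⟩, by ring, by linarith⟩
    apply hxy
    apply hind'
    refine hf.2 p hp _ fun w => ?_
    obtain ⟨x', y', rfl⟩ := hspan w
    simp only [map_add, map_smul, LinearMap.add_apply, LinearMap.smul_apply, smul_eq_mul, ha, hb,
      hd, hsymm u₂ u₁]
    linear_combination x' * e1 + y' * e2
  refine ⟨hδ, ?_⟩
  have hQ : ∀ x y : ℝ, LinearMap.BilinMap.toQuadraticMap (hessian f p) (x • u₁ + y • u₂)
      = a * x ^ 2 + 2 * b * x * y + d * y ^ 2 := hform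
  have hne : ∀ x y : ℝ, x • u₁ + y • u₂ ≠ 0 → (![x, y] : Fin 2 → ℝ) ≠ 0 := by
    intro x y hxy hc
    apply hxy
    have h0 : x = 0 := by simpa using congrFun hc 0
    have h1 : y = 0 := by simpa using congrFun hc 1
    simp [h0, h1]
  rcases binary_form_trichotomy hδ with hpos | hneg | ⟨⟨v, hv, hv0⟩, w, hw⟩
  · refine Or.inl ⟨hpos, sigNeg_eq_zero_of_pos fun u hu => ?_⟩
    obtain ⟨x, y, rfl⟩ := hspan u
    rw [hQ]
    simpa using hpos _ (hne x y hu)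
  · refine Or.inr (Or.inl ⟨hneg, ?_⟩)
    rw [← hfr]
    refine sigNeg_eq_finrank_of_neg fun u hu => ?_
    obtain ⟨x, y, rfl⟩ := hspan u
    rw [hQ]
    simpa using hneg _ (hne x y hu)
  · refine Or.inr (Or.inr ⟨⟨v, hv, hv0⟩, ?_⟩)
    refine sigNeg_eq_one_of_indefinite hfr (v := w 0 • u₁ + w 1 • u₂) (w := v 0 • u₁ + v 1 • u₂)
      ?_ ?_ ?_
    · rw [hQ]; exact hw
    · intro hc
      apply hv
      obtain ⟨h0, h1⟩ := hind' _ _ hc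
      ext i
      fin_cases i
      · exact h0
      · exact h1
    · rw [hQ]; exact hv0.ge

/-! ### The Reeb vector field on `S³`, extended to `ℂ²` -/

/-- Multiplication by `i` on `ℂ²`. -/
noncomputable def mulI : C2 →L[ℝ] C2 := LinearMap.toContinuousLinearMap
  { toFun := fun w => Complex.I • w
    map_add' := fun v w => smul_add _ v w
    map_smul' := fun r w => smul_comm _ r w }

lemma mulI_apply (w : C2) : mulI w = Complex.I • w := rfl

/-- The vector field `V₁(α, β) = (-conj β, conj α)` on `ℂ²`. -/
noncomputable def quatJ : C2 →L[ℝ] C2 := LinearMap.toContinuousLinearMap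
  { toFun := fun w => !₂[-(starRingEnd ℂ) (w 1), (starRingEnd ℂ) (w 0)]
    map_add' := fun v w => by
      ext i; fin_cases i
      · simp; ring
      · simp
    map_smul' := fun r w => by ext i; fin_cases i <;> simp }

lemma quatJ_apply (w : C2) :
    quatJ w = !₂[-(starRingEnd ℂ) (w 1), (starRingEnd ℂ) (w 0)] := rfl

lemma quatJ_zero (w : C2) : quatJ w 0 = -(starRingEnd ℂ) (w 1) := rfl

lemma quatJ_one (w : C2) : quatJ w 1 = (starRingEnd ℂ) (w 0) := rfl

lemma frame_eq (z : S3) (η : Fin 2 → ℝ) :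
    frame z η = ((η 0 : ℂ) + (η 1 : ℂ) * Complex.I) • quatJ z := rfl

/-- The polarization of the Hopf map: the symmetric bilinear map whose value at `(w, v)` is the
derivative at `w` of the quadratic extension of the Hopf map in the direction `v`. -/
noncomputable def hopfBilin : C2 →L[ℝ] C2 →L[ℝ] E3 := LinearMap.toContinuousBilinearMap
  (LinearMap.mk₂ ℝ (fun w v : C2 =>
    (!₂[2 * ((starRingEnd ℂ) (w 0) * v 0).re - 2 * ((starRingEnd ℂ) (w 1) * v 1).re,
      -2 * ((starRingEnd ℂ) (v 0) * w 1 + (starRingEnd ℂ) (w 0) * v 1).im,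
      -2 * ((starRingEnd ℂ) (v 0) * w 1 + (starRingEnd ℂ) (w 0) * v 1).re] : E3))
    (fun a b v => by ext i; fin_cases i <;> simp <;> ring)
    (fun r a v => by ext i; fin_cases i <;> simp <;> ring)
    (fun a v w => by ext i; fin_cases i <;> simp <;> ring)
    (fun r a v => by ext i; fin_cases i <;> simp <;> ring))

lemma hopfBilin_apply (w v : C2) : hopfBilin w v =
    !₂[2 * ((starRingEnd ℂ) (w 0) * v 0).re - 2 * ((starRingEnd ℂ) (w 1) * v 1).re,
      -2 * ((starRingEnd ℂ) (v 0) * w 1 + (starRingEnd ℂ) (w 0) * v 1).im,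
      -2 * ((starRingEnd ℂ) (v 0) * w 1 + (starRingEnd ℂ) (w 0) * v 1).re] := rfl

lemma hopfBilin_comm (w v : C2) : hopfBilin w v = hopfBilin v w := by
  rw [hopfBilin_apply, hopfBilin_apply]
  ext i; fin_cases i <;> simp <;> ring

/-- The quadratic extension of the Hopf map. -/
noncomputable def hopfExt (w : C2) : E3 := (1 / 2 : ℝ) • hopfBilin w w

lemma hopfExt_apply (w : C2) : hopfExt w =
    !₂[Complex.normSq (w 0) - Complex.normSq (w 1), -2 * ((starRingEnd ℂ) (w 0) * w 1).im,
      -2 * ((starRingEnd ℂ) (w 0) * w 1).re] := by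
  rw [hopfExt, hopfBilin_apply]
  ext i; fin_cases i <;> simp [Complex.normSq_apply] <;> ring

lemma coe_hopf (z : S3) : (hopf z : E3) = hopfExt z := (hopfExt_apply z).symm

lemma hasFDerivAt_hopfExt (w : C2) : HasFDerivAt hopfExt (hopfBilin w) w := by
  have h := ((hopfBilin.hasFDerivAt (x := w)).clm_apply (hasFDerivAt_id w)).const_smul (1 / 2 : ℝ)
  refine h.congr_fderiv ?_
  ext v : 1
  simp only [smul_apply, add_apply,
    ContinuousLinearMap.comp_apply, ContinuousLinearMap.flip_apply, id,
    ContinuousLinearMap.id_apply]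
  rw [hopfBilin_comm v w, ← two_smul ℝ, smul_smul]
  norm_num

lemma contDiff_hopfExt {n : WithTop ℕ∞} : ContDiff ℝ n hopfExt :=
  (hopfBilin.contDiff.clm_apply contDiff_id).const_smul (1 / 2 : ℝ)

/-- The square of the norm of `ℂ²`. -/
noncomputable def normSqC2 (w : C2) : ℝ := (herm w w).re

lemma normSqC2_eq (w : C2) : normSqC2 w = ‖w‖ ^ 2 := by
  rw [normSqC2, herm, inner_self_eq_norm_sq_to_K]
  norm_cast

lemma normSqC2_apply (w : C2) :
    normSqC2 w = (w 0).re ^ 2 + (w 0).im ^ 2 + ((w 1).re ^ 2 + (w 1).im ^ 2) := by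
  rw [normSqC2, herm_eq]
  simp
  ring

lemma normSqC2_coe (z : S3) : normSqC2 z = 1 := by rw [normSqC2, S3.herm_self]; rfl

/-- The `ℝ`-bilinear form `herm`. -/
noncomputable def hermBilin : C2 →L[ℝ] C2 →L[ℝ] ℂ := LinearMap.toContinuousBilinearMap
  (LinearMap.mk₂ ℝ (fun w v : C2 => herm w v)
    (fun a b v => inner_add_left _ _ _)
    (fun r a v => by simp)
    (fun a v w => inner_add_right _ _ _)
    (fun r a v => by simp))

lemma hermBilin_apply (w v : C2) : hermBilin w v = herm w v := rfl

lemma hasFDerivAt_normSqC2 (w : C2) :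
    HasFDerivAt normSqC2 ((2 : ℝ) • Complex.reCLM.comp (hermBilin w)) w := by
  have h := Complex.reCLM.hasFDerivAt.comp w
    ((hermBilin.hasFDerivAt (x := w)).clm_apply (hasFDerivAt_id w))
  refine h.congr_fderiv ?_
  ext v
  simp [hermBilin_apply, herm_eq]
  ring

lemma contDiff_normSqC2 {n : WithTop ℕ∞} : ContDiff ℝ n normSqC2 :=
  Complex.reCLM.contDiff.comp (hermBilin.contDiff.clm_apply contDiff_id)

section Field

variable (F : E3 → ℝ) (ε : ℝ)

/-- The conformal factor `1 + ε F(hopf w)`. -/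
noncomputable def conformal (w : C2) : ℝ := 1 + ε * F (hopfExt w)

/-- The derivative of `F ∘ hopf` along `c V₁`. -/
noncomputable def slope (c : C2 →L[ℝ] C2) (w : C2) : ℝ :=
  fderiv ℝ F (hopfExt w) (hopfBilin w (c (quatJ w)))

/-- The Reeb vector field of the contact form `(1 + ε F(hopf)) λ` on `S³`, before cutting off. -/
noncomputable def reebFieldAux (w : C2) : C2 :=
  (2 / conformal F ε w) • mulI w +
    (ε / conformal F ε w ^ 2) • (slope F mulI w • quatJ w -
      slope F (ContinuousLinearMap.id ℝ C2) w • mulI (quatJ w))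

/-- The Reeb vector field of the contact form `(1 + ε F(hopf)) λ` on `S³`, extended to a compactly
supported vector field on `ℂ²`. -/
noncomputable def reebField (w : C2) : C2 := bumpAtOne (normSqC2 w) • reebFieldAux F ε w

variable {F ε}

lemma contDiff_conformal {n : WithTop ℕ∞} (hF : ContDiff ℝ n F) : ContDiff ℝ n (conformal F ε) :=
  contDiff_const.add (contDiff_const.mul (hF.comp contDiff_hopfExt))

lemma contDiff_slope (hF : ContDiff ℝ ∞ F) (c : C2 →L[ℝ] C2) : ContDiff ℝ ∞ (slope F c) := by
  have h1 : ContDiff ℝ ∞ (fderiv ℝ F) := hF.fderiv_right (by simp)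
  exact (h1.comp contDiff_hopfExt).clm_apply
    (hopfBilin.contDiff.clm_apply (c.contDiff.comp quatJ.contDiff))

lemma contDiff_reebField (hF : ContDiff ℝ ∞ F) (hpos : ∀ x, 0 < 1 + ε * F x) :
    ContDiff ℝ ∞ (reebField F ε) := by
  have h0 : ∀ w, conformal F ε w ≠ 0 := fun w => (hpos _).ne'
  have hg := contDiff_conformal (ε := ε) hF
  have h1 : ContDiff ℝ ∞ fun w => (2 / conformal F ε w) • mulI w :=
    (contDiff_const.div hg h0).smul mulI.contDiff
  have h2 : ContDiff ℝ ∞ fun w => ε / conformal F ε w ^ 2 :=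
    contDiff_const.div (hg.pow 2) fun w => pow_ne_zero 2 (h0 w)
  have h3 : ContDiff ℝ ∞ fun w => slope F mulI w • quatJ w -
      slope F (ContinuousLinearMap.id ℝ C2) w • mulI (quatJ w) :=
    ((contDiff_slope hF _).smul quatJ.contDiff).sub
      ((contDiff_slope hF _).smul (mulI.contDiff.comp quatJ.contDiff))
  exact (bumpAtOne.contDiff.comp contDiff_normSqC2).smul (h1.add (h2.smul h3))

lemma hasCompactSupport_reebField : HasCompactSupport (reebField F ε) := by
  refine HasCompactSupport.of_support_subset_isCompact (isCompact_closedBall (0 : C2) 2) ?_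
  intro w hw
  rw [mem_closedBall_zero_iff]
  by_contra! hcon
  apply hw
  rw [reebField, bumpAtOne_eq_zero (Or.inr ?_), zero_smul]
  rw [normSqC2_eq]
  nlinarith

lemma reebField_coe (z : S3) : reebField F ε z = reebFieldAux F ε z := by
  rw [reebField, normSqC2_coe, bumpAtOne_eq_one (by norm_num) (by norm_num), one_smul]

/-- The extension is tangent to every sphere about the origin, which is why its flow preserves S³.
-/
lemma re_herm_reebField (w : C2) : (herm w (reebField F ε w)).re = 0 := by
  rw [herm_eq, reebField, reebFieldAux]
  simp [mulI_apply, quatJ_zero, quatJ_one]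
  ring

end Field

/-! ### Equivariance -/

/-- The linear action of `SU(2)` on `ℂ²` as a continuous `ℝ`-linear map. -/
noncomputable def actCLM (A : SU2) : C2 →L[ℝ] C2 := LinearMap.toContinuousLinearMap
  { toFun := actC2 A
    map_add' := fun v w => by ext i; fin_cases i <;> simp [actC2, Matrix.mulVec_add]
    map_smul' := fun r w => by
      ext i
      fin_cases i
      · show actC2 A (r • w) 0 = r • actC2 A w 0
        simp [actC2_zero]; ring
      · show actC2 A (r • w) 1 = r • actC2 A w 1
        simp [actC2_one]; ring }

lemma actCLM_apply (A : SU2) (w : C2) : actCLM A w = actC2 A w := rfl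

lemma actC2_mulI (A : SU2) (w : C2) : actC2 A (mulI w) = mulI (actC2 A w) := by
  ext i
  fin_cases i
  · show actC2 A (mulI w) 0 = Complex.I * actC2 A w 0
    simp [actC2_zero, mulI_apply]; ring
  · show actC2 A (mulI w) 1 = Complex.I * actC2 A w 1
    simp [actC2_one, mulI_apply]; ring

lemma actC2_quatJ (A : SU2) (w : C2) : actC2 A (quatJ w) = quatJ (actC2 A w) := by
  ext i
  fin_cases i
  · show actC2 A (quatJ w) 0 = -(starRingEnd ℂ) (actC2 A w 1)
    simp [actC2_zero, actC2_one, quatJ_zero, quatJ_one]; ring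
  · show actC2 A (quatJ w) 1 = (starRingEnd ℂ) (actC2 A w 0)
    simp [actC2_zero, actC2_one, quatJ_zero, quatJ_one]; ring

/-- The linear action of `SO(3)` on `ℝ³` as a continuous linear map. -/
noncomputable def rotCLM (B : SO3) : E3 →L[ℝ] E3 := LinearMap.toContinuousLinearMap
  { toFun := fun x => WithLp.toLp 2 (B.1.mulVec x.ofLp)
    map_add' := fun v w => by simp [Matrix.mulVec_add]
    map_smul' := fun r w => by simp [Matrix.mulVec_smul] }

lemma rotCLM_apply (B : SO3) (x : E3) : rotCLM B x = WithLp.toLp 2 (B.1.mulVec x.ofLp) := rfl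

lemma hopfBilin_actC2 (A : SU2) (w v : C2) :
    hopfBilin (actC2 A w) (actC2 A v) = rotCLM (P A) (hopfBilin w v) := by
  rw [hopfBilin_apply, hopfBilin_apply, rotCLM_apply, actC2_zero, actC2_one, actC2_zero, actC2_one]
  ext i
  fin_cases i <;>
    simp [P, rotMatrix, Matrix.mulVec, dotProduct, Fin.sum_univ_three, Complex.normSq_apply, sq] <;>
    ring

lemma hopfExt_actC2 (A : SU2) (w : C2) : hopfExt (actC2 A w) = rotCLM (P A) (hopfExt w) := by
  rw [hopfExt, hopfExt, hopfBilin_actC2, map_smul]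

lemma normSqC2_actC2 (A : SU2) (w : C2) : normSqC2 (actC2 A w) = normSqC2 w := by
  rw [normSqC2, normSqC2, herm_actC2]

section Equivariance

variable {F : E3 → ℝ} {ε : ℝ} {A : SU2}

lemma fderiv_rotCLM {B : SO3} (hF : Differentiable ℝ F) (hB : ∀ x, F (rotCLM B x) = F x)
    (x v : E3) : fderiv ℝ F (rotCLM B x) (rotCLM B v) = fderiv ℝ F x v := by
  have h1 := (hF (rotCLM B x)).hasFDerivAt.comp x (rotCLM B).hasFDerivAt
  have h2 : F ∘ rotCLM B = F := funext hB
  rw [h2] at h1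
  rw [h1.fderiv]
  rfl

/-- Multiplication by i and the left-invariant field `quatJ` commute with SU(2), and the Hopf map
intertwines A with P A, so each coefficient is invariant. -/
lemma reebField_actC2 (hF : Differentiable ℝ F) (hA : ∀ x, F (rotCLM (P A) x) = F x) (w : C2) :
    reebField F ε (actC2 A w) = actC2 A (reebField F ε w) := by
  have hg : conformal F ε (actC2 A w) = conformal F ε w := by
    rw [conformal, conformal, hopfExt_actC2, hA]
  have h1 : slope F mulI (actC2 A w) = slope F mulI w := by
    rw [slope, slope, hopfExt_actC2, ← actC2_quatJ, ← actC2_mulI, hopfBilin_actC2,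
      fderiv_rotCLM hF hA]
  have h2 : slope F (ContinuousLinearMap.id ℝ C2) (actC2 A w)
      = slope F (ContinuousLinearMap.id ℝ C2) w := by
    rw [slope, slope, hopfExt_actC2, ← actC2_quatJ, ContinuousLinearMap.id_apply,
      ContinuousLinearMap.id_apply, hopfBilin_actC2, fderiv_rotCLM hF hA]
  rw [reebField, reebField, reebFieldAux, reebFieldAux, normSqC2_actC2, hg, h1, h2,
    ← actC2_quatJ, ← actC2_mulI, ← actC2_mulI]
  simp only [← actCLM_apply, map_smul, map_add, map_sub]

end Equivariance

/-! ### Characterization of the Reeb vector field -/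

/-- For z on S³ the vectors z and V₁(z) form a unitary basis of ℂ²; V₁(z) spans the contact plane
over ℂ. -/
lemma eq_herm_smul_add (z : S3) (v : C2) :
    v = herm z v • (z : C2) + herm (quatJ z) v • quatJ z := by
  have h := S3.herm_self z
  rw [herm_eq] at h
  ext i
  fin_cases i
  · simp [herm_eq, quatJ_zero, quatJ_one]
    linear_combination (-(v 0)) * h
  · simp [herm_eq, quatJ_zero, quatJ_one]
    linear_combination (-(v 1)) * h

lemma herm_quatJ_self (z : S3) : herm (quatJ z) (quatJ z) = 1 := by
  have h := S3.herm_self z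
  rw [herm_eq] at h
  rw [herm_eq]
  simp [quatJ_zero, quatJ_one]
  linear_combination h

lemma herm_quatJ_right (w : C2) : herm w (quatJ w) = 0 := by
  simp [herm_eq, quatJ_zero, quatJ_one]; ring

lemma herm_quatJ_left (w : C2) : herm (quatJ w) w = 0 := by
  simp [herm_eq, quatJ_zero, quatJ_one]; ring

lemma hopfBilin_mulI_self (w : C2) : hopfBilin w (mulI w) = 0 := by
  rw [hopfBilin_apply]
  ext i
  fin_cases i <;> simp [mulI_apply] <;> ring

section ReebVector

variable {G : Subgroup SU2} {f : S2 → ℝ} {F : E3 → ℝ} {ε : ℝ}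

lemma perturbedForm_dprojS3 (hinv : ∀ h ∈ G.map P, ∀ x : S2, f (h • x) = f x) (q : TS3) :
    perturbedForm G (descend (G.map P) f hinv) ε (dprojS3 G q)
      = (1 + ε * f (hopf q.1.1)) * ((herm q.1.1 q.1.2).im / 2) := rfl

lemma coe_radial {w : C2} (hw : w ≠ 0) : (radial w : C2) = ((‖w‖⁻¹ : ℝ) : ℂ) • w := by
  simp [radial, hw]

lemma coe_radial_real {w : C2} (hw : w ≠ 0) : (radial w : C2) = (‖w‖⁻¹ : ℝ) • w := by
  rw [coe_radial hw]
  exact Complex.coe_smul _ _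

lemma hopfExt_real_smul (r : ℝ) (w : C2) : hopfExt (r • w) = r ^ 2 • hopfExt w := by
  rw [hopfExt, hopfExt, map_smul, map_smul, smul_apply, smul_smul, smul_smul,
    smul_smul]
  congr 1
  ring

/-- The quadratic Hopf extension at w is |w|² times the Hopf image of the radial projection, and F
is constant on rays for |w|² in (9/10, 11/10). This gives a formula that can be differentiated
directly. -/
lemma radialPullback_eq (h : IsRadialExtension f F)
    (hinv : ∀ h ∈ G.map P, ∀ x : S2, f (h • x) = f x) {w : C2} (v : C2)
    (h1 : 9 / 10 < normSqC2 w) (h2 : normSqC2 w < 11 / 10) :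
    radialPullback (fun q => perturbedForm G (descend (G.map P) f hinv) ε (dprojS3 G q)) w v
      = conformal F ε w * ((herm w v).im / 2) * (normSqC2 w)⁻¹ := by
  have hw : w ≠ 0 := by
    rintro rfl
    rw [normSqC2_eq] at h1
    norm_num at h1
  have hn : 0 < ‖w‖ := norm_pos_iff.2 hw
  have e1 : hopfExt w = normSqC2 w • (hopf (radial w) : E3) := by
    rw [coe_hopf, coe_radial_real hw, hopfExt_real_smul, smul_smul, normSqC2_eq]
    have : ‖w‖ ^ 2 * ‖w‖⁻¹ ^ 2 = 1 := by field_simp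
    rw [this, one_smul]
  have e2 : F (hopfExt w) = f (hopf (radial w)) := by
    rw [e1]; exact h.eq _ _ h1 h2
  rw [radialPullback, perturbedForm_dprojS3, conformal, e2, mul_assoc]
  congr 1
  show (herm (radial w : C2) ((((‖w‖⁻¹ : ℝ) : ℂ) • v) -
    ((herm (radial w) (((‖w‖⁻¹ : ℝ) : ℂ) • v)).re : ℂ) • (radial w : C2))).im / 2 = _
  have e3 : ∀ x y : C2, ∀ r : ℝ, herm x (y - (r : ℂ) • x) = herm x y - r * herm x x := by
    intro x y r
    simp only [herm, inner_sub_right, inner_smul_right]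
  rw [e3, S3.herm_self, coe_radial hw]
  have e4 : herm (((‖w‖⁻¹ : ℝ) : ℂ) • w) (((‖w‖⁻¹ : ℝ) : ℂ) • v)
      = ((‖w‖⁻¹ : ℝ) : ℂ) * (((‖w‖⁻¹ : ℝ) : ℂ) * herm w v) := by
    simp only [herm, inner_smul_left, inner_smul_right, Complex.conj_ofReal]
  rw [e4, normSqC2_eq]
  simp only [mul_one, Complex.sub_im, Complex.ofReal_im, sub_zero, Complex.im_ofReal_mul]
  field_simp

lemma fderiv_radialPullback (h : IsRadialExtension f F)
    (hinv : ∀ h ∈ G.map P, ∀ x : S2, f (h • x) = f x) (z : S3) {u : C2} (v : C2)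
    (hu : (herm z u).re = 0) :
    fderiv ℝ (fun w => radialPullback
      (fun q => perturbedForm G (descend (G.map P) f hinv) ε (dprojS3 G q)) w v) z u
      = ε * fderiv ℝ F (hopf z) (hopfBilin z u) * ((herm z v).im / 2)
        + conformal F ε z * ((herm u v).im / 2) := by
  have hev : (fun w => radialPullback
      (fun q => perturbedForm G (descend (G.map P) f hinv) ε (dprojS3 G q)) w v) =ᶠ[𝓝 (z : C2)]
      fun w => conformal F ε w * ((hermBilin w v).im / 2) * (normSqC2 w)⁻¹ := by
    have hc : Continuous normSqC2 := (contDiff_normSqC2 (n := 0)).continuous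
    have h1 : ∀ᶠ w in 𝓝 (z : C2), 9 / 10 < normSqC2 w :=
      continuousAt_const.eventually_lt hc.continuousAt (by rw [normSqC2_coe]; norm_num)
    have h2 : ∀ᶠ w in 𝓝 (z : C2), normSqC2 w < 11 / 10 :=
      hc.continuousAt.eventually_lt continuousAt_const (by rw [normSqC2_coe]; norm_num)
    filter_upwards [h1, h2] with w hw1 hw2
    exact radialPullback_eq h hinv v hw1 hw2
  rw [hev.fderiv_eq]
  have d1 : HasFDerivAt (conformal F ε)
      (ε • (fderiv ℝ F (hopf z)).comp (hopfBilin z)) (z : C2) := by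
    have hF : HasFDerivAt F (fderiv ℝ F (hopf z)) (hopfExt z) := by
      rw [← coe_hopf]
      exact (h.smooth.differentiable (by simp) _).hasFDerivAt
    exact ((hF.comp (z : C2) (hasFDerivAt_hopfExt z)).const_mul ε).const_add 1
  have d2 : HasFDerivAt (fun w => (hermBilin w v).im / 2)
      ((1 / 2 : ℝ) • Complex.imCLM.comp (hermBilin.flip v)) (z : C2) := by
    have h3 := (Complex.imCLM.hasFDerivAt.comp (z : C2)
      (hermBilin.flip v).hasFDerivAt).const_smul (1 / 2 : ℝ)
    refine h3.congr_of_eventuallyEq (Filter.Eventually.of_forall fun w => ?_)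
    show (hermBilin w v).im / 2 = (1 / 2 : ℝ) * (hermBilin w v).im
    ring
  have d3 : HasFDerivAt (fun w => (normSqC2 w)⁻¹) _ (z : C2) :=
    (hasDerivAt_inv (by rw [normSqC2_coe]; norm_num)).comp_hasFDerivAt (z : C2)
      (hasFDerivAt_normSqC2 z)
  refine (congrArg (fun D : C2 →L[ℝ] ℝ => D u) ((d1.mul d2).mul d3).fderiv).trans ?_
  simp [normSqC2_coe, hermBilin_apply, hu, smul_apply]
  ring

/-- The value of the exterior derivative of the perturbed contact form on tangent vectors. -/
lemma extDerivS3_perturbedForm (h : IsRadialExtension f F)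
    (hinv : ∀ h ∈ G.map P, ∀ x : S2, f (h • x) = f x) (z : S3) {u v : C2}
    (hu : (herm z u).re = 0) (hv : (herm z v).re = 0) :
    extDerivS3 (fun q => perturbedForm G (descend (G.map P) f hinv) ε (dprojS3 G q)) z u v
      = ε * fderiv ℝ F (hopf z) (hopfBilin z u) * ((herm z v).im / 2)
        - ε * fderiv ℝ F (hopf z) (hopfBilin z v) * ((herm z u).im / 2)
        + conformal F ε z * (herm u v).im := by
  rw [extDerivS3, fderiv_radialPullback h hinv z v hu, fderiv_radialPullback h hinv z u hv]
  have : (herm v u).im = -(herm u v).im := by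
    rw [← Complex.conj_im, herm, herm, inner_conj_symm]
  rw [this]
  ring

lemma complex_smul_eq (c : ℂ) (w : C2) : c • w = c.re • w + c.im • mulI w := by
  rw [mulI_apply]
  ext i
  simp
  nth_rewrite 1 [← Complex.re_add_im c]
  ring

/-- At a point of `S³`, the Reeb vector field is the only tangent vector `u` with `λ_ε(u) = 1` and
`dλ_ε(u, ·) = 0`. -/
lemma isReeb_iff (h : IsRadialExtension f F)
    (hinv : ∀ h ∈ G.map P, ∀ x : S2, f (h • x) = f x) (hpos : ∀ x, 0 < 1 + ε * F x) (p : TS3) :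
    (perturbedForm G (descend (G.map P) f hinv) ε (dprojS3 G p) = 1 ∧
      ∀ v : C2, (herm p.1.1 v).re = 0 → extDerivS3
        (fun q => perturbedForm G (descend (G.map P) f hinv) ε (dprojS3 G q)) p.1.1 p.1.2 v = 0) ↔
      p.1.2 = reebField F ε p.1.1 := by
  obtain ⟨⟨z, u⟩, hu⟩ := p
  simp only at hu ⊢
  have hg0 : 0 < conformal F ε z := hpos _
  have hgf : 1 + ε * f (hopf z) = conformal F ε z := by
    rw [conformal, ← coe_hopf, h.coe_eq]
  rw [perturbedForm_dprojS3]
  simp only [hgf]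
  set g := conformal F ε z with hg
  have dec := eq_herm_smul_add z u
  set a : ℝ := (herm z u).im with ha
  set b : ℂ := herm (quatJ z) u with hb
  have hza : herm z u = a * Complex.I := by
    apply Complex.ext <;> simp [hu, ha]
  rw [hza] at dec
  -- The real orthonormal frame iz, V₁, V₂ of T_zS³: λ_ε(u) = 1 fixes the coefficient of iz, and
  -- testing dλ_ε(u, ·) on V₁ and V₂ fixes those of V₂ and V₁ respectively.
  have dec' : u = a • mulI z + (b.re • quatJ z + b.im • mulI (quatJ z)) := by
    rw [← complex_smul_eq b]
    rw [mulI_apply, ← Complex.coe_smul, smul_smul]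
    exact dec
  set s₁ := slope F mulI z with hs₁
  set s₂ := slope F (ContinuousLinearMap.id ℝ C2) z with hs₂
  have hs₁' : fderiv ℝ F (hopf z) (hopfBilin z (mulI (quatJ z))) = s₁ := by
    rw [hs₁, slope, coe_hopf]
  have hs₂' : fderiv ℝ F (hopf z) (hopfBilin z (quatJ z)) = s₂ := by
    rw [hs₂, slope, coe_hopf, ContinuousLinearMap.id_apply]
  have hdu : fderiv ℝ F (hopf z) (hopfBilin z u) = b.re * s₂ + b.im * s₁ := by
    rw [dec', map_add, map_smul, hopfBilin_mulI_self, smul_zero, zero_add]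
    simp only [map_add, map_smul, hs₁', hs₂', smul_eq_mul]
  have hJ : herm z (quatJ z) = 0 := herm_quatJ_right _
  have hIJ : herm z (mulI (quatJ z)) = 0 := by
    rw [mulI_apply, herm, inner_smul_right]
    show Complex.I * herm z (quatJ z) = 0
    rw [hJ, mul_zero]
  have huJ : herm u (quatJ z) = (starRingEnd ℂ) b := by
    rw [hb, herm, herm, inner_conj_symm]
  have huIJ : herm u (mulI (quatJ z)) = Complex.I * (starRingEnd ℂ) b := by
    rw [← huJ, mulI_apply, herm, herm, inner_smul_right]
  rw [reebField_coe, reebFieldAux, ← hg, ← hs₁, ← hs₂]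
  constructor
  · rintro ⟨h1, h2⟩
    have ha' : a = 2 / g := by field_simp; linarith
    have e1 := h2 (quatJ z) (by rw [hJ]; rfl)
    have e2 := h2 (mulI (quatJ z)) (by rw [hIJ]; rfl)
    rw [extDerivS3_perturbedForm h hinv z hu (by rw [hJ]; rfl), hs₂', hJ, huJ] at e1
    rw [extDerivS3_perturbedForm h hinv z hu (by rw [hIJ]; rfl), hs₁', hIJ, huIJ] at e2
    simp [← ha, ← hg] at e1 e2
    rw [ha'] at e1 e2
    have hre : b.re = ε / g ^ 2 * s₁ := by field_simp at e2 ⊢; linarith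
    have him : b.im = -(ε / g ^ 2 * s₂) := by field_simp at e1 ⊢; linarith
    rw [dec', ha', hre, him]
    module
  · intro h1
    have e0 : herm z u = (2 / g : ℝ) * Complex.I := by
      rw [h1]
      simp only [← Complex.coe_smul, herm, inner_add_right, inner_sub_right, inner_smul_right,
        mulI_apply]
      have hz := S3.herm_self z
      simp only [herm] at hz hJ
      rw [hz, hJ]
      simp
    have eb : b = (ε / g ^ 2 * s₁ : ℝ) - (ε / g ^ 2 * s₂ : ℝ) * Complex.I := by
      rw [hb]
      conv_lhs => rw [h1]
      have hq := herm_quatJ_self z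
      have hq' := herm_quatJ_left (z : C2)
      simp only [herm] at hq hq'
      simp only [← Complex.coe_smul, herm, inner_add_right, inner_sub_right, inner_smul_right,
        mulI_apply, hq, hq']
      push_cast
      ring
    have ha' : a = 2 / g := by rw [ha, e0]; simp
    have hre : b.re = ε / g ^ 2 * s₁ := by
      rw [eb]
      simp only [Complex.sub_re, Complex.ofReal_re, Complex.re_ofReal_mul, Complex.I_re]
      ring
    have him : b.im = -(ε / g ^ 2 * s₂) := by
      rw [eb]
      simp only [Complex.sub_im, Complex.ofReal_im, Complex.im_ofReal_mul, Complex.I_im]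
      ring
    refine ⟨by rw [ha']; field_simp, fun v hv => ?_⟩
    rw [extDerivS3_perturbedForm h hinv z hu hv, hdu, ← ha, ← hg, ha']
    have dv := eq_herm_smul_add z v
    set c : ℂ := herm (quatJ z) v with hc
    have hzv : herm z v = (herm z v).im * Complex.I := by
      apply Complex.ext <;> simp [hv]
    have huv : (herm u v).im = b.re * c.im - b.im * c.re := by
      conv_lhs => rw [dv]
      rw [herm, inner_add_right, inner_smul_right, inner_smul_right]
      have e3 : inner ℂ u (z : C2) = -((a : ℂ) * Complex.I) := by
        have : herm u z = (starRingEnd ℂ) (herm z u) := (inner_conj_symm _ _).symm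
        rw [hza] at this
        simpa using this
      have e4 : inner ℂ u (quatJ z) = (starRingEnd ℂ) b := huJ
      rw [e3, e4, hzv]
      simp
      ring
    have hdv : fderiv ℝ F (hopf z) (hopfBilin z v) = c.re * s₂ + c.im * s₁ := by
      have dv' : v = (herm z v).im • mulI z + (c.re • quatJ z + c.im • mulI (quatJ z)) := by
        rw [← complex_smul_eq c, mulI_apply, ← Complex.coe_smul, smul_smul, ← hzv]
        exact dv
      rw [dv', map_add, map_smul, hopfBilin_mulI_self, smul_zero, zero_add]
      simp only [map_add, map_smul, hs₁', hs₂', smul_eq_mul]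
    rw [hdv, huv, hre, him]
    field_simp
    ring

end ReebVector

/-! ### The covering `S³ → S³/G` -/

/-- The action is free because z and V₁(z) span ℂ²: an element of SU(2) fixing z fixes both. For
finite G this makes S³ → S³/G a covering. -/
lemma SU2.eq_one_of_smul_eq {A : SU2} {z : S3} (h : A • z = z) : A = 1 := by
  have hz := congrArg Subtype.val h
  rw [coe_smul_S3] at hz
  have e0 : A.1 0 0 * z.1 0 - (starRingEnd ℂ) (A.1 1 0) * z.1 1 = z.1 0 := by
    rw [← actC2_zero, hz]
  have e1 : A.1 1 0 * z.1 0 + (starRingEnd ℂ) (A.1 0 0) * z.1 1 = z.1 1 := by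
    rw [← actC2_one, hz]
  have hn := S3.herm_self z
  rw [herm_eq] at hn
  have e1c := congrArg (starRingEnd ℂ) e1
  simp only [map_add, map_mul, Complex.conj_conj] at e1c
  have ha : A.1 0 0 = 1 := by
    linear_combination (starRingEnd ℂ) (z.1 0) * e0 + z.1 1 * e1c - (A.1 0 0 - 1) * hn
  rw [ha] at e0 e1
  have hb : A.1 1 0 = 0 := by
    have f0 : (starRingEnd ℂ) (A.1 1 0) * z.1 1 = 0 := by linear_combination -e0
    have f1 : A.1 1 0 * z.1 0 = 0 := by simpa using e1
    have f0c := congrArg (starRingEnd ℂ) f0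
    simp only [map_mul, Complex.conj_conj, map_zero] at f0c
    linear_combination (starRingEnd ℂ) (z.1 0) * f1 + z.1 1 * f0c - A.1 1 0 * hn
  apply Subtype.ext
  ext i j
  fin_cases i <;> fin_cases j
  · simpa using ha
  · simpa [hb] using SU2.apply_zero_one A
  · simpa using hb
  · simpa [ha] using SU2.apply_one_one A

instance (G : Subgroup SU2) : IsCancelSMul G S3 :=
  isCancelSMul_iff_eq_one_of_smul_eq.2 fun _ _ h => Subtype.ext (SU2.eq_one_of_smul_eq h)

instance (G : Subgroup SU2) : ContinuousConstSMul G S3 where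
  continuous_const_smul g := by
    refine Continuous.subtype_mk ?_ _
    exact (actCLM g.1).continuous.comp continuous_subtype_val

lemma isQuotientCoveringMap_projS3 (G : Subgroup SU2) [Finite G] :
    IsQuotientCoveringMap (projS3 G) G :=
  isQuotientCoveringMap_quotientMk_of_properlyDiscontinuousSMul

lemma projS3_eq_iff {G : Subgroup SU2} {z w : S3} :
    projS3 G z = projS3 G w ↔ ∃ g : G, (g : SU2) • w = z :=
  Quotient.eq''

lemma dprojS3_eq_iff {G : Subgroup SU2} {p q : TS3} :
    dprojS3 G p = dprojS3 G q ↔ ∃ g : G, (g : SU2) • q = p :=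
  Quotient.eq''

lemma continuousAt_of_hasDerivAt_coe {b : ℝ → S3} {v : C2} {t : ℝ}
    (h : HasDerivAt (fun s => (b s : C2)) v t) : ContinuousAt b t :=
  Topology.IsInducing.subtypeVal.continuousAt_iff.2 h.continuousAt

lemma HasVelocityAt.continuousAt {G : Subgroup SU2} [Finite G] {c : ℝ → S3Mod G} {X : TS3Mod G}
    {t : ℝ} (h : HasVelocityAt G c X t) : ContinuousAt c t := by
  obtain ⟨b, p, hb, -, hd, -⟩ := h
  have hq : Continuous (projS3 G) := (isQuotientCoveringMap_projS3 G).isCoveringMap.continuous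
  exact (hq.continuousAt.comp (continuousAt_of_hasDerivAt_coe hd)).congr hb

/-- A continuous lift of a differentiable curve in `S³/G` is differentiable. -/
lemma HasVelocityAt.of_lift {G : Subgroup SU2} [Finite G] {c : ℝ → S3Mod G} {X : TS3Mod G}
    {t : ℝ} (h : HasVelocityAt G c X t) {β : ℝ → S3} (hβ : ContinuousAt β t)
    (hlift : ∀ s, projS3 G (β s) = c s) :
    ∃ p : TS3, p.1.1 = β t ∧ HasDerivAt (fun s => (β s : C2)) p.1.2 t ∧ X = dprojS3 G p := by
  obtain ⟨b, p, hb, hbt, hd, hX⟩ := h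
  have hcov := isQuotientCoveringMap_projS3 G
  have ht : projS3 G (β t) = projS3 G (b t) := by rw [hlift, hb.self_of_nhds]
  obtain ⟨g, hg⟩ := projS3_eq_iff.1 ht
  -- On a neighbourhood disjoint from its nontrivial translates, two lifts of the same curve that
  -- agree at t (after applying g) agree near t.
  obtain ⟨U, hU, hdisj⟩ := hcov.disjoint (β t)
  have hbc : ContinuousAt (fun s => g • b s) t :=
    (continuous_const_smul g).continuousAt.comp (continuousAt_of_hasDerivAt_coe hd)
  have hbU : ∀ᶠ s in 𝓝 t, g • b s ∈ U := hbc.eventually_mem (by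
    show U ∈ 𝓝 ((g : SU2) • b t)
    rwa [hg])
  have heq : ∀ᶠ s in 𝓝 t, β s = g • b s := by
    filter_upwards [hb, hbU, hβ.eventually_mem hU] with s h1 h2 h3
    obtain ⟨k, hk⟩ := projS3_eq_iff.1 ((hlift s).trans h1.symm)
    have hk' : (k * g⁻¹) • (g • b s) = β s := by
      rw [smul_smul, inv_mul_cancel_right]; exact hk
    have : k * g⁻¹ = 1 := hdisj _ ⟨β s, ⟨g • b s, h2, hk'⟩, h3⟩
    rw [this, one_smul] at hk'
    exact hk'.symm
  refine ⟨(g : SU2) • p, ?_, ?_, ?_⟩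
  · rw [smul_TS3_fst, ← hbt, hg]
  · have h1 := (actCLM g.1).hasFDerivAt.comp_hasDerivAt t hd
    refine h1.congr_of_eventuallyEq ?_
    filter_upwards [heq] with s hs
    rw [hs]
    rfl
  · rw [hX]
    exact dprojS3_eq_iff.2 ⟨g⁻¹, by
      show ((g : SU2)⁻¹) • ((g : SU2) • p) = p
      rw [inv_smul_smul]⟩

/-- The data of an invariant function with an invariant radial extension and a small parameter. -/
structure ReebData (G : Subgroup SU2) (f : S2 → ℝ) (F : E3 → ℝ) (ε : ℝ) : Prop where
  ext : IsRadialExtension f F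
  inv : ∀ h ∈ G.map P, ∀ x : S2, f (h • x) = f x
  inv_ext : ∀ A ∈ G, ∀ x, F (rotCLM (P A) x) = F x
  pos : ∀ x, 0 < 1 + ε * F x

namespace ReebData

variable {G : Subgroup SU2} {f : S2 → ℝ} {F : E3 → ℝ} {ε : ℝ}

/-- The perturbed contact form. -/
noncomputable abbrev form (D : ReebData G f F ε) : TS3Mod G → ℝ :=
  perturbedForm G (descend (G.map P) f D.inv) ε

lemma reebField_actC2 (D : ReebData G f F ε) {A : SU2} (hA : A ∈ G) (w : C2) :
    reebField F ε (actC2 A w) = actC2 A (reebField F ε w) :=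
  SphereQuotient.reebField_actC2 (D.ext.smooth.differentiable (by simp)) (D.inv_ext A hA) w

/-- The value of the Reeb vector field at a point of `S³`. -/
noncomputable def reebVector (F : E3 → ℝ) (ε : ℝ) (z : S3) : TS3 :=
  ⟨(z, reebField F ε z), re_herm_reebField _⟩

/-- `IsReebVector` tests only some representative; equivariance of `reebField` carries the condition
to every other one. -/
lemma isReebVector_iff (D : ReebData G f F ε) (p : TS3) :
    IsReebVector G D.form (dprojS3 G p) ↔ p.1.2 = reebField F ε p.1.1 := by
  constructor
  · rintro ⟨h1, p', hp', h2⟩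
    have h3 := (isReeb_iff D.ext D.inv D.pos p').1 ⟨by rw [← hp']; exact h1, h2⟩
    obtain ⟨g, rfl⟩ := dprojS3_eq_iff.1 hp'
    rw [smul_TS3_snd, smul_TS3_fst, h3, coe_smul_S3, D.reebField_actC2 g.2]
  · intro hp
    obtain ⟨h1, h2⟩ := (isReeb_iff D.ext D.inv D.pos p).2 hp
    exact ⟨h1, p, rfl, h2⟩

/-- A continuous lift of a Reeb trajectory is an integral curve of the Reeb vector field. -/
lemma hasDerivAt_lift (D : ReebData G f F ε) [Finite G] {γ : ℝ → S3Mod G}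
    (hγ : IsReebTrajectory G D.form γ) {β : ℝ → S3} (hβ : Continuous β)
    (hlift : ∀ s, projS3 G (β s) = γ s) (t : ℝ) :
    HasDerivAt (fun s => (β s : C2)) (reebField F ε (β t)) t := by
  obtain ⟨X, hX, hR⟩ := hγ t
  obtain ⟨p, hp, hd, rfl⟩ := hX.of_lift hβ.continuousAt hlift
  rw [D.isReebVector_iff] at hR
  rwa [hR, hp] at hd

lemma exists_lift (D : ReebData G f F ε) [Finite G] {γ : ℝ → S3Mod G}
    (hγ : IsReebTrajectory G D.form γ) : ∃ β : ℝ → S3, Continuous β ∧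
      ∀ s, projS3 G (β s) = γ s := by
  have hc : Continuous γ := continuous_iff_continuousAt.2 fun t => by
    obtain ⟨X, hX, -⟩ := hγ t
    exact hX.continuousAt
  have hcov := isQuotientCoveringMap_projS3 G
  obtain ⟨e, he⟩ := hcov.surjective (γ 0)
  obtain ⟨β, ⟨-, hβ⟩, -⟩ := hcov.isCoveringMap.existsUnique_continuousMap_lifts ⟨γ, hc⟩ 0 e he
  exact ⟨β, β.continuous, fun s => congrFun hβ s⟩

lemma isReebTrajectory_projS3 (D : ReebData G f F ε) {β : ℝ → S3}
    (hβ : ∀ t, HasDerivAt (fun s => (β s : C2)) (reebField F ε (β t)) t) :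
    IsReebTrajectory G D.form fun t => projS3 G (β t) := by
  intro t
  refine ⟨dprojS3 G (reebVector F ε (β t)), ⟨β, reebVector F ε (β t),
    Filter.Eventually.of_forall fun _ => rfl, rfl, hβ t, rfl⟩, ?_⟩
  rw [D.isReebVector_iff]
  rfl

end ReebData

/-- A contractible loop in `S³/G` lifts to a loop in `S³`. -/
lemma IsContractibleLoop.exists_lift {G : Subgroup SU2} [Finite G] {γ : ℝ → S3Mod G} {T : ℝ}
    (h : IsContractibleLoop G γ T) : ∃ β : ℝ → S3, Continuous β ∧ Function.Periodic β T ∧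
      ∀ s, projS3 G (β s) = γ s := by
  obtain ⟨c, hc, y, ⟨H⟩⟩ := h
  have hcov := isQuotientCoveringMap_projS3 G
  obtain ⟨e, he⟩ := hcov.surjective y
  -- The nullhomotopy is run backwards, from the constant loop, which lifts to a constant loop. The
  -- other end of the lifted homotopy is then defined on the circle, so it is a closed lift.
  have h0 : ∀ a, H.symm.toContinuousMap (0, a)
      = projS3 G ((ContinuousMap.const (AddCircle T) e) a) := by
    intro a
    have := H.symm.apply_zero a
    exact this.trans he.symm
  set K := hcov.isCoveringMap.liftHomotopy H.symm.toContinuousMap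
    (ContinuousMap.const (AddCircle T) e) h0 with hK
  refine ⟨fun t => K (1, (t : AddCircle T)), ?_, ?_, ?_⟩
  · exact K.continuous.comp (continuous_const.prodMk (AddCircle.continuous_mk' T))
  · intro t
    simp only [AddCircle.coe_add, AddCircle.coe_period, add_zero]
  · intro t
    have h1 := congrFun (hcov.isCoveringMap.liftHomotopy_lifts H.symm.toContinuousMap
      (ContinuousMap.const (AddCircle T) e) h0) (1, (t : AddCircle T))
    refine h1.trans ?_
    rw [← hc t]
    exact H.symm.apply_one _

/-! ### The Reeb flow -/

lemma normSqC2_integralCurve {F : E3 → ℝ} {ε : ℝ} {x : ℝ → C2}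
    (hx : ∀ t, HasDerivAt x (reebField F ε (x t)) t) (t : ℝ) : normSqC2 (x t) = normSqC2 (x 0) := by
  have h : ∀ t, HasDerivAt (fun s => normSqC2 (x s)) 0 t := by
    intro t
    have h1 := (hasFDerivAt_normSqC2 (x t)).comp_hasDerivAt t (hx t)
    have h2 : ((2 : ℝ) • Complex.reCLM.comp (hermBilin (x t))) (reebField F ε (x t)) = 0 := by
      simp [hermBilin_apply, re_herm_reebField]
    rwa [h2] at h1
  exact is_const_of_deriv_eq_zero (fun t => (h t).differentiableAt) (fun t => (h t).deriv) t 0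

/-- The Reeb flow on `ℂ²`, restricting to a flow on `S³`. -/
structure IsAmbientFlow (F : E3 → ℝ) (ε : ℝ) (Φ : ℝ → C2 → C2) : Prop where
  zero : ∀ x, Φ 0 x = x
  deriv : ∀ x t, HasDerivAt (fun s => Φ s x) (reebField F ε (Φ t x)) t

lemma IsAmbientFlow.mem_sphere {F : E3 → ℝ} {ε : ℝ} {Φ : ℝ → C2 → C2}
    (hΦ : IsAmbientFlow F ε Φ) (t : ℝ) (z : S3) : Φ t z ∈ Metric.sphere (0 : C2) 1 := by
  rw [mem_sphere_zero_iff_norm]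
  have h1 : normSqC2 (Φ t z) = 1 := by
    rw [normSqC2_integralCurve (hΦ.deriv z) t, hΦ.zero, normSqC2_coe]
  rw [normSqC2_eq] at h1
  nlinarith [norm_nonneg (Φ t z)]

/-- The Reeb flow on `S³`. -/
def IsAmbientFlow.flow {F : E3 → ℝ} {ε : ℝ} {Φ : ℝ → C2 → C2} (hΦ : IsAmbientFlow F ε Φ) (t : ℝ)
    (z : S3) : S3 := ⟨Φ t z, hΦ.mem_sphere t z⟩

namespace ReebData

variable {G : Subgroup SU2} {f : S2 → ℝ} {F : E3 → ℝ} {ε : ℝ}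

lemma contDiff_reebField (D : ReebData G f F ε) : ContDiff ℝ ∞ (reebField F ε) :=
  SphereQuotient.contDiff_reebField D.ext.smooth D.pos

lemma exists_lipschitz (D : ReebData G f F ε) : ∃ K : NNReal, LipschitzWith K (reebField F ε) :=
  exists_lipschitzWith_of_hasCompactSupport (D.contDiff_reebField.of_le (by simp))
    hasCompactSupport_reebField

lemma exists_ambientFlow (D : ReebData G f F ε) : ∃ Φ, IsAmbientFlow F ε Φ := by
  obtain ⟨K, hK⟩ := D.exists_lipschitz
  obtain ⟨B, hB⟩ := D.contDiff_reebField.continuous.bounded_above_of_compact_support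
    hasCompactSupport_reebField
  obtain ⟨Φ, h0, h1⟩ := exists_flow hK hB
  exact ⟨Φ, h0, h1⟩

lemma integralCurve_eq (D : ReebData G f F ε) {Φ : ℝ → C2 → C2} (hΦ : IsAmbientFlow F ε Φ)
    {x : ℝ → C2} (hx : ∀ t, HasDerivAt x (reebField F ε (x t)) t) (t : ℝ) :
    x t = Φ t (x 0) := by
  obtain ⟨K, hK⟩ := D.exists_lipschitz
  exact congrFun (integralCurve_unique hK hx (hΦ.deriv (x 0)) (t₀ := 0) (hΦ.zero _).symm) t

lemma flow_smul (D : ReebData G f F ε) {Φ : ℝ → C2 → C2} (hΦ : IsAmbientFlow F ε Φ) {A : SU2}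
    (hA : A ∈ G) (t : ℝ) (z : S3) : hΦ.flow t (A • z) = A • hΦ.flow t z := by
  apply Subtype.ext
  have h := D.integralCurve_eq hΦ (x := fun s => actC2 A (Φ s z)) (fun s => ?_) t
  · simp only [hΦ.zero] at h
    exact h.symm
  · rw [D.reebField_actC2 hA]
    exact (actCLM A).hasFDerivAt.comp_hasDerivAt s (hΦ.deriv z s)

/-- The Reeb flow on `S³/G`. -/
def flowMod (D : ReebData G f F ε) {Φ : ℝ → C2 → C2} (hΦ : IsAmbientFlow F ε Φ) (t : ℝ) :
    S3Mod G → S3Mod G :=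
  Quotient.map (hΦ.flow t) (by
    rintro a b ⟨g, rfl⟩
    exact ⟨g, (D.flow_smul hΦ g.2 t b).symm⟩)

lemma flowMod_projS3 (D : ReebData G f F ε) {Φ : ℝ → C2 → C2} (hΦ : IsAmbientFlow F ε Φ) (t : ℝ)
    (z : S3) : D.flowMod hΦ t (projS3 G z) = projS3 G (hΦ.flow t z) := rfl

lemma isReebFlow_flowMod (D : ReebData G f F ε) {Φ : ℝ → C2 → C2} (hΦ : IsAmbientFlow F ε Φ) :
    IsReebFlow G D.form (D.flowMod hΦ) := by
  intro q
  obtain ⟨z, rfl⟩ : ∃ z, projS3 G z = q := Quotient.exists_rep q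
  constructor
  · rw [flowMod_projS3]
    congr 1
    exact Subtype.ext (hΦ.zero z)
  · exact D.isReebTrajectory_projS3 (β := fun t => hΦ.flow t z) fun t => hΦ.deriv z t

end ReebData

/-! ### Closed orbits project to critical points -/

/-- The vector field `4 x × ∇F(x)` on `ℝ³`. -/
noncomputable def crossGradient (F : E3 → ℝ) (x : E3) : E3 :=
  !₂[4 * (x 1 * fderiv ℝ F x (EuclideanSpace.single 2 1)
      - x 2 * fderiv ℝ F x (EuclideanSpace.single 1 1)),
    4 * (x 2 * fderiv ℝ F x (EuclideanSpace.single 0 1)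
      - x 0 * fderiv ℝ F x (EuclideanSpace.single 2 1)),
    4 * (x 0 * fderiv ℝ F x (EuclideanSpace.single 1 1)
      - x 1 * fderiv ℝ F x (EuclideanSpace.single 0 1))]

lemma fderiv_apply_eq_sum (F : E3 → ℝ) (x v : E3) : fderiv ℝ F x v
    = v 0 * fderiv ℝ F x (EuclideanSpace.single 0 1)
      + v 1 * fderiv ℝ F x (EuclideanSpace.single 1 1)
      + v 2 * fderiv ℝ F x (EuclideanSpace.single 2 1) := by
  have hv : v = v 0 • EuclideanSpace.single 0 (1 : ℝ) + v 1 • EuclideanSpace.single 1 (1 : ℝ)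
      + v 2 • EuclideanSpace.single 2 (1 : ℝ) := by
    ext i
    fin_cases i <;> simp
  conv_lhs => rw [hv]
  simp only [map_add, map_smul, smul_eq_mul]

lemma fderiv_crossGradient (F : E3 → ℝ) (x : E3) : fderiv ℝ F x (crossGradient F x) = 0 := by
  rw [fderiv_apply_eq_sum]
  simp [crossGradient]
  ring

lemma contDiff_crossGradient {F : E3 → ℝ} (hF : ContDiff ℝ ∞ F) :
    ContDiff ℝ 1 (crossGradient F) := by
  have h1 : ContDiff ℝ 1 (fderiv ℝ F) :=
    (hF.of_le (m := 2) ENat.LEInfty.out).fderiv_right (m := 1) (by norm_num)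
  have h2 : ∀ v, ContDiff ℝ 1 fun x => fderiv ℝ F x v := fun v => h1.clm_apply contDiff_const
  have h3 : ∀ i, ContDiff ℝ 1 fun x : E3 => x i := fun i => by fun_prop
  rw [contDiff_euclidean]
  intro i
  fin_cases i
  · exact contDiff_const.mul (((h3 1).mul (h2 _)).sub ((h3 2).mul (h2 _)))
  · exact contDiff_const.mul (((h3 2).mul (h2 _)).sub ((h3 0).mul (h2 _)))
  · exact contDiff_const.mul (((h3 0).mul (h2 _)).sub ((h3 1).mul (h2 _)))

lemma hasCompactSupport_crossGradient {F : E3 → ℝ} (hF : HasCompactSupport F) :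
    HasCompactSupport (crossGradient F) := by
  refine (hF.fderiv ℝ).mono' (fun x hx => ?_)
  by_contra hcon
  have h0 : fderiv ℝ F x = 0 := image_eq_zero_of_notMem_tsupport hcon
  apply hx
  rw [crossGradient, h0]
  ext i
  fin_cases i <;> simp

/-- The Reeb vector field on `S³` projects to a multiple of `x × ∇F(x)` on `S²`. -/
lemma hopfBilin_reebField (F : E3 → ℝ) (ε : ℝ) (z : S3) : hopfBilin z (reebField F ε z)
    = (ε / conformal F ε z ^ 2) • crossGradient F (hopfExt z) := by
  have hn := normSqC2_coe z
  rw [normSqC2_apply] at hn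
  rw [reebField_coe, reebFieldAux, map_add, map_smul, hopfBilin_mulI_self, smul_zero, zero_add,
    map_smul, map_sub, map_smul, map_smul]
  congr 1
  rw [slope, slope, fderiv_apply_eq_sum, fderiv_apply_eq_sum F _ (hopfBilin z _),
    ContinuousLinearMap.id_apply, crossGradient, hopfBilin_apply, hopfBilin_apply, hopfExt_apply]
  generalize fderiv ℝ F _ (EuclideanSpace.single 0 1) = d0
  generalize fderiv ℝ F _ (EuclideanSpace.single 1 1) = d1
  generalize fderiv ℝ F _ (EuclideanSpace.single 2 1) = d2
  simp only [quatJ_zero, quatJ_one, mulI_apply, PiLp.smul_apply, smul_eq_mul]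
  generalize (z : C2) 0 = α at *
  generalize (z : C2) 1 = β at *
  obtain ⟨x, y⟩ := α
  obtain ⟨u, v⟩ := β
  ext i
  fin_cases i
  · simp [Complex.normSq_apply] at hn ⊢
    linear_combination (8 * ((x * u + y * v) * d1 - (x * v - y * u) * d2)) * hn
  · simp [Complex.normSq_apply] at hn ⊢
    linear_combination (-8 * (x * u + y * v) * d0
      - 4 * (x ^ 2 + y ^ 2 - u ^ 2 - v ^ 2) * d2) * hn
  · simp [Complex.normSq_apply] at hn ⊢
    linear_combination (8 * (x * v - y * u) * d0
      + 4 * (x ^ 2 + y ^ 2 - u ^ 2 - v ^ 2) * d1) * hn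

/-- Vanishing of p × ∇F makes the gradient radial, and its radial part is zero by `fderiv_self`. -/
lemma fderiv_eq_zero_of_crossGradient_eq_zero {f : S2 → ℝ} {F : E3 → ℝ}
    (h : IsRadialExtension f F) (p : S2) (hp : crossGradient F p = 0) : fderiv ℝ F p = 0 := by
  have hn : (p : E3) 0 ^ 2 + (p : E3) 1 ^ 2 + (p : E3) 2 ^ 2 = 1 := by
    have h1 : ‖(p : E3)‖ ^ 2 = 1 := by rw [mem_sphere_zero_iff_norm.1 p.2]; norm_num
    rw [EuclideanSpace.norm_sq_eq] at h1
    simpa [Fin.sum_univ_three] using h1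
  have hs := h.fderiv_self p
  rw [fderiv_apply_eq_sum] at hs
  have e0 := congrArg (fun x : E3 => x 0) hp
  have e1 := congrArg (fun x : E3 => x 1) hp
  have e2 := congrArg (fun x : E3 => x 2) hp
  simp [crossGradient] at e0 e1 e2
  ext v
  rw [fderiv_apply_eq_sum]
  generalize fderiv ℝ F p (EuclideanSpace.single 0 1) = d0 at *
  generalize fderiv ℝ F p (EuclideanSpace.single 1 1) = d1 at *
  generalize fderiv ℝ F p (EuclideanSpace.single 2 1) = d2 at *
  generalize (p : E3) 0 = x at *
  generalize (p : E3) 1 = y at *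
  generalize (p : E3) 2 = w at *
  have h0 : d0 = 0 := by linear_combination x * hs - y * e2 + w * e1 - d0 * hn
  have h1 : d1 = 0 := by linear_combination y * hs - w * e0 + x * e2 - d1 * hn
  have h2 : d2 = 0 := by linear_combination w * hs - x * e1 + y * e0 - d2 * hn
  simp [h0, h1, h2]

namespace ReebData

variable {G : Subgroup SU2} {f : S2 → ℝ} {F : E3 → ℝ} {ε : ℝ}

/-- A lift of a closed orbit closes up after an element of `G`. -/
lemma exists_deck (D : ReebData G f F ε) [Finite G] {γ : ℝ → S3Mod G} {T : ℝ}
    (hγ : IsReebOrbit G D.form γ T) {β : ℝ → S3} (hβ : Continuous β)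
    (hlift : ∀ s, projS3 G (β s) = γ s) : ∃ A ∈ G, ∀ t, β (t + T) = A • β t := by
  obtain ⟨g, hg⟩ := projS3_eq_iff.1 ((hlift T).trans ((hγ.2.1.eq).trans (hlift 0).symm))
  refine ⟨g, g.2, fun t => ?_⟩
  obtain ⟨K, hK⟩ := D.exists_lipschitz
  have hd := D.hasDerivAt_lift hγ.2.2 hβ hlift
  have h1 : ∀ t, HasDerivAt (fun s => (β (s + T) : C2)) (reebField F ε (β (t + T))) t := fun t => by
    simpa using (hd (t + T)).comp_add_const t T
  have h2 : ∀ t, HasDerivAt (fun s => actC2 g (β s)) (reebField F ε (actC2 g (β t))) t := fun t => by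
    rw [D.reebField_actC2 g.2]
    exact (actCLM g).hasFDerivAt.comp_hasDerivAt t (hd t)
  have h3 := integralCurve_unique hK h1 h2 (t₀ := 0) (by
    show (β (0 + T) : C2) = _
    rw [zero_add, ← hg]; rfl)
  exact Subtype.ext (congrFun h3 t)

lemma deck_iterate {β : ℝ → S3} {A : SU2} {T : ℝ} (h : ∀ t, β (t + T) = A • β t) (n : ℕ) (t : ℝ) :
    β (t + n * T) = A ^ n • β t := by
  induction n with
  | zero => simp
  | succ n ih =>
    have : t + (n + 1 : ℕ) * T = (t + n * T) + T := by push_cast; ring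
    rw [this, h, ih, smul_smul, pow_succ']

lemma pow_card_eq_one {A : SU2} (hA : A ∈ G) : A ^ Nat.card G = 1 :=
  congrArg Subtype.val (pow_card_eq_one' (x := (⟨A, hA⟩ : G)))

/-- Short closed orbits lie over critical points. -/
lemma fderiv_eq_zero_of_isReebOrbit (D : ReebData G f F ε) [Finite G] {γ : ℝ → S3Mod G} {T : ℝ}
    (hγ : IsReebOrbit G D.form γ T) {β : ℝ → S3} (hβ : Continuous β)
    (hlift : ∀ s, projS3 G (β s) = γ s) {K : NNReal} (hK : LipschitzWith K (crossGradient F))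
    (hε : 0 < ε) (hhalf : ∀ x, 1 / 2 ≤ 1 + ε * F x) (hsmall : 4 * ε * K * (Nat.card G * T) < 1) :
    fderiv ℝ F (hopf (β 0)) = 0 := by
  have hd := D.hasDerivAt_lift hγ.2.2 hβ hlift
  have hx : ∀ t, HasDerivAt (fun s => hopfExt (β s))
      ((ε / conformal F ε (β t) ^ 2) • crossGradient F (hopfExt (β t))) t := fun t => by
    rw [← hopfBilin_reebField]
    exact (hasFDerivAt_hopfExt _).comp_hasDerivAt t (hd t)
  have hg : ∀ t, HasDerivAt (fun s => conformal F ε (β s)) 0 t := fun t => by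
    have h1 := (D.ext.smooth.differentiable (by simp)
      (hopfExt (β t))).hasFDerivAt.comp_hasDerivAt t (hx t)
    rw [map_smul, fderiv_crossGradient, smul_zero] at h1
    have h2 := (h1.const_mul ε).const_add 1
    rw [mul_zero] at h2
    exact h2
  -- With g constant, the projected curve solves the autonomous equation x' = a·`crossGradient F` x,
  -- where a = ε/g² ≤ 4ε because g ≥ 1/2.
  have hconst : ∀ t, conformal F ε (β t) = conformal F ε (β 0) := fun t =>
    is_const_of_deriv_eq_zero (fun t => (hg t).differentiableAt) (fun t => (hg t).deriv) t 0
  set g := conformal F ε (β 0) with hgdef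
  have hg2 : 1 / 2 ≤ g := hhalf _
  set a : ℝ := ε / g ^ 2 with ha
  have ha0 : 0 < a := by positivity
  have ha4 : a ≤ 4 * ε := by
    rw [ha, div_le_iff₀ (by positivity)]
    nlinarith [mul_le_mul hg2 hg2 (by norm_num) (by linarith)]
  have hL : LipschitzWith (a.toNNReal * K) fun x => a • crossGradient F x := by
    refine LipschitzWith.of_dist_le_mul fun x y => ?_
    rw [dist_smul₀, NNReal.coe_mul, Real.coe_toNNReal a ha0.le, Real.norm_eq_abs,
      abs_of_pos ha0, mul_assoc]
    exact mul_le_mul_of_nonneg_left (hK.dist_le_mul x y) ha0.le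
  obtain ⟨A, hA, hdeck⟩ := D.exists_deck hγ hβ hlift
  -- The lift only satisfies β(t + T) = Aβ(t), but A has order dividing |G|.
  have hper : Function.Periodic (fun s => hopfExt (β s)) (Nat.card G * T) := fun t => by
    show hopfExt (β (t + Nat.card G * T)) = _
    rw [deck_iterate hdeck, pow_card_eq_one hA, one_smul]
  have hN : (0 : ℝ) < Nat.card G := by exact_mod_cast Nat.card_pos
  have hNT := mul_pos hN hγ.1
  have h0 := eq_zero_of_periodic_integralCurve hL
    (fun t => by have := hx t; rwa [hconst t] at this) hNT hper (by
    rw [NNReal.coe_mul, Real.coe_toNNReal a ha0.le]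
    refine lt_of_le_of_lt ?_ hsmall
    gcongr) 0
  refine fderiv_eq_zero_of_crossGradient_eq_zero D.ext _ ?_
  rw [coe_hopf]
  exact (smul_eq_zero.1 h0).resolve_left ha0.ne'

end ReebData

/-! ### The Reeb vector field and the Hopf action -/

/-- Multiplication by a complex number on `ℂ²`, as an `ℝ`-linear map. -/
noncomputable def complexScale (c : ℂ) : C2 →L[ℝ] C2 :=
  c.re • ContinuousLinearMap.id ℝ C2 + c.im • mulI

lemma complexScale_apply (c : ℂ) (w : C2) : complexScale c w = c • w := (complex_smul_eq c w).symm

lemma quatJ_complex_smul (c : ℂ) (w : C2) : quatJ (c • w) = (starRingEnd ℂ) c • quatJ w := by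
  ext i
  fin_cases i <;> simp [quatJ_apply]

lemma hopfBilin_complex_smul {c : ℂ} (hc : Complex.normSq c = 1) (w v : C2) :
    hopfBilin (c • w) (c • v) = hopfBilin w v := by
  rw [Complex.normSq_apply] at hc
  rw [hopfBilin_apply, hopfBilin_apply]
  ext i
  fin_cases i
  · simp
    linear_combination (2 * ((w 0).re * (v 0).re + (w 0).im * (v 0).im)
      - 2 * ((w 1).re * (v 1).re + (w 1).im * (v 1).im)) * hc
  · simp
    linear_combination (((v 0).re * (w 1).im - (v 0).im * (w 1).re
      + (w 0).re * (v 1).im - (w 0).im * (v 1).re)) * hc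
  · simp
    linear_combination (((v 0).re * (w 1).re + (v 0).im * (w 1).im
      + (w 0).re * (v 1).re + (w 0).im * (v 1).im)) * hc

lemma hopfExt_complex_smul {c : ℂ} (hc : Complex.normSq c = 1) (w : C2) :
    hopfExt (c • w) = hopfExt w := by
  rw [hopfExt, hopfExt, hopfBilin_complex_smul hc]

lemma normSqC2_complex_smul {c : ℂ} (hc : Complex.normSq c = 1) (w : C2) :
    normSqC2 (c • w) = normSqC2 w := by
  rw [normSqC2_eq, normSqC2_eq, norm_smul, mul_pow, ← Complex.normSq_eq_norm_sq, hc, one_mul]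

section Field

variable {F : E3 → ℝ} {ε : ℝ}

/-- d·V₁(cw) = c·(d c̄² V₁(w)), and the Hopf map is invariant under the circle; the two slopes
rotate accordingly. -/
lemma slope_complex_smul {c : ℂ} (hc : Complex.normSq c = 1) (d : ℂ) (w : C2) :
    fderiv ℝ F (hopfExt (c • w)) (hopfBilin (c • w) (d • quatJ (c • w)))
      = (d * (starRingEnd ℂ) c ^ 2).re * slope F (ContinuousLinearMap.id ℝ C2) w
        + (d * (starRingEnd ℂ) c ^ 2).im * slope F mulI w := by
  have hcc : c * (starRingEnd ℂ) c = 1 := by rw [Complex.mul_conj, hc]; simp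
  have h : d • quatJ (c • w) = c • ((d * (starRingEnd ℂ) c ^ 2) • quatJ w) := by
    rw [quatJ_complex_smul, smul_smul, smul_smul]
    congr 1
    linear_combination (-(d * (starRingEnd ℂ) c)) * hcc
  rw [h, hopfBilin_complex_smul hc, hopfExt_complex_smul hc, complex_smul_eq, map_add, map_smul,
    map_smul, map_add, map_smul, map_smul]
  rfl

/-- Both λ and F∘𝔓 are circle-invariant. In the formula the contact part is a multiple of (s_I − i
s₁)V₁: passing from w to cw multiplies the coefficient by c² and V₁ by c̄, hence the product by c.
-/
lemma reebField_complex_smul {c : ℂ} (hc : Complex.normSq c = 1) (w : C2) :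
    reebField F ε (c • w) = c • reebField F ε w := by
  have h1 := slope_complex_smul (F := F) hc 1 w
  have hI := slope_complex_smul (F := F) hc Complex.I w
  rw [one_smul, one_mul] at h1
  have e1 : slope F (ContinuousLinearMap.id ℝ C2) (c • w) = _ := h1
  have eI : slope F mulI (c • w) = _ := hI
  have hg : conformal F ε (c • w) = conformal F ε w := by
    rw [conformal, conformal, hopfExt_complex_smul hc]
  have hcc : (starRingEnd ℂ) c * c = 1 := by rw [mul_comm, Complex.mul_conj, hc]; simp
  rw [reebField, reebField, reebFieldAux, reebFieldAux, normSqC2_complex_smul hc, hg, e1, eI,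
    quatJ_complex_smul, smul_comm c]
  congr 1
  generalize slope F mulI w = sI
  generalize slope F (ContinuousLinearMap.id ℝ C2) w = s1
  rw [smul_add, smul_comm c, smul_comm c (ε / _), mulI_apply, mulI_apply, mulI_apply, mulI_apply,
    smul_comm c Complex.I]
  congr 2
  have hre : ∀ x : ℂ, (x.re : ℂ) = (x + (starRingEnd ℂ) x) / 2 := fun x => by
    rw [Complex.add_conj]; push_cast; ring
  have him : ∀ x : ℂ, (x.im : ℂ) = -Complex.I * (x - (starRingEnd ℂ) x) / 2 := fun x => by
    rw [Complex.sub_conj]; push_cast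
    linear_combination (x.im : ℂ) * Complex.I_sq
  have hcoe : ∀ (r : ℝ) (v : C2), r • v = (r : ℂ) • v := fun r v => (Complex.coe_smul r v).symm
  simp only [hcoe, smul_smul, ← sub_smul]
  congr 1
  push_cast
  simp only [hre, him, map_mul, map_pow, Complex.conj_I, Complex.conj_conj]
  linear_combination (c * (sI - Complex.I * s1)) * hcc
    - (starRingEnd ℂ) c * c ^ 2 * sI * Complex.I_sq

/-- The linearization at any point of a fibre is reduced to the one at its base point z, so the
variational equation has constant coefficients. -/
lemma fderiv_reebField_complex_smul (hR : Differentiable ℝ (reebField F ε)) {c : ℂ}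
    (hc : Complex.normSq c = 1) (w v : C2) :
    fderiv ℝ (reebField F ε) (c • w) (c • v) = c • fderiv ℝ (reebField F ε) w v := by
  have h1 := (hR (complexScale c w)).hasFDerivAt.comp w (complexScale c).hasFDerivAt
  have h2 := (complexScale c).hasFDerivAt.comp w (hR w).hasFDerivAt
  have h3 : reebField F ε ∘ complexScale c = complexScale c ∘ reebField F ε := funext fun w => by
    simp only [Function.comp_apply, complexScale_apply, reebField_complex_smul hc]
  rw [h3] at h1
  have h4 := DFunLike.congr_fun (h1.unique h2) v
  simpa [complexScale_apply] using h4

/-! ### The linearized Reeb vector field over a critical point -/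

lemma reebField_of_fderiv_eq_zero {z : S3} (h0 : fderiv ℝ F (hopfExt z) = 0) :
    reebField F ε z = (2 / conformal F ε z) • mulI z := by
  rw [reebField_coe, reebFieldAux, slope, slope, h0]
  simp

/-- Since dF vanishes at the image point, only the derivative of dF survives in the product rule. -/
lemma hasFDerivAt_slope (hF : ContDiff ℝ 2 F) {z : C2} (h0 : fderiv ℝ F (hopfExt z) = 0)
    (c : C2 →L[ℝ] C2) : HasFDerivAt (slope F c)
      (((fderiv ℝ (fderiv ℝ F) (hopfExt z)).flip (hopfBilin z (c (quatJ z)))).comp (hopfBilin z))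
      z := by
  have h1 : HasFDerivAt (fderiv ℝ F) (fderiv ℝ (fderiv ℝ F) (hopfExt z)) (hopfExt z) :=
    ((hF.fderiv_right (m := 1) (by norm_num)).differentiable one_ne_zero _).hasFDerivAt
  have h2 := (h1.comp z (hasFDerivAt_hopfExt z)).clm_apply
    ((hopfBilin.hasFDerivAt (x := z)).clm_apply ((c.comp quatJ).hasFDerivAt (x := z)))
  refine h2.congr_fderiv ?_
  ext v
  simp [h0]

lemma fderiv_reebField (hF : ContDiff ℝ 2 F) {z : S3} (h0 : fderiv ℝ F (hopfExt z) = 0)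
    (hg : conformal F ε z ≠ 0) (v : C2) :
    fderiv ℝ (reebField F ε) z v = (2 / conformal F ε z) • mulI v
      + (ε / conformal F ε z ^ 2) •
        (fderiv ℝ (fderiv ℝ F) (hopfExt z) (hopfBilin z v) (hopfBilin z (mulI (quatJ z))) • quatJ z
          - fderiv ℝ (fderiv ℝ F) (hopfExt z) (hopfBilin z v) (hopfBilin z (quatJ z))
            • mulI (quatJ z)) := by
  have hev : reebField F ε =ᶠ[𝓝 (z : C2)] reebFieldAux F ε := by
    have hc : Continuous normSqC2 := (contDiff_normSqC2 (n := 0)).continuous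
    have h1 : ∀ᶠ w in 𝓝 (z : C2), 3 / 4 < normSqC2 w :=
      continuousAt_const.eventually_lt hc.continuousAt (by rw [normSqC2_coe]; norm_num)
    have h2 : ∀ᶠ w in 𝓝 (z : C2), normSqC2 w < 5 / 4 :=
      hc.continuousAt.eventually_lt continuousAt_const (by rw [normSqC2_coe]; norm_num)
    filter_upwards [h1, h2] with w hw1 hw2
    rw [reebField, bumpAtOne_eq_one hw1.le hw2.le, one_smul]
  rw [hev.fderiv_eq]
  have d0 : HasFDerivAt (conformal F ε) (0 : C2 →L[ℝ] ℝ) (z : C2) := by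
    have hFd := (hF.differentiable two_ne_zero (hopfExt z)).hasFDerivAt
    rw [h0] at hFd
    have h := ((hFd.comp (z : C2) (hasFDerivAt_hopfExt z)).const_mul ε).const_add 1
    rw [ContinuousLinearMap.zero_comp, smul_zero] at h
    exact h
  have d1 := hasFDerivAt_slope hF h0 mulI
  have d2 := hasFDerivAt_slope hF h0 (ContinuousLinearMap.id ℝ C2)
  have e1 : slope F mulI z = 0 := by rw [slope, h0]; rfl
  have e2 : slope F (ContinuousLinearMap.id ℝ C2) z = 0 := by rw [slope, h0]; rfl
  have d3 : HasFDerivAt (fun w => 2 / conformal F ε w) (0 : C2 →L[ℝ] ℝ) (z : C2) := by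
    have h := ((differentiableAt_const (2 : ℝ)).div differentiableAt_id
      hg).hasDerivAt.comp_hasFDerivAt (z : C2) d0
    rwa [smul_zero] at h
  have d4 : HasFDerivAt (fun w => ε / conformal F ε w ^ 2) (0 : C2 →L[ℝ] ℝ) (z : C2) := by
    have hd : DifferentiableAt ℝ (fun x : ℝ => ε / x ^ 2) (conformal F ε z) :=
      (differentiableAt_const ε).div (differentiableAt_id.pow 2) (pow_ne_zero 2 hg)
    have h := hd.hasDerivAt.comp_hasFDerivAt (z : C2) d0
    rwa [smul_zero] at h
  have d5 := (d3.smul (mulI.hasFDerivAt (x := (z : C2)))).add (d4.smul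
    ((d1.smul (quatJ.hasFDerivAt (x := (z : C2)))).sub
      (d2.smul ((mulI.comp quatJ).hasFDerivAt (x := (z : C2))))))
  have d6 : HasFDerivAt (reebFieldAux F ε) _ (z : C2) := d5
  rw [d6.fderiv]
  simp [e1, e2]

end Field

/-! ### The linearized Reeb flow along the fibres over critical points -/

lemma normSq_exp_mul_I (θ : ℝ) : Complex.normSq (Complex.exp (θ * Complex.I)) = 1 := by
  rw [Complex.normSq_eq_norm_sq, Complex.norm_exp_ofReal_mul_I, one_pow]

lemma hasDerivAt_exp_mul_I (κ t : ℝ) :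
    HasDerivAt (fun t : ℝ => Complex.exp ((κ * t : ℝ) * Complex.I))
      (κ • (Complex.I * Complex.exp ((κ * t : ℝ) * Complex.I))) t := by
  have h1 : HasDerivAt (fun t : ℝ => ((κ * t : ℝ) : ℂ) * Complex.I) (κ * Complex.I) t := by
    have := ((hasDerivAt_id t).const_mul κ).ofReal_comp.mul_const Complex.I
    simpa using this
  have h2 := h1.cexp
  convert h2 using 1
  rw [Complex.real_smul]
  ring

lemma frame_eq_add (z : S3) (η : Fin 2 → ℝ) :
    frame z η = η 0 • quatJ z + η 1 • mulI (quatJ z) := by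
  rw [frame_eq, add_smul, mul_smul, mulI_apply]
  rfl

/-- V₁ is antilinear, so e^{iθ}V₁(z) = e^{2iθ}V₁(e^{iθ}z). This doubling is the source of the 4k in
the index. -/
lemma frame_exp_mul_I {z w : S3} {θ : ℝ} (h : (w : C2) = Complex.exp (θ * Complex.I) • (z : C2))
    (v : Fin 2 → ℝ) : frame w ((planeRotation (2 * θ)).mulVec v)
      = Complex.exp (θ * Complex.I) • (v 0 • quatJ z + v 1 • mulI (quatJ z)) := by
  have hcoe : ∀ (r : ℝ) (v : C2), r • v = (r : ℂ) • v := fun r v => (Complex.coe_smul r v).symm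
  rw [frame_eq, h, quatJ_complex_smul, mulI_apply, hcoe, hcoe, smul_smul, smul_smul, ← add_smul,
    smul_smul]
  congr 1
  have hE : Complex.exp (θ * Complex.I) * (starRingEnd ℂ) (Complex.exp (θ * Complex.I)) = 1 := by
    rw [Complex.mul_conj, normSq_exp_mul_I]; simp
  have h2 : ((Real.cos (2 * θ) : ℝ) : ℂ) + (Real.sin (2 * θ) : ℝ) * Complex.I
      = Complex.exp (θ * Complex.I) ^ 2 := by
    rw [← Complex.exp_nat_mul, Complex.ofReal_cos, Complex.ofReal_sin, ← Complex.exp_mul_I]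
    congr 1
    push_cast
    ring
  have h3 : (((planeRotation (2 * θ)).mulVec v 0 : ℝ) : ℂ)
      + ((planeRotation (2 * θ)).mulVec v 1 : ℝ) * Complex.I
      = Complex.exp (θ * Complex.I) ^ 2 * (v 0 + v 1 * Complex.I) := by
    rw [← h2]
    simp [planeRotation, Matrix.mulVec, dotProduct, Fin.sum_univ_two]
    linear_combination (-(Complex.sin (2 * θ) * v 1)) * Complex.I_sq
  rw [h3]
  linear_combination (Complex.exp (θ * Complex.I) * (v 0 + v 1 * Complex.I)) * hE

namespace ReebData

variable {G : Subgroup SU2} {f : S2 → ℝ} {F : E3 → ℝ} {ε : ℝ}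

lemma conformal_pos (D : ReebData G f F ε) (w : C2) : 0 < conformal F ε w := D.pos _

lemma flow_eq (D : ReebData G f F ε) {Φ : ℝ → C2 → C2} (hΦ : IsAmbientFlow F ε Φ) {z : S3}
    (h0 : fderiv ℝ F (hopfExt z) = 0) (t : ℝ) :
    Φ t z = Complex.exp ((2 / conformal F ε z * t : ℝ) * Complex.I) • (z : C2) := by
  have h := D.integralCurve_eq hΦ (x := fun t : ℝ =>
    Complex.exp ((2 / conformal F ε z * t : ℝ) * Complex.I) • (z : C2)) (fun t => ?_) t
  · rw [h]; simp
  · rw [reebField_complex_smul (normSq_exp_mul_I _), reebField_of_fderiv_eq_zero h0]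
    have h1 := (hasDerivAt_exp_mul_I (2 / conformal F ε z) t).smul_const (z : C2)
    refine h1.congr_deriv ?_
    rw [mulI_apply, smul_assoc, mul_smul, smul_comm _ (2 / conformal F ε z),
      smul_comm Complex.I]

/-- The linearized Reeb flow along a fibre over a critical point, in the trivialization by the
left-invariant vector fields. -/
lemma isLinearizedFlow_flowMod (D : ReebData G f F ε) {Φ : ℝ → C2 → C2}
    (hΦ : IsAmbientFlow F ε Φ) {z : S3} (h0 : fderiv ℝ F (hopfExt z) = 0) {a b d : ℝ}
    (ha : ε / conformal F ε z ^ 2 * fderiv ℝ (fderiv ℝ F) (hopfExt z) (hopfBilin z (quatJ z))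
      (hopfBilin z (quatJ z)) = a)
    (hb : ε / conformal F ε z ^ 2 * fderiv ℝ (fderiv ℝ F) (hopfExt z) (hopfBilin z (quatJ z))
      (hopfBilin z (mulI (quatJ z))) = b)
    (hd : ε / conformal F ε z ^ 2 * fderiv ℝ (fderiv ℝ F) (hopfExt z)
      (hopfBilin z (mulI (quatJ z))) (hopfBilin z (mulI (quatJ z))) = d)
    {c s : ℝ → ℝ} (hc : ∀ t, HasDerivAt c (-(a * d - b ^ 2) * s t) t)
    (hs : ∀ t, HasDerivAt s (c t) t) (hc0 : c 0 = 1) (hs0 : s 0 = 0) :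
    IsLinearizedFlow G (D.flowMod hΦ) (projS3 G z) (fun t =>
      planeRotation (4 / conformal F ε z * t) * (c t • (1 : Matrix (Fin 2) (Fin 2) ℝ)
        + s t • hamiltonianMatrix a b d)) := by
  have hg := D.conformal_pos z
  set g := conformal F ε z with hgdef
  intro t η curve hcurve
  obtain ⟨β, p, hβ, hβ0, hβd, hp⟩ := hcurve
  obtain ⟨A, hA⟩ := dprojS3_eq_iff.1 (show dprojS3 G (triv z η) = dprojS3 G p from hp)
  have hA1 : (A : SU2) • p.1.1 = z := congrArg (fun q : TS3 => q.1.1) hA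
  have hA2 : actC2 A p.1.2 = frame z η := congrArg (fun q : TS3 => q.1.2) hA
  set v : ℝ → Fin 2 → ℝ := fun t =>
    (c t • (1 : Matrix (Fin 2) (Fin 2) ℝ) + s t • hamiltonianMatrix a b d).mulVec η with hv
  have hv0 : ∀ t, v t 0 = c t * η 0 + s t * (b * η 0 + d * η 1) := fun t => by
    simp [hv, hamiltonianMatrix, Matrix.add_mulVec, Matrix.smul_mulVec,
      Matrix.vecHead, Matrix.vecTail]
    ring
  have hv1 : ∀ t, v t 1 = c t * η 1 + s t * (-a * η 0 - b * η 1) := fun t => by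
    simp [hv, hamiltonianMatrix, Matrix.add_mulVec, Matrix.smul_mulVec,
      Matrix.vecHead, Matrix.vecTail]
    ring
  have hvd0 : ∀ t, HasDerivAt (fun t => v t 0) (b * v t 0 + d * v t 1) t := fun t => by
    simp only [hv0, hv1]
    refine (((hc t).mul_const (η 0)).add ((hs t).mul_const _)).congr_deriv ?_
    ring
  have hvd1 : ∀ t, HasDerivAt (fun t => v t 1) (-a * v t 0 - b * v t 1) t := fun t => by
    simp only [hv0, hv1]
    refine (((hc t).mul_const (η 1)).add ((hs t).mul_const _)).congr_deriv ?_
    ring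
  set E : ℝ → ℂ := fun t => Complex.exp ((2 / g * t : ℝ) * Complex.I) with hE
  -- u is the solution seen from the carried frame: its coordinates satisfy v' = Xv with X =
  -- `hamiltonianMatrix a b d`, solved by v = (c + sX)η since X² = −(ad − b²).
  set u : ℝ → C2 := fun t => v t 0 • quatJ z + v t 1 • mulI (quatJ z) with hu
  have hflow : ∀ t, Φ t z = E t • (z : C2) := D.flow_eq hΦ h0
  have hsymm : fderiv ℝ (fderiv ℝ F) (hopfExt z) (hopfBilin z (mulI (quatJ z)))
      (hopfBilin z (quatJ z)) = fderiv ℝ (fderiv ℝ F) (hopfExt z) (hopfBilin z (quatJ z))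
      (hopfBilin z (mulI (quatJ z))) :=
    (D.ext.contDiff_two.contDiffAt.isSymmSndFDerivAt (by simp)).eq _ _
  -- Differentiating E gives the summand (2/g)·i of the linearization, and differentiating u gives
  -- the Hessian summand.
  have hlin : ∀ t, HasDerivAt (fun t => E t • u t)
      (fderiv ℝ (reebField F ε) (Φ t z) (E t • u t)) t := by
    intro t
    rw [hflow, fderiv_reebField_complex_smul (D.contDiff_reebField.differentiable (by simp))
      (normSq_exp_mul_I _), fderiv_reebField D.ext.contDiff_two h0 hg.ne']
    have h1 : HasDerivAt u ((b * v t 0 + d * v t 1) • quatJ z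
        + (-a * v t 0 - b * v t 1) • mulI (quatJ z)) t :=
      ((hvd0 t).smul_const _).add ((hvd1 t).smul_const _)
    refine ((hasDerivAt_exp_mul_I (2 / g) t).smul h1).congr_deriv ?_
    have e1 : fderiv ℝ (fderiv ℝ F) (hopfExt z) (hopfBilin z (u t)) = v t 0 •
        fderiv ℝ (fderiv ℝ F) (hopfExt z) (hopfBilin z (quatJ z)) + v t 1 •
        fderiv ℝ (fderiv ℝ F) (hopfExt z) (hopfBilin z (mulI (quatJ z))) := by
      simp only [hu, map_add, map_smul]
    have e2 : (ε / g ^ 2) •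
        (fderiv ℝ (fderiv ℝ F) (hopfExt z) (hopfBilin z (u t)) (hopfBilin z (mulI (quatJ z)))
            • quatJ z
          - fderiv ℝ (fderiv ℝ F) (hopfExt z) (hopfBilin z (u t)) (hopfBilin z (quatJ z))
            • mulI (quatJ z))
        = (b * v t 0 + d * v t 1) • quatJ z + (-a * v t 0 - b * v t 1) • mulI (quatJ z) := by
      rw [e1, ← ha, ← hb, ← hd]
      simp only [add_apply, smul_apply, hsymm, smul_eq_mul]
      module
    rw [← hgdef, e2, smul_add _ ((2 / g) • mulI (u t)), add_comm]
    congr 1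
    rw [mulI_apply (u t), smul_assoc, mul_smul, smul_comm _ (2 / g), smul_comm Complex.I]
  refine ⟨fun r => hΦ.flow t ((A : SU2) • β r),
    triv (hΦ.flow t z) ((planeRotation (4 / g * t) * (c t • (1 : Matrix (Fin 2) (Fin 2) ℝ)
        + s t • hamiltonianMatrix a b d)).mulVec η), ?_, ?_, ?_, rfl⟩
  · filter_upwards [hβ] with r hr
    rw [← hr, ← flowMod_projS3 D hΦ]
    congr 1
    exact projS3_eq_iff.2 ⟨A, rfl⟩
  · show hΦ.flow t ((A : SU2) • β 0) = hΦ.flow t z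
    rw [hβ0, hA1]
  · have h1 : E t • u t = frame (hΦ.flow t z) ((planeRotation (4 / g * t) *
        (c t • (1 : Matrix (Fin 2) (Fin 2) ℝ) + s t • hamiltonianMatrix a b d)).mulVec η) := by
      rw [← Matrix.mulVec_mulVec, ← frame_exp_mul_I (z := z) (w := hΦ.flow t z)
        (θ := 2 / g * t) (hflow t)]
      congr 3
      ring
    show HasDerivAt _ (frame (hΦ.flow t z) _) 0
    rw [← h1]
    refine hasDerivAt_flow (D.contDiff_reebField.of_le ENat.LEInfty.out)
      hasCompactSupport_reebField hΦ.zero hΦ.deriv hlin (b := fun r => actC2 A (β r)) ?_ ?_ t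
    · exact (congrArg (fun q : S3 => actC2 A (q : C2)) hβ0).trans (congrArg Subtype.val hA1)
    · have h2 : E 0 • u 0 = frame z η := by
        have e0 : v 0 0 = η 0 := by rw [hv0, hc0, hs0]; ring
        have e1 : v 0 1 = η 1 := by rw [hv1, hc0, hs0]; ring
        have e2 : E 0 = 1 := by simp [hE]
        rw [e2, one_smul, frame_eq_add, ← e0, ← e1]
      rw [h2, ← hA2]
      exact (actCLM A).hasFDerivAt.comp_hasDerivAt 0 hβd

end ReebData

/-! ### The Hessian in the trivialization -/

lemma inner_hopf_hopfBilin_quatJ (z : S3) :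
    inner ℝ (hopf z : E3) (hopfBilin z (quatJ z)) = 0 := by
  rw [coe_hopf, hopfExt_apply, hopfBilin_apply, PiLp.inner_apply]
  simp [Fin.sum_univ_three, quatJ_zero, quatJ_one, Complex.normSq_apply]
  ring

lemma inner_hopf_hopfBilin_mulI_quatJ (z : S3) :
    inner ℝ (hopf z : E3) (hopfBilin z (mulI (quatJ z))) = 0 := by
  rw [coe_hopf, hopfExt_apply, hopfBilin_apply, PiLp.inner_apply]
  simp [Fin.sum_univ_three, quatJ_zero, quatJ_one, Complex.normSq_apply, mulI_apply]
  ring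

/-- The Hopf map is a homothety of factor 2 on contact planes, so V₁, V₂ map to a basis of the
tangent plane of S². -/
lemma norm_sq_hopfBilin_frame (z : S3) (x y : ℝ) :
    ‖x • hopfBilin z (quatJ z) + y • hopfBilin z (mulI (quatJ z))‖ ^ 2 = 4 * (x ^ 2 + y ^ 2) := by
  have hn := normSqC2_coe z
  rw [normSqC2_apply] at hn
  rw [EuclideanSpace.norm_sq_eq, hopfBilin_apply, hopfBilin_apply]
  simp only [quatJ_zero, quatJ_one, mulI_apply, PiLp.smul_apply, smul_eq_mul]
  generalize (z : C2) 0 = α at *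
  generalize (z : C2) 1 = β at *
  obtain ⟨p, q⟩ := α
  obtain ⟨r, s⟩ := β
  simp [Fin.sum_univ_three] at hn ⊢
  linear_combination (4 * (x ^ 2 + y ^ 2) * (p ^ 2 + q ^ 2 + (r ^ 2 + s ^ 2) + 1)) * hn

lemma hopfBilin_frame_independent (z : S3) (x y : ℝ)
    (h : x • hopfBilin z (quatJ z) + y • hopfBilin z (mulI (quatJ z)) = 0) : x = 0 ∧ y = 0 := by
  have h1 := norm_sq_hopfBilin_frame z x y
  rw [h] at h1
  simp only [norm_zero] at h1
  constructor <;> nlinarith [sq_nonneg x, sq_nonneg y]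

/-- The value of the Hessian of `F` on the images under the Hopf map of the vectors `c V₁`,
`d V₁`. -/
noncomputable def frameHessian (F : E3 → ℝ) (c d : C2 →L[ℝ] C2) (w : C2) : ℝ :=
  fderiv ℝ (fderiv ℝ F) (hopfExt w) (hopfBilin w (c (quatJ w))) (hopfBilin w (d (quatJ w)))

lemma exists_abs_frameHessian_le {F : E3 → ℝ} (hF : ContDiff ℝ 2 F) (c d : C2 →L[ℝ] C2) :
    ∃ M, ∀ z : S3, |frameHessian F c d z| ≤ M := by
  have h1 : Continuous (fderiv ℝ (fderiv ℝ F)) :=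
    (hF.fderiv_right (m := 1) (by norm_num)).continuous_fderiv one_ne_zero
  have h2 : ∀ c : C2 →L[ℝ] C2, Continuous fun w => hopfBilin w (c (quatJ w)) := fun c =>
    hopfBilin.continuous.clm_apply (c.continuous.comp quatJ.continuous)
  have h3 : Continuous (frameHessian F c d) :=
    ((h1.comp (contDiff_hopfExt (n := 0)).continuous).clm_apply (h2 c)).clm_apply (h2 d)
  obtain ⟨M, hM⟩ := (isCompact_sphere (0 : C2) 1).exists_bound_of_continuousOn h3.continuousOn
  exact ⟨M, fun z => hM z z.2⟩

/-! ### Angles of finite order -/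

/-- Modulo 2π there are only N such angles, so δ is a minimum of finitely many positive numbers;
angles with cosine 1 contribute the dummy value 1. -/
lemma exists_gap_of_finite_order {N : ℕ} (hN : 0 < N) : ∃ δ : ℝ, 0 < δ ∧ ∀ (θ : ℝ) (m : ℤ),
    N * θ = 2 * Real.pi * m → Real.cos θ = 1 ∨ Real.cos θ ≤ 1 - δ := by
  have hN' : (N : ℝ) ≠ 0 := by positivity
  have : NeZero N := ⟨hN.ne'⟩
  have h1 : ∀ j : Fin N, ∃ δ : ℝ, 0 < δ ∧
      (Real.cos (2 * Real.pi * (j : ℕ) / N) = 1 ∨ Real.cos (2 * Real.pi * (j : ℕ) / N) ≤ 1 - δ) := by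
    intro j
    rcases (Real.cos_le_one (2 * Real.pi * (j : ℕ) / N)).eq_or_lt with h | h
    · exact ⟨1, one_pos, Or.inl h⟩
    · exact ⟨1 - Real.cos (2 * Real.pi * (j : ℕ) / N), by linarith, Or.inr (by linarith)⟩
  choose δ hδ hcos using h1
  obtain ⟨j₀, hj₀⟩ := Finite.exists_min δ
  refine ⟨δ j₀, hδ j₀, fun θ m hθ => ?_⟩
  have hmod : (N : ℤ) * (m / N) + m % N = m := Int.mul_ediv_add_emod m N
  have hlt : m % N < N := Int.emod_lt_of_pos m (by exact_mod_cast hN)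
  have h0 : 0 ≤ m % N := Int.emod_nonneg m (by exact_mod_cast hN.ne')
  obtain ⟨r, hr⟩ := Int.eq_ofNat_of_zero_le h0
  rw [hr] at hmod hlt
  have hθ' : θ = 2 * Real.pi * r / N + (m / N : ℤ) * (2 * Real.pi) := by
    have : (m : ℝ) = N * (m / N : ℤ) + r := by exact_mod_cast hmod.symm
    rw [this] at hθ
    field_simp
    linarith
  rw [hθ', Real.cos_add_int_mul_two_pi]
  have h := hcos ⟨r, by exact_mod_cast hlt⟩
  exact h.imp_right fun h => h.trans (by linarith [hj₀ ⟨r, by exact_mod_cast hlt⟩])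

/-! ### Small parameters -/

/-- The perturbation parameter `ε` is small enough for the analysis of closed orbits of action
less than `L`. -/
structure IsSmall (N : ℕ) (F : E3 → ℝ) (ε L m δ : ℝ) (K : NNReal) : Prop where
  pos : 0 < ε
  half_le : ∀ x, 1 / 2 ≤ 1 + ε * F x
  lipschitz : LipschitzWith K (crossGradient F)
  lipschitz_small : 4 * ε * K * (N * L) < 1
  hessian_le : ∀ z : S3, |frameHessian F (ContinuousLinearMap.id ℝ C2)
      (ContinuousLinearMap.id ℝ C2) z| ≤ m / (4 * ε) ∧
    |frameHessian F (ContinuousLinearMap.id ℝ C2) mulI z| ≤ m / (4 * ε) ∧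
    |frameHessian F mulI mulI z| ≤ m / (4 * ε)
  small : L * m ≤ 1 / 8
  small_gap : 8 * (L * m) < 2 * δ
  gap : ∀ (θ : ℝ) (n : ℤ), N * θ = 2 * Real.pi * n → Real.cos θ = 1 ∨ Real.cos θ ≤ 1 - δ

lemma exists_isSmall {N : ℕ} (hN : 0 < N) {F : E3 → ℝ} (hF : ContDiff ℝ ∞ F)
    (hc : HasCompactSupport F) {L : ℝ} (hL : 0 < L) : ∃ ε₀ : ℝ, 0 < ε₀ ∧ ∀ ε, 0 < ε → ε ≤ ε₀ →
      ∃ m δ K, IsSmall N F ε L m δ K := by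
  have hF2 : ContDiff ℝ 2 F := hF.of_le ENat.LEInfty.out
  obtain ⟨B, hB⟩ := hF.continuous.bounded_above_of_compact_support hc
  obtain ⟨K, hK⟩ := exists_lipschitzWith_of_hasCompactSupport (contDiff_crossGradient hF)
    (hasCompactSupport_crossGradient hc)
  obtain ⟨M₁, hM₁⟩ := exists_abs_frameHessian_le hF2 (ContinuousLinearMap.id ℝ C2)
    (ContinuousLinearMap.id ℝ C2)
  obtain ⟨M₂, hM₂⟩ := exists_abs_frameHessian_le hF2 (ContinuousLinearMap.id ℝ C2) mulI
  obtain ⟨M₃, hM₃⟩ := exists_abs_frameHessian_le hF2 mulI mulI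
  obtain ⟨δ, hδ, hgap⟩ := exists_gap_of_finite_order hN
  have hev : ∀ c r : ℝ, 0 < r → ∀ᶠ ε in 𝓝[>] (0 : ℝ), ε * c < r := fun c r hr => by
    have h : Filter.Tendsto (fun ε : ℝ => ε * c) (𝓝[>] 0) (𝓝 0) := by
      have : Filter.Tendsto (fun ε : ℝ => ε * c) (𝓝 0) (𝓝 (0 * c)) :=
        (continuous_id.mul continuous_const).tendsto 0
      rw [zero_mul] at this
      exact this.mono_left nhdsWithin_le_nhds
    exact h.eventually_lt_const hr
  set M := max M₁ (max M₂ M₃) with hM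
  have hM0 : 0 ≤ M := ((abs_nonneg _).trans (hM₁ (radial 0))).trans (le_max_left _ _)
  obtain ⟨ε₀, hε₀, h1, h2, h3, h4⟩ := ((eventually_mem_nhdsWithin (a := (0 : ℝ))
    (s := Set.Ioi 0)).and <| (hev B (1 / 2) (by norm_num)).and <|
      (hev (4 * K * (N * L)) 1 one_pos).and <| (hev (4 * L * M) (1 / 8) (by norm_num)).and
        (hev (32 * L * M) (2 * δ) (by linarith))).exists
  have hε₀' : 0 < ε₀ := hε₀
  have hB0 : 0 ≤ B := (norm_nonneg _).trans (hB 0)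
  -- M bounds the Hessian of F on the frame over S³. The matrix entries carry the factor ε/g² ≤ 4ε,
  -- whence m = 4εM.
  refine ⟨ε₀, hε₀', fun ε hε hle => ⟨4 * ε * M, δ, K, ?_⟩⟩
  have hmono : ∀ c : ℝ, 0 ≤ c → ε * c ≤ ε₀ * c := fun c hc => mul_le_mul_of_nonneg_right hle hc
  have hdiv : 4 * ε * M / (4 * ε) = M := by field_simp
  refine ⟨hε, fun x => ?_, hK, ?_, fun z => ?_, ?_, ?_, hgap⟩
  · have := mul_le_mul_of_nonneg_left (neg_le_of_abs_le (hB x)) hε.le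
    linarith [hmono B hB0]
  · linarith [hmono (4 * K * (N * L)) (by positivity)]
  · rw [hdiv]
    exact ⟨(hM₁ z).trans (le_max_left _ _),
      (hM₂ z).trans ((le_max_left _ _).trans (le_max_right _ _)),
      (hM₃ z).trans ((le_max_right _ _).trans (le_max_right _ _))⟩
  · linarith [hmono (4 * L * M) (by positivity)]
  · linarith [hmono (32 * L * M) (by positivity)]

/-! ### Closed orbits of small action: nondegeneracy, closed lifts and index -/

namespace ReebData

variable {G : Subgroup SU2} {f : S2 → ℝ} {F : E3 → ℝ} {ε : ℝ}

/-- The linearized Reeb flow along a fibre over a critical point is a twisted path, whose quadratic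
form is determined by the Hessian of `f`. -/
lemma exists_isTwistedPath (D : ReebData G f F ε) (hf : IsMorse f) {N : ℕ} {L m δ : ℝ} {K : NNReal}
    (hsm : IsSmall N F ε L m δ K) {z : S3} (hz : IsCrit f (hopf z)) {T : ℝ} (hT : 0 < T)
    (hTL : T < L) : ∃ M a b d c s, IsTwistedPath M (4 / conformal F ε z) a b d T m c s ∧
      (∀ γ : ℝ → S3Mod G, γ 0 = projS3 G z → IsLinearizedReebFlow G D.form γ M) ∧
      (((∀ v : Fin 2 → ℝ, v ≠ 0 → 0 < a * v 0 ^ 2 + 2 * b * v 0 * v 1 + d * v 1 ^ 2) ∧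
        morseIndex f (hopf z) = 0) ∨
      ((∀ v : Fin 2 → ℝ, v ≠ 0 → a * v 0 ^ 2 + 2 * b * v 0 * v 1 + d * v 1 ^ 2 < 0) ∧
        morseIndex f (hopf z) = 2) ∨
      ((∃ v : Fin 2 → ℝ, v ≠ 0 ∧ a * v 0 ^ 2 + 2 * b * v 0 * v 1 + d * v 1 ^ 2 = 0) ∧
        morseIndex f (hopf z) = 1)) := by
  have hε := hsm.pos
  have h0 : fderiv ℝ F (hopfExt z) = 0 := by
    rw [← coe_hopf]; exact (D.ext.isCrit_iff hf.1 _).1 hz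
  obtain ⟨hne, hcases⟩ := D.ext.morseIndex_cases hf hz (inner_hopf_hopfBilin_quatJ z)
    (inner_hopf_hopfBilin_mulI_quatJ z) (hopfBilin_frame_independent z) rfl rfl rfl
  rw [coe_hopf] at hne hcases
  obtain ⟨ba, bb, bd⟩ := hsm.hessian_le z
  simp only [frameHessian, ContinuousLinearMap.id_apply] at ba bb bd
  set r := ε / conformal F ε z ^ 2 with hr
  set a := fderiv ℝ (fderiv ℝ F) (hopfExt z) (hopfBilin z (quatJ z)) (hopfBilin z (quatJ z))
  set b := fderiv ℝ (fderiv ℝ F) (hopfExt z) (hopfBilin z (quatJ z))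
    (hopfBilin z (mulI (quatJ z)))
  set d := fderiv ℝ (fderiv ℝ F) (hopfExt z) (hopfBilin z (mulI (quatJ z)))
    (hopfBilin z (mulI (quatJ z)))
  have hg : 1 / 2 ≤ conformal F ε z := hsm.half_le _
  have hr0 : 0 < r := by positivity
  have hr4 : r ≤ 4 * ε := by
    rw [hr, div_le_iff₀ (by positivity)]
    nlinarith [mul_le_mul hg hg (by norm_num) (by linarith)]
  have hbound : ∀ x : ℝ, |x| ≤ m / (4 * ε) → |r * x| ≤ m := fun x hx => by
    rw [abs_mul, abs_of_pos hr0]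
    calc r * |x| ≤ 4 * ε * (m / (4 * ε)) :=
          mul_le_mul hr4 hx (abs_nonneg _) (by positivity)
      _ = m := by field_simp
  -- Rescaling the Hessian by r > 0 preserves its nondegeneracy and its signature, so the Morse
  -- index can be read from the rescaled form.
  have hdet : r * a * (r * d) - (r * b) ^ 2 = r ^ 2 * (a * d - b ^ 2) := by ring
  have hdet0 : r * a * (r * d) - (r * b) ^ 2 ≠ 0 := by
    rw [hdet]; exact mul_ne_zero (by positivity) hne
  obtain ⟨c, s, hc, hs, hc0, hs0, hsq, hest⟩ := exists_trig_pair _ hdet0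
  have hm0 : 0 ≤ m := (abs_nonneg _).trans (hbound a ba)
  obtain ⟨Φ, hΦ⟩ := D.exists_ambientFlow
  refine ⟨_, r * a, r * b, r * d, c, s, ⟨fun t => rfl,
    continuous_iff_continuousAt.2 fun t => (hc t).continuousAt,
    continuous_iff_continuousAt.2 fun t => (hs t).continuousAt, hc0, hs0, hsq, hest, hT,
    hbound a ba, hbound b bb, hbound d bd,
    (mul_le_mul_of_nonneg_right hTL.le hm0).trans hsm.small⟩, fun γ hγ => ?_, ?_⟩
  · refine ⟨D.flowMod hΦ, D.isReebFlow_flowMod hΦ, ?_⟩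
    rw [hγ]
    exact D.isLinearizedFlow_flowMod hΦ h0 rfl rfl rfl hc hs hc0 hs0
  · have hscale : ∀ v : Fin 2 → ℝ, r * a * v 0 ^ 2 + 2 * (r * b) * v 0 * v 1 + r * d * v 1 ^ 2
        = r * (a * v 0 ^ 2 + 2 * b * v 0 * v 1 + d * v 1 ^ 2) := fun v => by ring
    simp only [hscale]
    rcases hcases with ⟨h, hi⟩ | ⟨h, hi⟩ | ⟨⟨v, hv, h⟩, hi⟩
    · exact Or.inl ⟨fun v hv => mul_pos hr0 (h v hv), hi⟩
    · exact Or.inr (Or.inl ⟨fun v hv => mul_neg_of_pos_of_neg hr0 (h v hv), hi⟩)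
    · exact Or.inr (Or.inr ⟨⟨v, hv, by rw [h, mul_zero]⟩, hi⟩)

lemma conformal_coe (D : ReebData G f F ε) (z : S3) :
    conformal F ε z = 1 + ε * f (hopf z) := by
  rw [conformal, ← coe_hopf, D.ext.coe_eq]

lemma coe_fiberOrbit (D : ReebData G f F ε) (z : S3) (t : ℝ) : (fiberOrbit f ε z t : C2)
    = Complex.exp ((2 / conformal F ε z * t : ℝ) * Complex.I) • (z : C2) := by
  rw [D.conformal_coe, div_mul_eq_mul_div]
  rfl

/-- A lift of a Reeb orbit that meets the fibre over a critical point follows this fibre. -/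
lemma lift_eq_fiberOrbit (D : ReebData G f F ε) [Finite G] {γ : ℝ → S3Mod G}
    (hγ : IsReebTrajectory G D.form γ) {β : ℝ → S3} (hβ : Continuous β)
    (hlift : ∀ s, projS3 G (β s) = γ s) (h0 : fderiv ℝ F (hopf (β 0)) = 0) (t : ℝ) :
    β t = fiberOrbit f ε (β 0) t := by
  obtain ⟨Φ, hΦ⟩ := D.exists_ambientFlow
  apply Subtype.ext
  rw [D.coe_fiberOrbit, ← D.flow_eq hΦ (by rwa [← coe_hopf])]
  exact D.integralCurve_eq hΦ (D.hasDerivAt_lift hγ hβ hlift) t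

lemma hopf_fiberOrbit (D : ReebData G f F ε) (z : S3) (t : ℝ) :
    hopf (fiberOrbit f ε z t) = hopf z := by
  apply Subtype.ext
  rw [coe_hopf, coe_hopf, D.coe_fiberOrbit, hopfExt_complex_smul (normSq_exp_mul_I _)]

lemma exists_int_of_fiberOrbit_eq (D : ReebData G f F ε) {z : S3} {t : ℝ}
    (h : fiberOrbit f ε z t = z) : ∃ n : ℤ, 2 / conformal F ε z * t = 2 * Real.pi * n := by
  have h1 := congrArg Subtype.val h
  rw [D.coe_fiberOrbit] at h1
  have hz : (z : C2) ≠ 0 := fun hz => by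
    have := normSqC2_coe z
    rw [hz, normSqC2_eq] at this
    norm_num at this
  have h2 : Complex.exp ((2 / conformal F ε z * t : ℝ) * Complex.I) = 1 :=
    smul_left_injective ℂ hz (h1.trans (one_smul ℂ _).symm)
  obtain ⟨n, hn⟩ := Complex.exp_eq_one_iff.1 h2
  refine ⟨n, ?_⟩
  have h3 : ((2 / conformal F ε z * t : ℝ) : ℂ) = (2 * Real.pi * n : ℝ) := by
    refine mul_right_cancel₀ Complex.I_ne_zero (hn.trans ?_)
    push_cast
    ring
  exact_mod_cast h3

lemma isNondegenerateOrbit (D : ReebData G f F ε) [Finite G] (hf : IsMorse f) {L m δ : ℝ}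
    {K : NNReal} (hsm : IsSmall (Nat.card G) F ε L m δ K) {γ : ℝ → S3Mod G} {T : ℝ}
    (hγ : IsReebOrbit G D.form γ T) (hTL : T < L) {β : ℝ → S3} (hβ : Continuous β)
    (hlift : ∀ s, projS3 G (β s) = γ s) (h0 : fderiv ℝ F (hopf (β 0)) = 0) :
    IsNondegenerateOrbit G D.form γ T := by
  obtain ⟨M, a, b, d, c, s, hM, hlin, -⟩ :=
    D.exists_isTwistedPath hf hsm ((D.ext.isCrit_iff hf.1 _).2 h0) hγ.1 hTL
  refine ⟨M, hlin γ (hlift 0).symm, ?_⟩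
  obtain ⟨A, hA, hdeck⟩ := D.exists_deck hγ hβ hlift
  have hclosed : fiberOrbit f ε (β 0) (Nat.card G * T) = β 0 := by
    rw [← D.lift_eq_fiberOrbit hγ.2.2 hβ hlift h0, ← zero_add (_ * T), deck_iterate hdeck,
      pow_card_eq_one hA, one_smul]
  obtain ⟨n, hn⟩ := D.exists_int_of_fiberOrbit_eq hclosed
  -- The fibre closes up after |G|T, with n turns of e^{2it/g}; the frame turns twice as fast. So
  -- the rotation angle at time T has finite order and the gap applies.
  have hangle : (Nat.card G : ℝ) * (4 / conformal F ε (β 0) * T) = 2 * Real.pi * (2 * n : ℤ) := by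
    push_cast
    linear_combination 2 * hn
  rcases hsm.gap _ _ hangle with h | h
  · exact hM.one_notMem_spectrum_of_cos_eq_one h
  · refine hM.one_notMem_spectrum_of_cos_lt ?_
    have := mul_le_mul_of_nonneg_right hTL.le hM.m_nonneg
    linarith [hsm.small_gap]

lemma exists_liftsToFiberOrbit (D : ReebData G f F ε) [Finite G] {γ : ℝ → S3Mod G} {T : ℝ}
    (hγ : IsReebOrbit G D.form γ T) {β : ℝ → S3} (hβ : Continuous β)
    (hlift : ∀ s, projS3 G (β s) = γ s) (h0 : fderiv ℝ F (hopf (β 0)) = 0)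
    (hper : Function.Periodic β T) :
    ∃ k : ℕ, 1 ≤ k ∧ LiftsToFiberOrbit G f ε γ T (β 0) k := by
  have horbit := D.lift_eq_fiberOrbit hγ.2.2 hβ hlift h0
  obtain ⟨n, hn⟩ := D.exists_int_of_fiberOrbit_eq ((horbit T).symm.trans hper.eq)
  have hg := D.conformal_pos (β 0)
  have hn0 : 0 < n := by
    have h1 : 0 < 2 * Real.pi * n := by
      rw [← hn]; have := hγ.1; positivity
    have h2 : (0 : ℝ) < n := pos_of_mul_pos_right h1 (by positivity)
    exact_mod_cast h2
  obtain ⟨k, rfl⟩ := Int.eq_ofNat_of_zero_le hn0.le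
  refine ⟨k, by exact_mod_cast hn0, ?_, fun t => ?_⟩
  · rw [← D.conformal_coe]
    field_simp at hn
    push_cast at hn
    linear_combination hn
  · rw [← horbit, hlift]

/-- Going k times round the fibre takes time kπg, during which the rotation at speed 4/g makes 2k
full turns. The three cases of the Hessian then shift 2·2k by −1, 0 or 1. -/
lemma hasConleyZehnderIndex (D : ReebData G f F ε) (hf : IsMorse f) {N : ℕ} {L m δ : ℝ}
    {K : NNReal} (hsm : IsSmall N F ε L m δ K) {γ : ℝ → S3Mod G} {T : ℝ} (hT : 0 < T)
    (hTL : T < L) {z : S3} (hz : IsCrit f (hopf z)) {k : ℕ}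
    (hk : LiftsToFiberOrbit G f ε γ T z k) :
    HasConleyZehnderIndex G D.form γ T (4 * k + morseIndex f (hopf z) - 1) := by
  obtain ⟨M, a, b, d, c, s, hM, hlin, hcases⟩ := D.exists_isTwistedPath hf hsm hz hT hTL
  have hγ0 : γ 0 = projS3 G z := by
    rw [hk.2]
    congr 1
    apply Subtype.ext
    rw [D.coe_fiberOrbit]
    simp
  refine ⟨M, hlin γ hγ0, ?_⟩
  have hg := D.conformal_pos z
  have hangle : 4 / conformal F ε z * T = 2 * Real.pi * (2 * k : ℤ) := by
    rw [hk.1, ← D.conformal_coe]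
    push_cast
    field_simp
    ring
  rcases hcases with ⟨h, hi⟩ | ⟨h, hi⟩ | ⟨⟨v, hv, h⟩, hi⟩
  · rw [hM.conleyZehnder_eq_of_posDef hangle h, hi]
    push_cast
    ring
  · rw [hM.conleyZehnder_eq_of_negDef hangle h, hi]
    push_cast
    ring
  · rw [hM.conleyZehnder_eq_of_isotropic hangle hv h, hi]
    push_cast
    ring

end ReebData

end SphereQuotient

/-! ### The theorem -/

open SphereQuotient

theorem lemma2p9 (G : Subgroup SU2) [Finite G] (f : S2 → ℝ) (hf : IsMorse f)
    (hinv : ∀ h ∈ G.map P, ∀ x : S2, f (h • x) = f x) (L : ℝ) (hL : 0 < L) :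
    ∃ ε₀ : ℝ, 0 < ε₀ ∧ ∀ ε : ℝ, 0 < ε → ε ≤ ε₀ →
      ∀ (γ : ℝ → S3Mod G) (T : ℝ),
        IsReebOrbit G (perturbedForm G (descend (G.map P) f hinv) ε) γ T → T < L →
          IsNondegenerateOrbit G (perturbedForm G (descend (G.map P) f hinv) ε) γ T ∧
          (∃ q, IsOrbifoldCrit (G.map P) f q ∧ ∀ t, seifert G (γ t) = q) ∧
          (IsContractibleLoop G γ T →
            (∃ (p : S2) (z : S3) (k : ℕ), IsCrit f p ∧ hopf z = p ∧ 1 ≤ k ∧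
              LiftsToFiberOrbit G f ε γ T z k) ∧
            ∀ (p : S2) (z : S3) (k : ℕ), IsCrit f p → hopf z = p → 1 ≤ k →
              LiftsToFiberOrbit G f ε γ T z k →
                HasConleyZehnderIndex G (perturbedForm G (descend (G.map P) f hinv) ε) γ T
                  (4 * k + morseIndex f p - 1)) := by
  have hext := isRadialExtension_radialExtension hf.1
  obtain ⟨ε₀, hε₀, hsmall⟩ := exists_isSmall (N := Nat.card G) Nat.card_pos hext.smooth
    hext.compact hL
  refine ⟨ε₀, hε₀, fun ε hε hle γ T hγ hTL => ?_⟩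
  obtain ⟨m, δ, K, hsm⟩ := hsmall ε hε hle
  have D : ReebData G f (radialExtension f) ε :=
    { ext := hext
      inv := hinv
      inv_ext := fun A hA x => radialExtension_mulVec (hinv _ (Subgroup.mem_map_of_mem P hA)) x
      pos := fun x => by linarith [hsm.half_le x] }
  have hKT : 4 * ε * K * (Nat.card G * T) < 1 := by
    refine lt_of_le_of_lt ?_ hsm.lipschitz_small
    gcongr
  -- Stated for all lifts, because the contractible case uses a closed lift that need not be the one
  -- chosen for the other conclusions.
  have hcrit : ∀ β : ℝ → S3, Continuous β → (∀ s, projS3 G (β s) = γ s) →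
      fderiv ℝ (radialExtension f) (hopf (β 0)) = 0 := fun β hβ hlift =>
    D.fderiv_eq_zero_of_isReebOrbit hγ hβ hlift hsm.lipschitz hε hsm.half_le hKT
  obtain ⟨β, hβ, hlift⟩ := D.exists_lift hγ.2.2
  refine ⟨D.isNondegenerateOrbit hf hsm hγ hTL hβ hlift (hcrit β hβ hlift),
    ⟨projS2 (G.map P) (hopf (β 0)), ⟨hopf (β 0),
      (hext.isCrit_iff hf.1 _).2 (hcrit β hβ hlift), rfl⟩, fun t => ?_⟩, fun hcontr => ⟨?_, ?_⟩⟩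
  · rw [← hlift t, D.lift_eq_fiberOrbit hγ.2.2 hβ hlift (hcrit β hβ hlift) t]
    exact congrArg (projS2 (G.map P)) (D.hopf_fiberOrbit _ t)
  · obtain ⟨β', hβ', hper, hlift'⟩ := hcontr.exists_lift
    obtain ⟨k, hk1, hk⟩ := D.exists_liftsToFiberOrbit hγ hβ' hlift' (hcrit β' hβ' hlift') hper
    exact ⟨hopf (β' 0), β' 0, k, (hext.isCrit_iff hf.1 _).2 (hcrit β' hβ' hlift'), rfl, hk1, hk⟩
  · rintro p z k hp rfl - hk
    exact D.hasConleyZehnderIndex hf hsm hγ.1 hTL hp hk
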